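/- Let $k$ be an algebraically closed field and let $\Lambda$ be a finite-dimensional $k$-algebra with $k$-dual bimodule $D\Lambda=\mathrm{Hom}_k(\Lambda,k)$, where $(a'\varphi a'')(a)=\varphi(a''aa')$. Let $\widehat\Lambda=\big(\bigoplus_{i\in\mathbb Z}\Lambda\big)\oplus\big(\bigoplus_{i\in\mathbb Z}D\Lambda\big)$ be its repetitive algebra, a $k$-algebra without unit whose product is $$(a_i,\varphi_i)_i\cdot(b_i,\psi_i)_i=(a_ib_i,\;a_{i+1}\psi_i+\varphi_ib_i)_i .$$ Let $\widehat\Lambda\text{-mod}$ be the abelian category of finite-dimensional left $\widehat\Lambda$-modules $M$ with $\widehat\Lambda M=M$, and let $\widehat V$ be an object of it. Let $\widehat{\mathcal C}$ be the category of complete local commutative Noetherian $k$-algebras with residue field $k$; its morphisms are the continuous $k$-algebra homomorphisms which induce the identity on $k$. A lift of $\widehat V$ over $R\in\widehat{\mathcal C}$ is a finitely generated $R\otimes_k\widehat\Lambda$-module $\widehat M$ which is free over $R$, together with an isomorphism $\widehat\phi:k\otimes_R\widehat M\to\widehat V$ of $\widehat\Lambda$-modules. Two lifts $(\widehat M,\widehat\phi)$,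 $(\widehat M',\widehat\phi')$ are isomorphic if there is an isomorphism $\widehat\alpha:\widehat M\to\widehat M'$ of $R\otimes_k\widehat\Lambda$-modules with $\widehat\phi'\circ(\mathrm{id}_k\otimes\widehat\alpha)=\widehat\phi$. Let $\widehat{\mathrm F}:\widehat{\mathcal C}\to\mathrm{Sets}$ be the functor that sends $R$ to the set of isomorphism classes $[\widehat M,\widehat\phi]$ of lifts of $\widehat V$ over $R$, and $\theta:R\to R'$ to the map $[\widehat M,\widehat\phi]\mapsto[R'\otimes_{R,\theta}\widehat M,\widehat\phi_\theta]$, where $\widehat\phi_\theta$ is the composition $k\otimes_{R'}(R'\otimes_{R,\theta}\widehat M)\cong k\otimes_R\widehat M\xrightarrow{\widehat\phi}\widehat V$. Let $\mathrm F$ be the restriction of $\widehat{\mathrm F}$ to the Artinian objects, and let $k[\epsilon]$, $\epsilon^2=0$, be the ring of dual numbers. A pair $(R,\xi)$ with $R\in\widehat{\mathcal C}$ and $\xi\in\widehat{\mathrm F}(R)$ is called a pro-representable hull of $\mathrm F$ if the natural transformation $\mathrm{Hom}_{\widehat{\mathcal C}}(R,-)\to\mathrm F$, $u\mapsto\widehat{\mathrm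 F}(u)(\xi)$, on Artinian objects is smooth (for every surjection $B\to A$ of Artinian objects the map $\mathrm{Hom}_{\widehat{\mathcal C}}(R,B)\to\mathrm{Hom}_{\widehat{\mathcal C}}(R,A)\times_{\mathrm F(A)}\mathrm F(B)$ is surjective) and is bijective on $k[\epsilon]$. Then: 1. $\mathrm F$ has a pro-representable hull. 2. $\widehat{\mathrm F}$ is continuous: for every $R\in\widehat{\mathcal C}$ with maximal ideal $\mathfrak m_R$, the natural map $\widehat{\mathrm F}(R)\to\varprojlim_{i\ge1}\widehat{\mathrm F}(R/\mathfrak m_R^i)$ is bijective. 3. The natural map $\mathrm F(k[\epsilon]\times_kk[\epsilon])\to\mathrm F(k[\epsilon])\times\mathrm F(k[\epsilon])$ is bijective, so that the tangent space $t_{\widehat V}=\mathrm F(k[\epsilon])$ carries the canonical $k$-vector space structure (addition is induced by $a+b\epsilon_1+c\epsilon_2\mapsto a+(b+c)\epsilon$, multiplication by $c\in k$ by $a+b\epsilon\mapsto a+cb\epsilon$), and with this structure there is an isomorphism of $k$-vector spaces $t_{\widehat V}\cong\mathrm{Ext}^1_{\widehat\Lambda}(\widehat V,\widehat V)$, where $\mathrm{Ext}^1$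 is taken in $\widehat\Lambda\text{-mod}$. 4. Suppose that $\underline{\mathrm{End}}_{\widehat\Lambda}(\widehat V)=k$, i.e. the canonical map from $k$ to the quotient of $\mathrm{End}_{\widehat\Lambda}(\widehat V)$ by the endomorphisms which factor through a projective object of $\widehat\Lambda\text{-mod}$ is bijective. Then every pro-representable hull $(R,\xi)$ of $\mathrm F$ represents $\widehat{\mathrm F}$: for all $A\in\widehat{\mathcal C}$ the map $\mathrm{Hom}_{\widehat{\mathcal C}}(R,A)\to\widehat{\mathrm F}(A)$, $u\mapsto\widehat{\mathrm F}(u)(\xi)$, is bijective. That is, $R$ is a universal deformation ring of $\widehat V$. -/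

import Mathlib

open CategoryTheory TensorProduct IsLocalRing

universe u

section RepetitiveAlgebra

variable (k Λ : Type u) [Field k] [Ring Λ] [Algebra k Λ]

/-- The underlying vector space `(⨁_{i ∈ ℤ} Λ) ⊕ (⨁_{i ∈ ℤ} DΛ)` of the repetitive algebra of `Λ`,
where `DΛ = Hom_k(Λ, k)`.  An element is a pair of finitely supported families
`(a_i)_i` (in `Λ`) and `(φ_i)_i` (in `DΛ`). -/
def RepetitiveAlgebra : Type u := (ℤ →₀ Λ) × (ℤ →₀ Module.Dual k Λ)

namespace RepetitiveAlgebra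

variable {k Λ}

noncomputable instance : AddCommGroup (RepetitiveAlgebra k Λ) :=
  inferInstanceAs (AddCommGroup ((ℤ →₀ Λ) × (ℤ →₀ Module.Dual k Λ)))

noncomputable instance : Module k (RepetitiveAlgebra k Λ) :=
  inferInstanceAs (Module k ((ℤ →₀ Λ) × (ℤ →₀ Module.Dual k Λ)))

/-- The left action of `Λ` on `DΛ`: `(a φ)(x) = φ (x a)`. -/
noncomputable def dualLeft (a : Λ) (φ : Module.Dual k Λ) : Module.Dual k Λ :=
  φ ∘ₗ LinearMap.mulRight k a

/-- The right action of `Λ` on `DΛ`: `(φ a)(x) = φ (a x)`. -/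
noncomputable def dualRight (φ : Module.Dual k Λ) (a : Λ) : Module.Dual k Λ :=
  φ ∘ₗ LinearMap.mulLeft k a

@[simp] theorem dualLeft_apply (a : Λ) (φ : Module.Dual k Λ) (x : Λ) :
    dualLeft a φ x = φ (x * a) := rfl

@[simp] theorem dualRight_apply (φ : Module.Dual k Λ) (a : Λ) (x : Λ) :
    dualRight φ a x = φ (a * x) := rfl

/-- The product
`(a_i, φ_i)_i * (b_i, ψ_i)_i = (a_i b_i, a_{i+1} ψ_i + φ_i b_i)_i`. -/
noncomputable instance : Mul (RepetitiveAlgebra k Λ) where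
  mul x y :=
    (Finsupp.zipWith (· * ·) (mul_zero 0) x.1 y.1,
     Finsupp.onFinset (x.2.support ∪ y.2.support)
      (fun i => dualLeft (x.1 (i + 1)) (y.2 i) + dualRight (x.2 i) (y.1 i)) (by
        intro i hi
        by_contra h
        simp only [Finset.mem_union, Finsupp.mem_support_iff, not_or, not_not] at h
        apply hi
        ext z
        simp [h.1, h.2]))

@[ext] theorem ext {x y : RepetitiveAlgebra k Λ} (h₁ : ∀ i, x.1 i = y.1 i)
    (h₂ : ∀ i z, x.2 i z = y.2 i z) : x = y :=
  Prod.ext (Finsupp.ext h₁) (Finsupp.ext fun i => LinearMap.ext (h₂ i))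

@[simp] theorem mul_fst_apply (x y : RepetitiveAlgebra k Λ) (i : ℤ) :
    (x * y).1 i = x.1 i * y.1 i := rfl

@[simp] theorem mul_snd_apply (x y : RepetitiveAlgebra k Λ) (i : ℤ) :
    (x * y).2 i = dualLeft (x.1 (i + 1)) (y.2 i) + dualRight (x.2 i) (y.1 i) := rfl

@[simp] theorem add_fst_apply (x y : RepetitiveAlgebra k Λ) (i : ℤ) :
    (x + y).1 i = x.1 i + y.1 i := rfl

@[simp] theorem add_snd_apply (x y : RepetitiveAlgebra k Λ) (i : ℤ) :
    (x + y).2 i = x.2 i + y.2 i := rfl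

@[simp] theorem zero_fst_apply (i : ℤ) : (0 : RepetitiveAlgebra k Λ).1 i = 0 := rfl

@[simp] theorem zero_snd_apply (i : ℤ) : (0 : RepetitiveAlgebra k Λ).2 i = 0 := rfl

@[simp] theorem smul_fst_apply (c : k) (x : RepetitiveAlgebra k Λ) (i : ℤ) :
    (c • x).1 i = c • x.1 i := rfl

@[simp] theorem smul_snd_apply (c : k) (x : RepetitiveAlgebra k Λ) (i : ℤ) :
    (c • x).2 i = c • x.2 i := rfl

noncomputable instance : NonUnitalRing (RepetitiveAlgebra k Λ) :=
  { (inferInstance : AddCommGroup (RepetitiveAlgebra k Λ)) with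
    mul := (· * ·)
    left_distrib := fun x y z => by
      ext i <;> simp [mul_add, add_mul]
      abel
    right_distrib := fun x y z => by
      ext i <;> simp [mul_add, add_mul]
      abel
    zero_mul := fun x => by ext i <;> simp
    mul_zero := fun x => by ext i <;> simp
    mul_assoc := fun x y z => by
      ext i <;> simp [mul_assoc]
      abel }

instance : IsScalarTower k (RepetitiveAlgebra k Λ) (RepetitiveAlgebra k Λ) where
  smul_assoc c x y := by ext i <;> simp

instance : SMulCommClass k (RepetitiveAlgebra k Λ) (RepetitiveAlgebra k Λ) where
  smul_comm c x y := by ext i <;> simp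

/-- The idempotent `∑_{|i| ≤ n} 1_i` of the repetitive algebra. -/
noncomputable def localUnit (n : ℕ) : RepetitiveAlgebra k Λ :=
  (Finsupp.indicator (Finset.Icc (-(n : ℤ)) n) (fun _ _ => (1 : Λ)), 0)

theorem exists_localUnit_mul (x : RepetitiveAlgebra k Λ) :
    ∃ N : ℕ, ∀ n, N ≤ n → localUnit n * x = x := by
  classical
  obtain ⟨N, hN⟩ : ∃ N : ℕ, ∀ i ∈ x.1.support ∪ x.2.support, i.natAbs ≤ N :=
    ⟨(x.1.support ∪ x.2.support).sup Int.natAbs, fun i hi => Finset.le_sup (f := Int.natAbs) hi⟩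
  refine ⟨N + 1, fun n hn => ?_⟩
  have key : ∀ i : ℤ, i.natAbs ≤ N + 1 → (localUnit n : RepetitiveAlgebra k Λ).1 i = 1 := by
    intro i hi
    have : i ∈ Finset.Icc (-(n : ℤ)) n := by
      rw [Finset.mem_Icc]; omega
    simp [localUnit, Finsupp.indicator, this, -Finset.mem_Icc]
  have h0 : ∀ i, (localUnit n : RepetitiveAlgebra k Λ).2 i = 0 := fun i => rfl
  ext i z
  · by_cases hi : x.1 i = 0
    · simp [hi]
    · have := hN i (by simp [hi])
      simp [key i (by omega)]
  · by_cases hi : x.2 i = 0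
    · simp [hi, h0]
    · have := hN i (by simp [hi])
      simp [key (i + 1) (by omega), h0]

end RepetitiveAlgebra

end RepetitiveAlgebra

section RepMod

open scoped ModuleCat

variable (k Λ : Type u) [Field k] [Ring Λ] [Algebra k Λ]

/-- The unital `k`-algebra `k ⊕ Λ̂` obtained by adjoining a unit to the repetitive algebra.  Its
(unital) modules are the same as the `k`-vector spaces with an action of the non-unital
`k`-algebra `Λ̂`. -/
abbrev RepetitiveAlgebraUnit : Type u := Unitization k (RepetitiveAlgebra k Λ)

/-- The condition on a `k`-vector space `M` with an action of `Λ̂` to be an object of `Λ̂`-mod: it is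
finite dimensional over `k` and `Λ̂ M = M` (the condition which replaces "`1` acts as the identity"
since `Λ̂` has no unit). -/
def isRepMod : ObjectProperty (ModuleCat.{u} (RepetitiveAlgebraUnit k Λ)) := fun M =>
  Module.Finite k M ∧
    Submodule.span k {m : M | ∃ (x : RepetitiveAlgebra k Λ) (m' : M),
      m = (Unitization.inr x : RepetitiveAlgebraUnit k Λ) • m'} = ⊤

/-- The category `Λ̂`-mod of finite dimensional `Λ̂`-modules. -/
abbrev RepMod : Type (u + 1) := (isRepMod k Λ).FullSubcategory

variable {k Λ}

theorem span_action_eq_top_iff (M : ModuleCat.{u} (RepetitiveAlgebraUnit k Λ)) :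
    Submodule.span k {m : M | ∃ (x : RepetitiveAlgebra k Λ) (m' : M),
      m = (Unitization.inr x : RepetitiveAlgebraUnit k Λ) • m'} = ⊤ ↔
    ∀ m : M, ∃ x : RepetitiveAlgebra k Λ,
      (Unitization.inr x : RepetitiveAlgebraUnit k Λ) • m = m := by
  constructor
  · intro h m
    have hm : m ∈ (⊤ : Submodule k M) := trivial
    rw [← h] at hm
    suffices ∃ N : ℕ, ∀ n, N ≤ n → (Unitization.inr (RepetitiveAlgebra.localUnit n) :
        RepetitiveAlgebraUnit k Λ) • m = m from ⟨_, this.choose_spec _ le_rfl⟩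
    induction hm using Submodule.span_induction with
    | mem m hm =>
      obtain ⟨x, m', rfl⟩ := hm
      obtain ⟨N, hN⟩ := RepetitiveAlgebra.exists_localUnit_mul x
      refine ⟨N, fun n hn => ?_⟩
      rw [smul_smul, ← Unitization.inr_mul, hN n hn]
    | zero => exact ⟨0, fun n _ => smul_zero _⟩
    | add a b _ _ ha hb =>
      obtain ⟨N, hN⟩ := ha
      obtain ⟨N', hN'⟩ := hb
      exact ⟨max N N', fun n hn => by
        rw [smul_add, hN n (le_trans (le_max_left _ _) hn),
          hN' n (le_trans (le_max_right _ _) hn)]⟩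
    | smul c a _ ha =>
      obtain ⟨N, hN⟩ := ha
      exact ⟨N, fun n hn => by rw [smul_comm, hN n hn]⟩
  · intro h
    rw [eq_top_iff]
    intro m _
    obtain ⟨x, hx⟩ := h m
    exact Submodule.subset_span ⟨x, m, hx.symm⟩

theorem isRepMod_iff (M : ModuleCat.{u} (RepetitiveAlgebraUnit k Λ)) :
    isRepMod k Λ M ↔ Module.Finite k M ∧ ∀ m : M, ∃ x : RepetitiveAlgebra k Λ,
      (Unitization.inr x : RepetitiveAlgebraUnit k Λ) • m = m := by
  rw [← span_action_eq_top_iff]; rfl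

theorem isRepMod_of_injective {M N : ModuleCat.{u} (RepetitiveAlgebraUnit k Λ)} (f : M ⟶ N)
    (hf : Function.Injective f) (hN : isRepMod k Λ N) : isRepMod k Λ M := by
  rw [isRepMod_iff] at hN ⊢
  obtain ⟨h₁, h₂⟩ := hN
  refine ⟨Module.Finite.of_injective (f.hom.restrictScalars k) hf, fun m => ?_⟩
  obtain ⟨x, hx⟩ := h₂ (f m)
  exact ⟨x, hf (by rw [← hx]; exact map_smul f.hom _ _)⟩

theorem isRepMod_of_surjective {M N : ModuleCat.{u} (RepetitiveAlgebraUnit k Λ)} (f : M ⟶ N)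
    (hf : Function.Surjective f) (hM : isRepMod k Λ M) : isRepMod k Λ N := by
  rw [isRepMod_iff] at hM ⊢
  obtain ⟨h₁, h₂⟩ := hM
  refine ⟨Module.Finite.of_surjective (f.hom.restrictScalars k) hf, fun n => ?_⟩
  obtain ⟨m, rfl⟩ := hf n
  obtain ⟨x, hx⟩ := h₂ m
  exact ⟨x, by conv_rhs => rw [← hx]
               exact (map_smul f.hom _ _).symm⟩

instance : (isRepMod k Λ).ContainsZero where
  exists_zero := ⟨ModuleCat.of _ PUnit, ModuleCat.isZero_of_subsingleton _, by
    rw [isRepMod_iff]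
    exact ⟨inferInstance, fun m => ⟨0, Subsingleton.elim _ _⟩⟩⟩

instance : (isRepMod k Λ).IsClosedUnderSubobjects where
  prop_of_mono f _ h := isRepMod_of_injective f ((ModuleCat.mono_iff_injective f).1 inferInstance) h

instance : (isRepMod k Λ).IsClosedUnderQuotients where
  prop_of_epi f _ h := isRepMod_of_surjective f ((ModuleCat.epi_iff_surjective f).1 inferInstance) h

theorem isRepMod_prod {M N : ModuleCat.{u} (RepetitiveAlgebraUnit k Λ)} (hM : isRepMod k Λ M)
    (hN : isRepMod k Λ N) :
    isRepMod k Λ (ModuleCat.of (RepetitiveAlgebraUnit k Λ) (M × N)) := by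
  rw [isRepMod_iff] at hM hN
  obtain ⟨h₁, h₂⟩ := hM
  obtain ⟨h₁', h₂'⟩ := hN
  refine ⟨Module.Finite.prod (R := k) (M := M) (N := N), ?_⟩
  rw [eq_top_iff]
  rintro ⟨m, n⟩ _
  obtain ⟨x, hx⟩ := h₂ m
  obtain ⟨y, hy⟩ := h₂' n
  have : ((m, n) : M × N) = (m, 0) + (0, n) := by simp
  rw [this]
  refine Submodule.add_mem _ (Submodule.subset_span ⟨x, (m, 0), ?_⟩)
    (Submodule.subset_span ⟨y, (0, n), ?_⟩)
  · exact Prod.ext hx.symm (smul_zero _).symm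
  · exact Prod.ext (smul_zero _).symm hy.symm

instance : (isRepMod k Λ).IsClosedUnderBinaryProducts where
  limitsOfShape_le := by
    rintro X ⟨p⟩
    exact (isRepMod k Λ).prop_of_iso
      ((ModuleCat.binaryProductLimitCone _ _).isLimit.conePointsIsoOfNatIso p.isLimit
        (Limits.diagramIsoPair p.diag).symm)
      (isRepMod_prod (p.prop_diag_obj _) (p.prop_diag_obj _))

instance : (isRepMod k Λ).IsClosedUnderFiniteProducts :=
  ObjectProperty.IsClosedUnderFiniteProducts.mk'


instance : HasExt.{u + 1} (RepMod k Λ) := HasExt.standard _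

end RepMod

section CHat

/-- An object of the category `Ĉ`: a complete local commutative Noetherian `k`-algebra with residue
field `k`. -/
structure CHat (k : Type u) [Field k] where
  carrier : Type u
  [commRing : CommRing carrier]
  [algebra : Algebra k carrier]
  [isLocalRing : IsLocalRing carrier]
  [isNoetherianRing : IsNoetherianRing carrier]
  [isAdicComplete : IsAdicComplete (maximalIdeal carrier) carrier]
  residue_bijective : Function.Bijective (algebraMap k (ResidueField carrier))

namespace CHat

attribute [instance] commRing algebra isLocalRing isNoetherianRing isAdicComplete

variable {k : Type u} [Field k]

instance : CoeSort (CHat k) (Type u) := ⟨CHat.carrier⟩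

/-- The residue map `R → R / m_R = k` of an object of `Ĉ`. -/
noncomputable def aug (R : CHat k) : R →ₐ[k] k where
  __ := (RingEquiv.ofBijective _ R.residue_bijective).symm.toRingHom.comp (residue R)
  commutes' c := by
    change (RingEquiv.ofBijective _ R.residue_bijective).symm (algebraMap k (ResidueField R) c) = c
    exact (RingEquiv.ofBijective _ R.residue_bijective).symm_apply_apply c

theorem aug_eq_zero_iff (R : CHat k) (r : R) : aug R r = 0 ↔ r ∈ maximalIdeal R := by
  change (RingEquiv.ofBijective _ R.residue_bijective).symm (residue R r) = 0 ↔ _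
  rw [EmbeddingLike.map_eq_zero_iff, residue_eq_zero_iff]

theorem sub_aug_mem (R : CHat k) (r : R) : r - algebraMap k R (aug R r) ∈ maximalIdeal R := by
  rw [← aug_eq_zero_iff, map_sub, AlgHom.commutes, Algebra.algebraMap_self_apply, sub_self]

/-- The residue field `k` as an algebra over an object of `Ĉ`, through the residue map. -/
noncomputable instance residueAlgebra (R : CHat k) : Algebra R k := (aug R).toRingHom.toAlgebra

theorem residueAlgebra_smul (R : CHat k) (r : R) (c : k) : r • c = aug R r * c := rfl

instance (R : CHat k) : IsScalarTower k R k :=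
  IsScalarTower.of_algebraMap_eq fun c => ((aug R).commutes c).symm

/-- A morphism of `Ĉ`: a `k`-algebra homomorphism which maps the maximal ideal into the maximal
ideal, i.e. which is continuous for the adic topologies and induces the identity on `k`. -/
@[ext] structure Hom (R S : CHat k) where
  toAlgHom : R →ₐ[k] S
  map_maximalIdeal : ∀ r ∈ maximalIdeal R, toAlgHom r ∈ maximalIdeal S

instance : Category (CHat k) where
  Hom := Hom
  id R := ⟨AlgHom.id k R, fun _ h => h⟩
  comp f g := ⟨g.toAlgHom.comp f.toAlgHom, fun r h => g.map_maximalIdeal _ (f.map_maximalIdeal r h)⟩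

@[ext] theorem hom_ext {R S : CHat k} {f g : R ⟶ S} (h : f.toAlgHom = g.toAlgHom) : f = g :=
  Hom.ext h

theorem aug_comp {R S : CHat k} (f : R ⟶ S) (r : R) : aug S (f.toAlgHom r) = aug R r := by
  have h := (aug_eq_zero_iff S _).2 (f.map_maximalIdeal _ (sub_aug_mem R r))
  rwa [map_sub, map_sub, AlgHom.commutes, AlgHom.commutes, Algebra.algebraMap_self_apply,
    sub_eq_zero] at h

/-- Every `k`-algebra homomorphism between objects of `Ĉ` is a morphism of `Ĉ`. -/
def ofAlgHom {R S : CHat k} (f : R →ₐ[k] S) : R ⟶ S where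
  toAlgHom := f
  map_maximalIdeal r hr := by
    have h := (aug_eq_zero_iff R r).2 hr
    have h' := sub_aug_mem S (f r)
    by_contra h''
    have hne : aug S (f r) ≠ 0 := fun h0 => h'' ((aug_eq_zero_iff S _).1 h0)
    have hu : IsUnit (r - algebraMap k R (aug S (f r))) := by
      by_contra hn
      have hn' : r - algebraMap k R (aug S (f r)) ∈ maximalIdeal R := (mem_maximalIdeal _).2 hn
      rw [← aug_eq_zero_iff, map_sub, h, AlgHom.commutes, Algebra.algebraMap_self_apply] at hn'
      exact hne (by simpa using hn')
    have := hu.map f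
    rw [map_sub, AlgHom.commutes] at this
    exact (mem_maximalIdeal _).1 h' this

theorem residue_bijective_of {S : Type u} [CommRing S] [Algebra k S] [IsLocalRing S]
    (h : ∀ s : S, ∃ c : k, s - algebraMap k S c ∈ maximalIdeal S) :
    Function.Bijective (algebraMap k (ResidueField S)) := by
  refine ⟨(algebraMap k (ResidueField S)).injective, fun x => ?_⟩
  obtain ⟨s, rfl⟩ := residue_surjective x
  obtain ⟨c, hc⟩ := h s
  refine ⟨c, ?_⟩
  rw [← residue_eq_zero_iff, map_sub, sub_eq_zero] at hc
  exact hc.symm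

/-- The object `R / m_R ^ (n + 1)` of `Ĉ`. -/
noncomputable def quot (R : CHat k) (n : ℕ) : CHat k :=
  let I : Ideal R := maximalIdeal R ^ (n + 1)
  have hI : I ≤ maximalIdeal R := Ideal.pow_le_self (Nat.succ_ne_zero n)
  haveI : Nontrivial (R ⧸ I) := Ideal.Quotient.nontrivial_iff.2
    (ne_top_of_le_ne_top (IsLocalRing.maximalIdeal.isMaximal (R := R)).ne_top hI)
  haveI : IsLocalRing (R ⧸ I) :=
    IsLocalRing.of_surjective' (Ideal.Quotient.mk I) Ideal.Quotient.mk_surjective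
  have hm : maximalIdeal (R ⧸ I) = (maximalIdeal R).map (Ideal.Quotient.mk I) := by
    refine (IsLocalRing.eq_maximalIdeal ?_).symm
    exact (Ideal.map_eq_top_or_isMaximal_of_surjective _ Ideal.Quotient.mk_surjective
      inferInstance).resolve_left fun h => by
        have h1 : (1 : R ⧸ I) ∈ (maximalIdeal R).map (Ideal.Quotient.mk I) := h ▸ trivial
        obtain ⟨r, hr, hr1⟩ :=
          (Ideal.mem_map_iff_of_surjective _ Ideal.Quotient.mk_surjective).1 h1
        rw [← map_one (Ideal.Quotient.mk I), Ideal.Quotient.eq] at hr1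
        have h2 : (1 : R) ∈ maximalIdeal R := by
          simpa using Ideal.sub_mem _ hr (hI hr1)
        exact (mem_maximalIdeal (1 : R)).1 h2 isUnit_one
  haveI : IsArtinianRing (R ⧸ I) := by
    rw [isArtinianRing_iff_isNilpotent_maximalIdeal]
    refine ⟨n + 1, ?_⟩
    rw [hm, ← Ideal.map_pow]
    exact Ideal.map_quotient_self I
  { carrier := R ⧸ I
    residue_bijective := residue_bijective_of fun s => by
      obtain ⟨r, rfl⟩ := Ideal.Quotient.mk_surjective s
      refine ⟨aug R r, ?_⟩
      rw [hm]
      have := Ideal.mem_map_of_mem (Ideal.Quotient.mk I) (sub_aug_mem R r)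
      rwa [map_sub] at this }

/-- The projection `R → R / m_R ^ (n + 1)`. -/
noncomputable def quotProj (R : CHat k) (n : ℕ) : R ⟶ R.quot n :=
  ofAlgHom (Ideal.Quotient.mkₐ k (maximalIdeal R ^ (n + 1)))

/-- The projection `R / m_R ^ (n + 2) → R / m_R ^ (n + 1)`. -/
noncomputable def quotTrans (R : CHat k) (n : ℕ) : R.quot (n + 1) ⟶ R.quot n :=
  ofAlgHom (Ideal.Quotient.factorₐ k (Ideal.pow_le_pow_right (Nat.le_succ (n + 1))))

section SqZero

variable (k) (W : Type u) [AddCommGroup W] [Module k W] [Module kᵐᵒᵖ W] [IsCentralScalar k W]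
  [Module.Finite k W]

instance isLocalRing_sqZero : IsLocalRing (TrivSqZeroExt k W) :=
  .of_isUnit_or_isUnit_one_sub_self fun a => by
    by_cases h : a.fst = 0
    · right; simp [TrivSqZeroExt.isUnit_iff_isUnit_fst, h]
    · left; simp [TrivSqZeroExt.isUnit_iff_isUnit_fst, h]

instance finite_sqZero : Module.Finite k (TrivSqZeroExt k W) :=
  Module.Finite.prod (R := k) (M := k) (N := W)

/-- The object `k[W] = k ⊕ W` of `Ĉ`, with `W ^ 2 = 0`, for a finite dimensional `k`-vector space
`W`. -/
noncomputable def sqZero : CHat k :=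
  haveI : IsArtinianRing (TrivSqZeroExt k W) := IsArtinianRing.of_finite k _
  { carrier := TrivSqZeroExt k W
    residue_bijective := residue_bijective_of fun s => ⟨s.fst, by
      rw [mem_maximalIdeal, mem_nonunits_iff, TrivSqZeroExt.isUnit_iff_isUnit_fst]
      simp [TrivSqZeroExt.algebraMap_eq_inl]⟩ }

variable {k W} {W' : Type u} [AddCommGroup W'] [Module k W'] [Module kᵐᵒᵖ W'] [IsCentralScalar k W']
  [Module.Finite k W']

/-- The morphism `k[W] → k[W']` induced by a linear map `W → W'`. -/
noncomputable def sqZeroMap (f : W →ₗ[k] W') : sqZero k W ⟶ sqZero k W' :=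
  ofAlgHom (R := sqZero k W) (S := sqZero k W') (TrivSqZeroExt.map f)

end SqZero

variable (k) in
/-- The ring of dual numbers `k[ε]`, `ε ^ 2 = 0`, as an object of `Ĉ`. -/
noncomputable abbrev dual : CHat k := sqZero k k

end CHat

end CHat

section Deformations

open scoped ModuleCat

variable {k Λ : Type u} [Field k] [Ring Λ] [Algebra k Λ]

/-- A lift of the `Λ̂`-module `V` over `R`: a finitely generated `R ⊗_k Λ̂`-module `M` which is free
over `R`, with an isomorphism `φ : k ⊗_R M → V` of `Λ̂`-modules.  The module structure over the
non-unital ring `R ⊗_k Λ̂` consists of the `R`-module structure and of the `k`-linear and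
multiplicative action `act` of `Λ̂` by `R`-linear endomorphisms. -/
structure Lift (V : RepMod k Λ) (R : CHat k) where
  M : Type u
  [addCommGroup : AddCommGroup M]
  [module : Module R M]
  [free : Module.Free R M]
  act : RepetitiveAlgebra k Λ →ₙ+* Module.End R M
  act_smul : ∀ (c : k) (x : RepetitiveAlgebra k Λ), act (c • x) = algebraMap k R c • act x
  fg : ∃ s : Finset M,
    Submodule.span R {m : M | ∃ (x : RepetitiveAlgebra k Λ) (m' : M), m' ∈ s ∧ m = act x m'} = ⊤
  φ : k ⊗[R] M ≃ₗ[k] V.obj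
  φ_act : ∀ (x : RepetitiveAlgebra k Λ) (t : k ⊗[R] M),
    φ ((act x).baseChange k t) = (Unitization.inr x : RepetitiveAlgebraUnit k Λ) • φ t

namespace Lift

attribute [instance] addCommGroup module free

variable {V : RepMod k Λ} {R S T : CHat k}

/-- An isomorphism of lifts: an isomorphism of `R ⊗_k Λ̂`-modules compatible with the identifications
of the reductions with `V`. -/
structure Iso (L L' : Lift V R) where
  α : L.M ≃ₗ[R] L'.M
  α_act : ∀ (x : RepetitiveAlgebra k Λ) (m : L.M), α (L.act x m) = L'.act x (α m)
  φ_α : ∀ t : k ⊗[R] L.M, L'.φ (α.toLinearMap.baseChange k t) = L.φ t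

/-- Two lifts are isomorphic. -/
def IsIso (L L' : Lift V R) : Prop := Nonempty (Iso L L')

theorem IsIso.refl (L : Lift V R) : IsIso L L :=
  ⟨{ α := LinearEquiv.refl R L.M
     α_act := fun _ _ => rfl
     φ_α := fun t => by simp }⟩

theorem IsIso.symm {L L' : Lift V R} (h : IsIso L L') : IsIso L' L := by
  obtain ⟨e⟩ := h
  refine ⟨{ α := e.α.symm, α_act := fun x m => ?_, φ_α := fun t => ?_ }⟩
  · apply e.α.injective
    rw [e.α_act, LinearEquiv.apply_symm_apply, LinearEquiv.apply_symm_apply]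
  · rw [← e.φ_α, ← LinearMap.comp_apply, ← LinearMap.baseChange_comp]
    simp

theorem IsIso.trans {L L' L'' : Lift V R} (h : IsIso L L') (h' : IsIso L' L'') : IsIso L L'' := by
  obtain ⟨e⟩ := h
  obtain ⟨e'⟩ := h'
  refine ⟨{ α := e.α.trans e'.α, α_act := fun x m => ?_, φ_α := fun t => ?_ }⟩
  · simp [e.α_act, e'.α_act]
  · rw [← e.φ_α, ← e'.φ_α, LinearEquiv.coe_trans, LinearMap.baseChange_comp]
    rfl

instance setoid (V : RepMod k Λ) (R : CHat k) : Setoid (Lift V R) where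
  r := IsIso
  iseqv := ⟨IsIso.refl, IsIso.symm, IsIso.trans⟩

/-- The lift `S ⊗_R M` of `V` over `S`, where `S` is an `R`-algebra compatibly with the residue maps;
the identification of its reduction is the composition
`k ⊗_S (S ⊗_R M) ≅ k ⊗_R M ≅ V`. -/
noncomputable def extend [Algebra R S] [IsScalarTower k R S] [IsScalarTower R S k] (L : Lift V R) :
    Lift V S where
  M := S ⊗[R] L.M
  act := ((Module.End.baseChangeHom R S L.M : Module.End R L.M →ₐ[R] Module.End S (S ⊗[R] L.M)) :
    Module.End R L.M →ₙ+* Module.End S (S ⊗[R] L.M)).comp L.act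
  act_smul c x := by
    change LinearMap.baseChange S (L.act (c • x)) = _ • LinearMap.baseChange S (L.act x)
    rw [L.act_smul, LinearMap.baseChange_smul, IsScalarTower.algebraMap_apply k R S]
    exact (algebraMap_smul S _ _).symm
  fg := by
    classical
    obtain ⟨s, hs⟩ := L.fg
    refine ⟨s.image (fun m => (1 : S) ⊗ₜ[R] m), ?_⟩
    rw [eq_top_iff, ← Submodule.baseChange_top, ← hs, Submodule.baseChange_span, Submodule.span_le]
    rintro _ ⟨m, ⟨x, m', hm', rfl⟩, rfl⟩
    exact Submodule.subset_span ⟨x, 1 ⊗ₜ m', Finset.mem_image_of_mem _ hm', rfl⟩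
  φ := (AlgebraTensorModule.cancelBaseChange R S k k L.M).trans L.φ
  φ_act x t := by
    have key : ∀ t : k ⊗[S] (S ⊗[R] L.M),
        AlgebraTensorModule.cancelBaseChange R S k k L.M
          (((L.act x).baseChange S).baseChange k t) =
        (L.act x).baseChange k (AlgebraTensorModule.cancelBaseChange R S k k L.M t) := by
      intro t
      induction t with
      | zero => simp
      | add a b ha hb => simp only [map_add, ha, hb]
      | tmul c u =>
        induction u with
        | zero => simp
        | add a b ha hb => simp only [TensorProduct.tmul_add, map_add, ha, hb]
        | tmul s m => simp
    exact (congrArg L.φ (key t)).trans (L.φ_act x _)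

/-- The criterion for a lift over `S` to be isomorphic to `S ⊗_R M`. -/
theorem isIso_extend [Algebra R S] [IsScalarTower k R S] [IsScalarTower R S k] (L : Lift V R)
    (L' : Lift V S) [Module R L'.M] [IsScalarTower R S L'.M] (f : L.M →ₗ[R] L'.M)
    (hf : IsBaseChange S f) (h_act : ∀ x m, f (L.act x m) = L'.act x (f m))
    (h_φ : ∀ m, L'.φ (1 ⊗ₜ f m) = L.φ (1 ⊗ₜ m)) : IsIso (L.extend (S := S)) L' := by
  have key₁ : ∀ x (u : S ⊗[R] L.M),
      hf.equiv ((L.act x).baseChange S u) = L'.act x (hf.equiv u) := by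
    intro x u
    induction u with
    | zero => simp
    | add a b ha hb => simp only [map_add, ha, hb]
    | tmul s m => simp [IsBaseChange.equiv_tmul, h_act]
  have key₂ : ∀ t : k ⊗[S] (S ⊗[R] L.M), L'.φ (hf.equiv.toLinearMap.baseChange k t) =
      L.φ (AlgebraTensorModule.cancelBaseChange R S k k L.M t) := by
    intro t
    induction t with
    | zero => simp
    | add a b ha hb => simp only [map_add, ha, hb]
    | tmul c u =>
      induction u with
      | zero => simp
      | add a b ha hb => simp only [TensorProduct.tmul_add, map_add, ha, hb]
      | tmul s m =>
        have h1 : (c ⊗ₜ[S] (s • f m) : k ⊗[S] L'.M) = (s • c) • ((1 : k) ⊗ₜ[S] f m) := by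
          rw [TensorProduct.tmul_smul, TensorProduct.smul_tmul', TensorProduct.smul_tmul',
            smul_eq_mul, mul_one]
        have h2 : ((s • c) ⊗ₜ[R] m : k ⊗[R] L.M) = (s • c) • ((1 : k) ⊗ₜ[R] m) := by
          rw [TensorProduct.smul_tmul', smul_eq_mul, mul_one]
        rw [LinearMap.baseChange_tmul, LinearEquiv.coe_coe, IsBaseChange.equiv_tmul,
          AlgebraTensorModule.cancelBaseChange_tmul, h1, h2, map_smul, map_smul, h_φ]
  exact ⟨{ α := hf.equiv, α_act := key₁, φ_α := key₂ }⟩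

theorem extend_isIso [Algebra R S] [IsScalarTower k R S] [IsScalarTower R S k] {L L' : Lift V R}
    (h : IsIso L L') : IsIso (L.extend (S := S)) (L'.extend (S := S)) := by
  obtain ⟨e⟩ := h
  let : Module R (L'.extend (S := S)).M := inferInstanceAs (Module R (S ⊗[R] L'.M))
  have : IsScalarTower R S (L'.extend (S := S)).M :=
    inferInstanceAs (IsScalarTower R S (S ⊗[R] L'.M))
  refine isIso_extend L (L'.extend (S := S)) (TensorProduct.mk R S L'.M 1 ∘ₗ e.α.toLinearMap) ?_
    ?_ ?_
  · exact IsBaseChange.comp_equiv e.α _ (TensorProduct.isBaseChange R L'.M S)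
  · intro x m
    change (1 : S) ⊗ₜ[R] e.α (L.act x m) = (L'.act x).baseChange S (1 ⊗ₜ[R] e.α m)
    rw [e.α_act, LinearMap.baseChange_tmul]
  · intro m
    rw [← e.φ_α]
    change L'.φ (AlgebraTensorModule.cancelBaseChange R S k k L'.M (1 ⊗ₜ[S] (1 ⊗ₜ[R] e.α m))) = _
    rw [AlgebraTensorModule.cancelBaseChange_tmul, one_smul]
    rfl

theorem extend_self_isIso (a : Algebra R R) (ha : a = Algebra.id R)
    (h₁ : @IsScalarTower k R R _ a.toSMul _) (h₂ : @IsScalarTower R R k a.toSMul _ _)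
    (L : Lift V R) : IsIso (@extend k Λ _ _ _ V R R a h₁ h₂ L) L := by
  subst ha
  refine isIso_extend L L LinearMap.id ?_ (fun _ _ => rfl) (fun _ => rfl)
  exact IsBaseChange.of_equiv (TensorProduct.lid R L.M) (fun x => by simp)

theorem extend_extend_isIso [Algebra R S] [IsScalarTower k R S] [IsScalarTower R S k]
    [Algebra S T] [IsScalarTower k S T] [IsScalarTower S T k]
    [Algebra R T] [IsScalarTower k R T] [IsScalarTower R T k] [IsScalarTower R S T]
    (L : Lift V R) :
    IsIso (L.extend (S := T)) ((L.extend (S := S)).extend (S := T)) := by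
  let : Module R ((L.extend (S := S)).extend (S := T)).M :=
    inferInstanceAs (Module R (T ⊗[S] (S ⊗[R] L.M)))
  have : IsScalarTower R T ((L.extend (S := S)).extend (S := T)).M :=
    inferInstanceAs (IsScalarTower R T (T ⊗[S] (S ⊗[R] L.M)))
  refine isIso_extend L ((L.extend (S := S)).extend (S := T)) ((TensorProduct.mk S T (S ⊗[R] L.M) 1).restrictScalars R ∘ₗ
    TensorProduct.mk R S L.M 1) ?_ ?_ ?_
  · have h : IsBaseChange T ((TensorProduct.mk S T (S ⊗[R] L.M) 1).restrictScalars R ∘ₗ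
        TensorProduct.mk R S L.M 1) :=
      (TensorProduct.isBaseChange R L.M S).comp (TensorProduct.isBaseChange S (S ⊗[R] L.M) T)
    exact h
  · intro x m
    rfl
  · intro m
    change L.φ (AlgebraTensorModule.cancelBaseChange R S k k L.M
      (AlgebraTensorModule.cancelBaseChange S T k k (S ⊗[R] L.M)
        (1 ⊗ₜ[T] (1 ⊗ₜ[S] (1 ⊗ₜ[R] m))))) = _
    rw [AlgebraTensorModule.cancelBaseChange_tmul, one_smul,
      AlgebraTensorModule.cancelBaseChange_tmul, one_smul]

/-- The lift `S ⊗_{R, θ} M` of `V` over `S`, for a morphism `θ : R → S` of `Ĉ`. -/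
noncomputable def baseChange (θ : R ⟶ S) (L : Lift V R) : Lift V S :=
  letI : Algebra R S := θ.toAlgHom.toRingHom.toAlgebra
  haveI : IsScalarTower k R S :=
    IsScalarTower.of_algebraMap_eq fun c => (θ.toAlgHom.commutes c).symm
  haveI : IsScalarTower R S k :=
    IsScalarTower.of_algebraMap_eq fun r => (CHat.aug_comp θ r).symm
  L.extend

theorem baseChange_isIso (θ : R ⟶ S) {L L' : Lift V R} (h : IsIso L L') :
    IsIso (L.baseChange θ) (L'.baseChange θ) := by
  let : Algebra R S := θ.toAlgHom.toRingHom.toAlgebra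
  have : IsScalarTower k R S :=
    IsScalarTower.of_algebraMap_eq fun c => (θ.toAlgHom.commutes c).symm
  have : IsScalarTower R S k :=
    IsScalarTower.of_algebraMap_eq fun r => (CHat.aug_comp θ r).symm
  exact extend_isIso h

theorem baseChange_id_isIso (L : Lift V R) : IsIso (L.baseChange (𝟙 R)) L :=
  extend_self_isIso _ (Algebra.algebra_ext _ _ fun _ => rfl) _ _ L

theorem baseChange_comp_isIso (θ : R ⟶ S) (η : S ⟶ T) (L : Lift V R) :
    IsIso (L.baseChange (θ ≫ η)) ((L.baseChange θ).baseChange η) := by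
  let : Algebra R S := θ.toAlgHom.toRingHom.toAlgebra
  have : IsScalarTower k R S :=
    IsScalarTower.of_algebraMap_eq fun c => (θ.toAlgHom.commutes c).symm
  have : IsScalarTower R S k :=
    IsScalarTower.of_algebraMap_eq fun r => (CHat.aug_comp θ r).symm
  let : Algebra S T := η.toAlgHom.toRingHom.toAlgebra
  have : IsScalarTower k S T :=
    IsScalarTower.of_algebraMap_eq fun c => (η.toAlgHom.commutes c).symm
  have : IsScalarTower S T k :=
    IsScalarTower.of_algebraMap_eq fun r => (CHat.aug_comp η r).symm
  let : Algebra R T := (θ ≫ η).toAlgHom.toRingHom.toAlgebra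
  have : IsScalarTower k R T :=
    IsScalarTower.of_algebraMap_eq fun c => ((θ ≫ η).toAlgHom.commutes c).symm
  have : IsScalarTower R T k :=
    IsScalarTower.of_algebraMap_eq fun r => (CHat.aug_comp (θ ≫ η) r).symm
  have : IsScalarTower R S T := IsScalarTower.of_algebraMap_eq fun r => rfl
  exact extend_extend_isIso L

end Lift

/-- The set of deformations of `V` over `R`: the isomorphism classes of lifts. -/
def Def (V : RepMod k Λ) (R : CHat k) : Type (u + 1) := Quotient (Lift.setoid V R)

/-- The deformation functor `R ↦ Def(V, R)` on `Ĉ`, with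
`[M, φ] ↦ [S ⊗_{R, θ} M, φ_θ]` for `θ : R → S`. -/
noncomputable def defFunctor (V : RepMod k Λ) : CHat k ⥤ Type (u + 1) where
  obj R := Def V R
  map θ := ↾(Quotient.map (Lift.baseChange θ) fun _ _ => Lift.baseChange_isIso θ)
  map_id R := by
    ext x
    induction x using Quotient.inductionOn with
    | h L => exact Quotient.sound (Lift.baseChange_id_isIso L)
  map_comp θ η := by
    ext x
    induction x using Quotient.inductionOn with
    | h L => exact Quotient.sound (Lift.baseChange_comp_isIso θ η L)

end Deformations

section FunctorsOnCHat

universe w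

variable {k : Type u} [Field k]

/-- A functor `H` on `Ĉ` is continuous if `H(R) = lim_i H(R / m_R ^ i)` for all `R`, i.e. the natural
map from `H(R)` to the set of compatible families in `∏_{i ≥ 1} H(R / m_R ^ i)` is bijective. -/
def IsContinuous (H : CHat k ⥤ Type w) : Prop :=
  ∀ R : CHat k, Function.Bijective
    (fun h : H.obj R => (⟨fun n => H.map (R.quotProj n) h, fun n => by
      rw [← Functor.map_comp_apply]; rfl⟩ :
      {x : ∀ n : ℕ, H.obj (R.quot n) // ∀ n, H.map (R.quotTrans n) (x (n + 1)) = x n}))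

/-- `(R, ξ)`, with `R` an object of `Ĉ` and `ξ ∈ H(R)`, is a (pro-representable) hull of the
restriction of `H` to the Artinian objects of `Ĉ`: the natural transformation
`Hom(R, -) → H`, `u ↦ H(u)(ξ)` on Artinian objects is smooth, i.e.
`Hom(R, B) → Hom(R, A) ×_{H(A)} H(B)` is surjective for each surjection `p : B → A` of Artinian
objects, and it induces a bijection on tangent spaces. -/
structure IsHull (H : CHat k ⥤ Type w) (R : CHat k) (ξ : H.obj R) : Prop where
  smooth : ∀ (B A : CHat k) [IsArtinianRing B] [IsArtinianRing A] (p : B ⟶ A),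
    Function.Surjective p.toAlgHom → ∀ (u : R ⟶ A) (b : H.obj B), H.map p b = H.map u ξ →
      ∃ v : R ⟶ B, v ≫ p = u ∧ H.map v ξ = b
  tangent : Function.Bijective (fun u : R ⟶ CHat.dual k => H.map u ξ)

/-- `(R, ξ)` represents `H`: the map `Hom(R, A) → H(A)`, `u ↦ H(u)(ξ)` is bijective for all objects
`A` of `Ĉ`. -/
def Represents (H : CHat k ⥤ Type w) (R : CHat k) (ξ : H.obj R) : Prop :=
  ∀ A : CHat k, Function.Bijective (fun u : R ⟶ A => H.map u ξ)

/-- The tangent space `H(k[ε])`. -/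
abbrev FunctorTangentSpace (H : CHat k ⥤ Type w) : Type w := H.obj (CHat.dual k)

/-- A `k`-vector space structure on the tangent space `H(k[ε])` is the canonical one if the natural
map `H(k[ε] ×_k k[ε]) → H(k[ε]) × H(k[ε])` is bijective, the addition is its inverse followed by
the map induced by `k[ε] ×_k k[ε] → k[ε]`, `a + b ε₁ + c ε₂ ↦ a + (b + c) ε`, and the multiplication
by `c ∈ k` is induced by `a + b ε ↦ a + c b ε`.  Here `k[ε] ×_k k[ε]` is the ring `k[W]` for
`W = k × k`. -/
structure IsTangentStructure (H : CHat k ⥤ Type w) [AddCommGroup (FunctorTangentSpace H)]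
    [Module k (FunctorTangentSpace H)] : Prop where
  bijective : Function.Bijective (fun z : H.obj (CHat.sqZero k (k × k)) =>
    ((H.map (CHat.sqZeroMap (LinearMap.fst k k k)) z,
      H.map (CHat.sqZeroMap (LinearMap.snd k k k)) z) : FunctorTangentSpace H × FunctorTangentSpace H))
  add_eq : ∀ z : H.obj (CHat.sqZero k (k × k)),
    H.map (CHat.sqZeroMap (LinearMap.fst k k k)) z + H.map (CHat.sqZeroMap (LinearMap.snd k k k)) z =
      (H.map (CHat.sqZeroMap (LinearMap.fst k k k + LinearMap.snd k k k)) z : FunctorTangentSpace H)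
  smul_eq : ∀ (c : k) (t : FunctorTangentSpace H),
    c • t = H.map (CHat.sqZeroMap (c • LinearMap.id : k →ₗ[k] k)) t

end FunctorsOnCHat

section StableEnd

open scoped ZeroObject

variable {k Λ : Type u} [Field k] [Ring Λ] [Algebra k Λ]

/-- The endomorphisms of `V` in `Λ̂`-mod which factor through a projective object. -/
noncomputable def projectiveEnd (V : RepMod k Λ) : Submodule k (V ⟶ V) where
  carrier := {f | ∃ (P : RepMod k Λ) (_ : Projective P) (a : V ⟶ P) (b : P ⟶ V), f = a ≫ b}
  zero_mem' := ⟨0, inferInstance, 0, 0, by simp⟩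
  add_mem' := by
    rintro _ _ ⟨P, hP, a, b, rfl⟩ ⟨Q, hQ, c, d, rfl⟩
    exact ⟨P ⊞ Q, inferInstance, Limits.biprod.lift a c, Limits.biprod.desc b d, by simp⟩
  smul_mem' := by
    rintro c _ ⟨P, hP, a, b, rfl⟩
    exact ⟨P, hP, a, c • b, by simp⟩

/-- The stable endomorphism ring of `V` (as a `k`-vector space): the endomorphisms of `V` modulo those
which factor through a projective object. -/
abbrev StableEnd (V : RepMod k Λ) : Type u := (V ⟶ V) ⧸ projectiveEnd V

/-- The stable endomorphism ring of `V` is `k`: its `k`-algebra structure map `c ↦ c • 𝟙` is bijective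
(this only involves the underlying vector space). -/
def StableEndEqBase (V : RepMod k Λ) : Prop :=
  Function.Bijective (fun c : k => (projectiveEnd V).mkQ (c • 𝟙 V))

end StableEnd

-- Fix a `k`-basis of the module. A lift over `R` then becomes a framed deformation: a
-- multiplicative `k`-linear map `ρ : Λ̂ → M_n(R)` reducing to the matrix representation `ρ₀`. Two
-- lifts are isomorphic exactly when their framed deformations are conjugate under the kernel of
-- `GL_n(R) → GL_n(k)` (`defFunctorPresentation`). The claims about hulls, continuity and
-- universality are proved for any functor with such a `FramedPresentation`, from two properties of
-- `ρ₀`.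
--
-- The first property is finiteness (`finitelyDetermined_repMatrix`). A local unit `e` of `Λ̂` acts
-- as `1` on the module, hence as an invertible idempotent, that is as `1`, in every framed
-- deformation. So `ρ(x) = ρ(exe)`, and `eΛ̂e` is finite dimensional: finitely many matrices
-- `ρ(β_s)` determine `ρ`. Continuity follows, the delicate half (injectivity,
-- `FramedRep.equiv_of_forall_quot`) by Krull's intersection theorem.
--
-- The hull is constructed explicitly (`exists_isHull`). Modulo terms of higher order, conjugation
-- by `1 + X` adds `(Xρ₀(β_s) - ρ₀(β_s)X)_s` to the deviation `ρ(β_s) - ρ₀(β_s)`. A linear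
-- projection onto the space of these commutators cuts out a slice. Over an Artinian ring every
-- framed deformation is conjugate into the slice, by a matrix as close to `1` as the deformation is
-- to the slice, and the framed deformations in the slice are the points of an explicit quotient of
-- a power series ring.
--
-- For the tangent space, a framed deformation over `k ⊕ W` is `ρ₀ + d` with `d` a derivation, and
-- conjugation changes `d` by inner derivations. Hence `F(k ⊕ W)` is `H¹` with coefficients in
-- `M_n(W)`, naturally in `W`, and the vector space structure is that of `H¹`. It is compared with
-- `Ext¹` through the projective cover `(Λ̂e)^n → V` (`nonempty_ext_linearEquiv_repH1`).
--
-- The second property, used for universality, is that every endomorphism of `ρ₀` lifts to every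
-- framed deformation (`CentralizerLifts`). When the stable endomorphism ring is `k`, an
-- endomorphism is a scalar plus a map factoring through a projective. The linear form `trace`
-- supplies dual bases of `Λ̂`, and the associated Casimir operator `T ↦ ∑ ρ₀(x_i) T ρ₀(y_i)` hits
-- all maps factoring through projectives; lifting `T` entrywise and replacing `ρ₀` by `ρ` lifts the
-- map. Automorphisms therefore lift along surjections onto Artinian rings, and this makes points of
-- a hull with equal classes coincide, one small extension at a time (`hom_eq_of_comp_eq`,
-- `represents`).

universe w

open CHat

set_option maxSynthPendingDepth 4

/-! ### Quotients by powers of the maximal ideal, and limits over them -/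

namespace CHat

variable {k : Type u} [Field k]

theorem isUnit_iff_aug_ne_zero (R : CHat k) (r : R) : IsUnit r ↔ aug R r ≠ 0 := by
  rw [Ne, aug_eq_zero_iff, mem_maximalIdeal, mem_nonunits_iff, not_not]

theorem aug_algebraMap (R : CHat k) (c : k) : aug R (algebraMap k R c) = c := (aug R).commutes c

theorem quotProj_surjective (R : CHat k) (n : ℕ) :
    Function.Surjective (R.quotProj n).toAlgHom := Ideal.Quotient.mk_surjective

theorem quotProj_eq_zero_iff (R : CHat k) (n : ℕ) (r : R) :
    (R.quotProj n).toAlgHom r = 0 ↔ r ∈ maximalIdeal R ^ (n + 1) := Ideal.Quotient.eq_zero_iff_mem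

theorem quotTrans_quotProj (R : CHat k) (n : ℕ) (r : R) :
    (R.quotTrans n).toAlgHom ((R.quotProj (n + 1)).toAlgHom r) = (R.quotProj n).toAlgHom r := rfl

theorem quotProj_comp_quotTrans (R : CHat k) (n : ℕ) :
    R.quotProj (n + 1) ≫ R.quotTrans n = R.quotProj n := rfl

theorem quotTrans_surjective (R : CHat k) (n : ℕ) :
    Function.Surjective (R.quotTrans n).toAlgHom := fun x => by
  obtain ⟨r, rfl⟩ := R.quotProj_surjective n x
  exact ⟨_, R.quotTrans_quotProj n r⟩

theorem mem_maximalIdeal_of_map {R S : CHat k} (θ : R ⟶ S) {r : R}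
    (h : θ.toAlgHom r ∈ maximalIdeal S) : r ∈ maximalIdeal R := by
  rw [← aug_eq_zero_iff] at h ⊢
  rwa [aug_comp] at h

theorem exists_mem_maximalIdeal_of_surjective {R S : CHat k} (θ : R ⟶ S)
    (hθ : Function.Surjective θ.toAlgHom) {s : S} (hs : s ∈ maximalIdeal S) :
    ∃ r ∈ maximalIdeal R, θ.toAlgHom r = s := by
  obtain ⟨r, rfl⟩ := hθ s
  exact ⟨r, mem_maximalIdeal_of_map θ hs, rfl⟩

theorem maximalIdeal_quot_pow (R : CHat k) (n : ℕ) :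
    maximalIdeal (R.quot n) ^ (n + 1) = ⊥ := by
  have h : maximalIdeal (R.quot n) ≤ (maximalIdeal R).map (R.quotProj n).toAlgHom.toRingHom := by
    intro s hs
    obtain ⟨r, hr, rfl⟩ := exists_mem_maximalIdeal_of_surjective _ (R.quotProj_surjective n) hs
    exact Ideal.mem_map_of_mem (R.quotProj n).toAlgHom.toRingHom hr
  rw [eq_bot_iff]
  refine (Ideal.pow_right_mono h _).trans ?_
  rw [← Ideal.map_pow, Ideal.map_le_iff_le_comap]
  intro r hr
  exact (quotProj_eq_zero_iff R n r).2 hr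

instance isArtinianRing_quot (R : CHat k) (n : ℕ) : IsArtinianRing (R.quot n) := by
  rw [isArtinianRing_iff_isNilpotent_maximalIdeal]
  exact ⟨n + 1, R.maximalIdeal_quot_pow n⟩

theorem exists_maximalIdeal_pow_eq_bot (R : CHat k) [IsArtinianRing R] :
    ∃ n, maximalIdeal R ^ n = ⊥ :=
  (isArtinianRing_iff_isNilpotent_maximalIdeal R).1 inferInstance

/-- The kernel of `quotTrans` is `𝔪^(n+1) / 𝔪^(n+2)`, which `𝔪` kills. These are the small
extensions along which `hom_eq_of_comp_eq` is applied. -/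
theorem mul_eq_zero_of_quotTrans_eq_zero (R : CHat k) (n : ℕ) {a b : R.quot (n + 1)}
    (ha : a ∈ maximalIdeal (R.quot (n + 1))) (hb : (R.quotTrans n).toAlgHom b = 0) :
    a * b = 0 := by
  obtain ⟨r, hr, rfl⟩ := exists_mem_maximalIdeal_of_surjective _ (R.quotProj_surjective _) ha
  obtain ⟨s, rfl⟩ := R.quotProj_surjective _ b
  rw [quotTrans_quotProj, quotProj_eq_zero_iff] at hb
  rw [← map_mul, quotProj_eq_zero_iff, pow_succ']
  exact Ideal.mul_mem_mul hr hb

theorem eq_of_quotProj (R : CHat k) {r s : R}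
    (h : ∀ n, (R.quotProj n).toAlgHom r = (R.quotProj n).toAlgHom s) : r = s := by
  rw [← sub_eq_zero]
  refine IsHausdorff.haus (I := maximalIdeal R) inferInstance _ fun n => ?_
  rw [SModEq.zero, smul_eq_mul, Ideal.mul_top]
  have := h n
  rw [← sub_eq_zero, ← map_sub, quotProj_eq_zero_iff] at this
  exact Ideal.pow_le_pow_right (Nat.le_succ n) this

theorem exists_quotProj_eq (R : CHat k) (a : ∀ n, R.quot n)
    (ha : ∀ n, (R.quotTrans n).toAlgHom (a (n + 1)) = a n) :
    ∃ r : R, ∀ n, (R.quotProj n).toAlgHom r = a n := by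
  choose f hf using fun n => R.quotProj_surjective n (a n)
  have hsucc : ∀ n, f (n + 1) - f n ∈ maximalIdeal R ^ (n + 1) := fun n => by
    rw [← quotProj_eq_zero_iff, map_sub, hf, ← quotTrans_quotProj, hf, ha, sub_self]
  have hle : ∀ m d, f (m + d) - f m ∈ maximalIdeal R ^ m := fun m d => by
    induction d with
    | zero => simp
    | succ d ih =>
      have := Ideal.add_mem _ (Ideal.pow_le_pow_right (by omega) (hsucc (m + d))) ih
      simpa [add_assoc] using this
  obtain ⟨L, hL⟩ := IsPrecomplete.prec (I := maximalIdeal R) inferInstance (f := f)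
    (fun {m n} hmn => by
      obtain ⟨d, rfl⟩ := Nat.exists_eq_add_of_le hmn
      rw [SModEq.comm, SModEq.sub_mem, smul_eq_mul, Ideal.mul_top]
      exact hle m d)
  refine ⟨L, fun n => ?_⟩
  -- `quot n` is the quotient by `𝔪 ^ (n + 1)`, so the limit is compared with `f (n + 1)` rather
  -- than `f n`.
  have h := hL (n + 1)
  rw [SModEq.sub_mem, smul_eq_mul, Ideal.mul_top, ← quotProj_eq_zero_iff, map_sub, sub_eq_zero,
    ← quotTrans_quotProj, hf, ha] at h
  exact h.symm

theorem exists_hom_comp_quotProj_eq {R A : CHat k} (u : ∀ n, R ⟶ A.quot n)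
    (hu : ∀ n, u (n + 1) ≫ A.quotTrans n = u n) : ∃ v : R ⟶ A, ∀ n, v ≫ A.quotProj n = u n := by
  choose f hf using fun r => A.exists_quotProj_eq (fun n => (u n).toAlgHom r)
    fun n => congrArg (fun h : R ⟶ A.quot n => h.toAlgHom r) (hu n)
  refine ⟨ofAlgHom
    { toFun := f
      map_one' := A.eq_of_quotProj fun n => by simp [hf]
      map_mul' := fun r s => A.eq_of_quotProj fun n => by simp [hf]
      map_zero' := A.eq_of_quotProj fun n => by simp [hf]
      map_add' := fun r s => A.eq_of_quotProj fun n => by simp [hf]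
      commutes' := fun c => A.eq_of_quotProj fun n => by simp [hf] }, fun n => ?_⟩
  ext r
  exact hf r n

/-- The morphism `R → k → S` of `Ĉ`. -/
noncomputable def augHom (R S : CHat k) : R ⟶ S := ofAlgHom ((Algebra.ofId k S).comp (aug R))

theorem augHom_apply (R S : CHat k) (r : R) :
    (augHom R S).toAlgHom r = algebraMap k S (aug R r) := rfl

end CHat

/-! ### Framed deformations of a matrix representation -/

section FramedRep

variable {k : Type u} [Field k] {H : Type u} [NonUnitalRing H] [Module k H]
  {n : Type} [Fintype n] [DecidableEq n]

/-- A framed deformation over `R` of a matrix representation `ρ₀` of a non-unital algebra. -/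
@[ext] structure FramedRep (ρ₀ : H →ₙₐ[k] Matrix n n k) (R : CHat k) where
  rep : H →ₙₐ[k] Matrix n n R
  aug_rep : ∀ x, (aug R).mapMatrix (rep x) = ρ₀ x

theorem mapMatrix_aug_eq_one_iff {R : CHat k} (g : Matrix n n R) :
    (aug R).mapMatrix g = 1 ↔ ∀ i j, (g - 1) i j ∈ maximalIdeal R := by
  rw [← sub_eq_zero, ← map_one ((aug R).mapMatrix : Matrix n n R →ₐ[k] _), ← map_sub,
    ← Matrix.ext_iff]
  simp only [← aug_eq_zero_iff]
  rfl

theorem isUnit_of_isUnit_mapMatrix_aug {R : CHat k} {g : Matrix n n R}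
    (h : IsUnit ((aug R).mapMatrix g)) : IsUnit g := by
  rw [Matrix.isUnit_iff_isUnit_det] at h ⊢
  rw [isUnit_iff_aug_ne_zero, AlgHom.map_det]
  exact h.ne_zero

theorem isUnit_of_mapMatrix_aug_eq_one {R : CHat k} {g : Matrix n n R}
    (h : (aug R).mapMatrix g = 1) : IsUnit g :=
  isUnit_of_isUnit_mapMatrix_aug (h ▸ isUnit_one)

theorem mapMatrix_aug_comp {R S : CHat k} (θ : R ⟶ S) (M : Matrix n n R) :
    (aug S).mapMatrix (θ.toAlgHom.mapMatrix M) = (aug R).mapMatrix M := by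
  ext i j
  exact aug_comp θ _

namespace FramedRep

variable {ρ₀ : H →ₙₐ[k] Matrix n n k} {R S : CHat k}

theorem ext_apply {ρ ρ' : FramedRep ρ₀ R} (h : ∀ x, ρ.rep x = ρ'.rep x) : ρ = ρ' :=
  FramedRep.ext (NonUnitalAlgHom.ext h)

theorem rep_sub_mem (ρ : FramedRep ρ₀ R) (x : H) (i j : n) :
    ρ.rep x i j - algebraMap k R (ρ₀ x i j) ∈ maximalIdeal R := by
  rw [← aug_eq_zero_iff, map_sub, aug_algebraMap, ← ρ.aug_rep x]
  simp

/-- The pushforward of a framed deformation along a morphism of `Ĉ`. -/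
def map (θ : R ⟶ S) (ρ : FramedRep ρ₀ R) : FramedRep ρ₀ S where
  rep := ((θ.toAlgHom.mapMatrix : Matrix n n R →ₐ[k] Matrix n n S) :
    Matrix n n R →ₙₐ[k] Matrix n n S).comp ρ.rep
  aug_rep x := (mapMatrix_aug_comp θ (ρ.rep x)).trans (ρ.aug_rep x)

theorem map_rep (θ : R ⟶ S) (ρ : FramedRep ρ₀ R) (x : H) :
    (ρ.map θ).rep x = θ.toAlgHom.mapMatrix (ρ.rep x) := rfl

theorem map_rep_apply (θ : R ⟶ S) (ρ : FramedRep ρ₀ R) (x : H) (i j : n) :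
    (ρ.map θ).rep x i j = θ.toAlgHom (ρ.rep x i j) := rfl

theorem map_comp {T : CHat k} (θ : R ⟶ S) (η : S ⟶ T) (ρ : FramedRep ρ₀ R) :
    ρ.map (θ ≫ η) = (ρ.map θ).map η := rfl

/-- Strict equivalence of framed deformations: conjugation by a matrix which reduces to `1`. -/
def Equiv (ρ ρ' : FramedRep ρ₀ R) : Prop :=
  ∃ g : Matrix n n R, (aug R).mapMatrix g = 1 ∧ ∀ x, g * ρ.rep x = ρ'.rep x * g

theorem exists_conj (ρ : FramedRep ρ₀ R) {g : Matrix n n R} (hg : (aug R).mapMatrix g = 1) :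
    ∃ ρ' : FramedRep ρ₀ R, ∀ x, g * ρ.rep x = ρ'.rep x * g := by
  obtain ⟨u, rfl⟩ := isUnit_of_mapMatrix_aug_eq_one hg
  have hu : (aug R).mapMatrix (↑u⁻¹ : Matrix n n R) = 1 := by
    have := congrArg (aug R).mapMatrix u.inv_mul
    rwa [map_mul, hg, mul_one, map_one] at this
  refine ⟨⟨{ toFun := fun x => u * ρ.rep x * (↑u⁻¹ : Matrix n n R)
             map_smul' := fun c x => by simp
             map_zero' := by simp
             map_add' := fun x y => by simp [mul_add, add_mul]
             map_mul' := fun x y => by simp [mul_assoc] }, fun x => ?_⟩, fun x => ?_⟩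
  · change (aug R).mapMatrix ((u : Matrix n n R) * ρ.rep x * (↑u⁻¹ : Matrix n n R)) = _
    rw [map_mul, map_mul, hg, hu, ρ.aug_rep, one_mul, mul_one]
  · exact (Units.inv_mul_cancel_right _ _).symm

end FramedRep

/-- A presentation of a functor on `Ĉ` as the functor of strict equivalence classes of framed
deformations of `ρ₀`. -/
structure FramedPresentation (ρ₀ : H →ₙₐ[k] Matrix n n k) (F : CHat k ⥤ Type w) where
  cls : ∀ {R : CHat k}, FramedRep ρ₀ R → F.obj R
  cls_surjective : ∀ R : CHat k, Function.Surjective (cls (R := R))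
  cls_eq_iff : ∀ {R : CHat k} (ρ ρ' : FramedRep ρ₀ R), cls ρ = cls ρ' ↔ ρ.Equiv ρ'
  map_cls : ∀ {R S : CHat k} (θ : R ⟶ S) (ρ : FramedRep ρ₀ R), F.map θ (cls ρ) = cls (ρ.map θ)

namespace FramedPresentation

variable {ρ₀ : H →ₙₐ[k] Matrix n n k} {F : CHat k ⥤ Type w}

/-- An arbitrary entrywise lift of the conjugating matrix still reduces to `1` over `k`, because `p`
respects the residue maps. Conjugating by it upgrades an equality of classes over `A` to an equality
of framed deformations. -/
theorem exists_lift (P : FramedPresentation ρ₀ F) {B A : CHat k} (p : B ⟶ A) (hp : Function.Surjective p.toAlgHom)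
    (b : F.obj B) (ρ : FramedRep ρ₀ A) (h : F.map p b = P.cls ρ) :
    ∃ ρ' : FramedRep ρ₀ B, P.cls ρ' = b ∧ ρ'.map p = ρ := by
  obtain ⟨ρ₁, rfl⟩ := P.cls_surjective B b
  rw [P.map_cls, P.cls_eq_iff] at h
  obtain ⟨g, hg, hgρ⟩ := h
  choose f hf using hp
  let g' : Matrix n n B := Matrix.of fun i j => f (g i j)
  have hg' : p.toAlgHom.mapMatrix g' = g := by
    ext i j
    exact hf _
  have hg₁ : (aug B).mapMatrix g' = 1 := by rw [← mapMatrix_aug_comp p, hg', hg]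
  obtain ⟨ρ₂, hρ₂⟩ := ρ₁.exists_conj hg₁
  refine ⟨ρ₂, ((P.cls_eq_iff _ _).2 ⟨g', hg₁, hρ₂⟩).symm, FramedRep.ext_apply fun x => ?_⟩
  refine (isUnit_of_mapMatrix_aug_eq_one hg).mul_right_cancel ?_
  have := congrArg p.toAlgHom.mapMatrix (hρ₂ x)
  rw [map_mul, map_mul, hg'] at this
  rw [← hgρ, FramedRep.map_rep, FramedRep.map_rep, ← this]

theorem eq_of_maximalIdeal_eq_bot (P : FramedPresentation ρ₀ F) {A : CHat k}
    (hA : maximalIdeal A = ⊥) (a b : F.obj A) : a = b := by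
  obtain ⟨ρ, rfl⟩ := P.cls_surjective A a
  obtain ⟨ρ', rfl⟩ := P.cls_surjective A b
  congr 1
  refine FramedRep.ext_apply fun x => ?_
  ext i j
  have h := ρ.rep_sub_mem x i j
  have h' := ρ'.rep_sub_mem x i j
  rw [hA, Ideal.mem_bot, sub_eq_zero] at h h'
  rw [h, h']

end FramedPresentation

/-- `ρ₀` is finitely determined if the framed deformations of `ρ₀` are, linearly and uniformly,
determined by their values at finitely many elements. -/
def FinitelyDetermined (ρ₀ : H →ₙₐ[k] Matrix n n k) : Prop :=
  ∃ (r : ℕ) (β : Fin r → H) (κ : H →ₗ[k] Fin r → k),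
    ∀ (R : CHat k) (ρ : FramedRep ρ₀ R) (x : H), ρ.rep x = ∑ s, κ x s • ρ.rep (β s)

end FramedRep

/-! ### Continuity -/

section Continuity

variable {k : Type u} [Field k] {H : Type u} [NonUnitalRing H] [Module k H]
  {n : Type} [Fintype n] [DecidableEq n] {ρ₀ : H →ₙₐ[k] Matrix n n k}

theorem mem_ideal_smul_top_of_entries {R ι : Type*} [CommRing R] [Fintype ι] (I : Ideal R)
    (y : ι → Matrix n n R) (hy : ∀ s i j, y s i j ∈ I) :
    y ∈ (I • ⊤ : Submodule R (ι → Matrix n n R)) := by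
  classical
  rw [← Finset.univ_sum_single y]
  refine Submodule.sum_mem _ fun s _ => ?_
  rw [Matrix.matrix_eq_sum_single (y s), ← LinearMap.coe_single (R := R), map_sum]
  refine Submodule.sum_mem _ fun i _ => ?_
  rw [map_sum]
  refine Submodule.sum_mem _ fun j _ => ?_
  rw [← mul_one (y s i j), ← smul_eq_mul, ← Matrix.smul_single, map_smul]
  exact Submodule.smul_mem_smul (hy s i j) trivial

/-- The conjugating matrices over the various quotients need not be compatible. Instead,
intertwining is the equation `L g = 0` for a linear map `L` between finite modules, which finite
determination makes possible, and solvability modulo all powers of `𝔪` implies solvability by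
Krull's theorem. -/
theorem FramedRep.equiv_of_forall_quot (hfd : FinitelyDetermined ρ₀) {R : CHat k}
    (ρ ρ' : FramedRep ρ₀ R) (h : ∀ m, (ρ.map (R.quotProj m)).Equiv (ρ'.map (R.quotProj m))) :
    ρ.Equiv ρ' := by
  obtain ⟨r, β, κ, hβ⟩ := hfd
  let L : Matrix n n R →ₗ[R] (Fin r → Matrix n n R) := LinearMap.pi fun s =>
    LinearMap.mulRight R (ρ.rep (β s)) - LinearMap.mulLeft R (ρ'.rep (β s))
  have hL : ∀ X s, L X s = X * ρ.rep (β s) - ρ'.rep (β s) * X := fun _ _ => rfl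
  let W : Submodule R (Matrix n n R) :=
    { carrier := {X | ∀ i j, X i j ∈ maximalIdeal R}
      add_mem' := fun hX hY i j => Ideal.add_mem _ (hX i j) (hY i j)
      zero_mem' := fun i j => Ideal.zero_mem _
      smul_mem' := fun c X hX i j => Ideal.mul_mem_left _ c (hX i j) }
  -- The cokernel of `L` restricted to `W` is a finite module over a Noetherian local ring, hence
  -- Hausdorff. The class of `L 1` equals that of `L g'` for each lifted conjugating matrix `g'`, so
  -- it lies in every `𝔪 ^ m` multiple.
  have key : L 1 ∈ W.map L := by
    rw [← Submodule.Quotient.mk_eq_zero]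
    refine IsHausdorff.haus (I := maximalIdeal R) inferInstance _ fun m => ?_
    rw [SModEq.zero]
    obtain ⟨g, hg, hgρ⟩ := h m
    choose f hf using R.quotProj_surjective m
    let g' : Matrix n n R := Matrix.of fun i j => f (g i j)
    have hg' : (R.quotProj m).toAlgHom.mapMatrix g' = g := by
      ext i j
      exact hf _
    have h₁ : g' - 1 ∈ W :=
      (mapMatrix_aug_eq_one_iff g').1 (by rw [← mapMatrix_aug_comp (R.quotProj m), hg', hg])
    have h₂ : L g' ∈ (maximalIdeal R ^ m • ⊤ : Submodule R (Fin r → Matrix n n R)) := by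
      refine mem_ideal_smul_top_of_entries _ _ fun s i j => ?_
      refine Ideal.pow_le_pow_right (Nat.le_succ m) ?_
      rw [← quotProj_eq_zero_iff, hL]
      have h₃ : (R.quotProj m).toAlgHom.mapMatrix (g' * ρ.rep (β s) - ρ'.rep (β s) * g') = 0 := by
        rw [map_sub, map_mul, map_mul, hg', sub_eq_zero]
        exact hgρ _
      exact congrFun (congrFun h₃ i) j
    have h₄ : Submodule.Quotient.mk (p := W.map L) (L 1) = (W.map L).mkQ (L g') := by
      rw [Submodule.mkQ_apply, Submodule.Quotient.eq, ← map_sub, ← neg_mem_iff, ← map_neg, neg_sub]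
      exact Submodule.mem_map_of_mem h₁
    rw [h₄]
    have h₅ := Submodule.mem_map_of_mem (f := (W.map L).mkQ) h₂
    rw [Submodule.map_smul''] at h₅
    exact Submodule.smul_mono le_rfl le_top h₅
  obtain ⟨X, hX, hX1⟩ := key
  have hg : (aug R).mapMatrix (1 - X) = 1 := by
    rw [mapMatrix_aug_eq_one_iff]
    intro i j
    rw [sub_sub_cancel_left]
    exact neg_mem (hX i j)
  refine ⟨1 - X, hg, fun x => ?_⟩
  rw [hβ, hβ R ρ', Finset.mul_sum, Finset.sum_mul]
  refine Finset.sum_congr rfl fun s _ => ?_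
  have h₀ : L (1 - X) s = 0 := by rw [map_sub, hX1, sub_self]; rfl
  rw [hL, sub_eq_zero] at h₀
  rw [mul_smul_comm, smul_mul_assoc, h₀]

theorem FramedRep.exists_limit {R : CHat k} (ρ : ∀ m, FramedRep ρ₀ (R.quot m))
    (hρ : ∀ m, (ρ (m + 1)).map (R.quotTrans m) = ρ m) :
    ∃ ρ' : FramedRep ρ₀ R, ∀ m, ρ'.map (R.quotProj m) = ρ m := by
  have h₀ : ∀ x i j m, (R.quotTrans m).toAlgHom ((ρ (m + 1)).rep x i j) = (ρ m).rep x i j :=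
    fun x i j m => by rw [← hρ m]; rfl
  choose f hf using fun x i j => R.exists_quotProj_eq (fun m => (ρ m).rep x i j) (h₀ x i j)
  refine ⟨⟨{ toFun := fun x => Matrix.of (f x), map_smul' := ?_, map_zero' := ?_, map_add' := ?_,
             map_mul' := ?_ }, ?_⟩, ?_⟩
  · intro c x
    ext i j
    refine R.eq_of_quotProj fun m => ?_
    simp [hf]
  · ext i j
    refine R.eq_of_quotProj fun m => ?_
    simp [hf]
  · intro x y
    ext i j
    refine R.eq_of_quotProj fun m => ?_
    simp [hf]
  · intro x y
    ext i j
    refine R.eq_of_quotProj fun m => ?_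
    simp [hf, Matrix.mul_apply]
  · intro x
    rw [← (ρ 0).aug_rep x, ← mapMatrix_aug_comp (R.quotProj 0)]
    congr 1
    ext i j
    exact hf x i j 0
  · intro m
    refine FramedRep.ext_apply fun x => ?_
    ext i j
    exact hf x i j m

theorem FramedPresentation.isContinuous {F : CHat k ⥤ Type w} (P : FramedPresentation ρ₀ F)
    (hfd : FinitelyDetermined ρ₀) : IsContinuous F := by
  intro R
  constructor
  · intro a b hab
    obtain ⟨ρ, rfl⟩ := P.cls_surjective R a
    obtain ⟨ρ', rfl⟩ := P.cls_surjective R b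
    rw [P.cls_eq_iff]
    refine FramedRep.equiv_of_forall_quot hfd ρ ρ' fun m => ?_
    rw [← P.cls_eq_iff, ← P.map_cls, ← P.map_cls]
    exact congrFun (congrArg Subtype.val hab) m
  · rintro ⟨x, hx⟩
    obtain ⟨ρ₁, hρ₁⟩ := P.cls_surjective _ (x 0)
    -- Recursive choice of representatives: each one restricts on the nose to the previous one, so
    -- the entries have limits in `R`.
    choose f hf hf' using fun (m : ℕ) (ρ : {ρ : FramedRep ρ₀ (R.quot m) // P.cls ρ = x m}) =>
      P.exists_lift (R.quotTrans m) (R.quotTrans_surjective m) (x (m + 1)) ρ.1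
        ((hx m).trans ρ.2.symm)
    let ρ : ∀ m, {ρ : FramedRep ρ₀ (R.quot m) // P.cls ρ = x m} :=
      fun m => Nat.rec ⟨ρ₁, hρ₁⟩ (fun m ρ => ⟨f m ρ, hf m ρ⟩) m
    obtain ⟨ρ', hρ'⟩ := FramedRep.exists_limit (fun m => (ρ m).1) fun m => hf' m (ρ m)
    refine ⟨P.cls ρ', Subtype.ext (funext fun m => ?_)⟩
    change F.map (R.quotProj m) (P.cls ρ') = x m
    rw [P.map_cls, hρ', (ρ m).2]

end Continuity

/-! ### Power series rings as objects of `Ĉ` -/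

section PowerSeries

variable (k : Type u) [Field k] (σ : Type)

theorem MvPolynomial.mem_idealOfVars_iff_constantCoeff (p : MvPolynomial σ k) :
    p ∈ MvPolynomial.idealOfVars σ k ↔ MvPolynomial.constantCoeff p = 0 := by
  rw [← pow_one (MvPolynomial.idealOfVars σ k), MvPolynomial.mem_pow_idealOfVars_iff']
  constructor
  · intro h
    exact h 0 (by simp)
  · intro h x hx
    have : x = 0 := by
      rw [← Finsupp.degree_eq_zero_iff]
      omega
    rw [this]
    exact h

instance isMaximal_idealOfVars : (MvPolynomial.idealOfVars σ k).IsMaximal := by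
  have : MvPolynomial.idealOfVars σ k =
      RingHom.ker (MvPolynomial.constantCoeff : MvPolynomial σ k →+* k) := by
    ext p
    exact MvPolynomial.mem_idealOfVars_iff_constantCoeff k σ p
  rw [this]
  exact RingHom.ker_isMaximal_of_surjective _ fun c => ⟨MvPolynomial.C c, by simp⟩

variable [Finite σ]

namespace CHat

/-- The ring of formal power series in finitely many variables, as an object of `Ĉ`, constructed as
the completion of a polynomial ring. -/
noncomputable def powerSeries : CHat k :=
  let I := MvPolynomial.idealOfVars σ k
  haveI hmax : (I.map (algebraMap _ (AdicCompletion I (MvPolynomial σ k)))).IsMaximal :=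
    AdicCompletion.isMaximal_map_of_le I I le_rfl (MvPolynomial.idealOfVars_fg σ k)
  haveI hcomplete := AdicCompletion.isAdicComplete_self I (MvPolynomial.idealOfVars_fg σ k)
  haveI : IsLocalRing (AdicCompletion I (MvPolynomial σ k)) :=
    isLocalRing_of_isAdicComplete_maximal (I.map (algebraMap _ _))
  haveI : IsNoetherianRing (AdicCompletion I (MvPolynomial σ k)) :=
    isNoetherianRing_of_ringEquiv (MvPowerSeries σ k)
      (MvPowerSeries.toAdicCompletionAlgEquiv σ k).toRingEquiv
  have hm : maximalIdeal (AdicCompletion I (MvPolynomial σ k)) =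
      I.map (algebraMap _ (AdicCompletion I (MvPolynomial σ k))) :=
    (IsLocalRing.eq_maximalIdeal hmax).symm
  { carrier := AdicCompletion I (MvPolynomial σ k)
    isAdicComplete := hm ▸ hcomplete
    residue_bijective := residue_bijective_of fun s => by
      obtain ⟨p, hp⟩ := Ideal.Quotient.mk_surjective (AdicCompletion.evalOneₐ I s)
      refine ⟨MvPolynomial.constantCoeff p, ?_⟩
      rw [hm, ← AdicCompletion.ker_evalOneₐ_eq_map I (MvPolynomial.idealOfVars_fg σ k)]
      change AdicCompletion.evalOneₐ I (s - AdicCompletion.of I _ (MvPolynomial.C _)) = 0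
      rw [map_sub, AdicCompletion.evalOneₐ_of, ← hp, sub_eq_zero]
      refine (Ideal.Quotient.eq).2 ?_
      rw [MvPolynomial.mem_idealOfVars_iff_constantCoeff]
      simp }

variable {k σ}

/-- The inclusion of polynomials into formal power series. -/
noncomputable def polyMap : MvPolynomial σ k →ₐ[k] powerSeries k σ :=
  (AlgHom.restrictScalars k (Algebra.ofId (MvPolynomial σ k)
    (AdicCompletion (MvPolynomial.idealOfVars σ k) (MvPolynomial σ k))) :
    MvPolynomial σ k →ₐ[k] AdicCompletion (MvPolynomial.idealOfVars σ k) (MvPolynomial σ k))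

theorem maximalIdeal_powerSeries : maximalIdeal (powerSeries k σ) =
    (MvPolynomial.idealOfVars σ k).map (polyMap (k := k) (σ := σ)).toRingHom := by
  have h : ((MvPolynomial.idealOfVars σ k).map
      (polyMap (k := k) (σ := σ)).toRingHom).IsMaximal :=
    AdicCompletion.isMaximal_map_of_le _ (MvPolynomial.idealOfVars σ k) le_rfl
      (MvPolynomial.idealOfVars_fg σ k)
  exact (IsLocalRing.eq_maximalIdeal h).symm

theorem polyMap_X_mem (i : σ) : polyMap (k := k) (MvPolynomial.X i) ∈
    maximalIdeal (powerSeries k σ) := by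
  rw [maximalIdeal_powerSeries]
  exact Ideal.mem_map_of_mem (polyMap (k := k) (σ := σ)).toRingHom
    (Ideal.subset_span ⟨i, rfl⟩)

theorem exists_sub_polyMap_mem (s : powerSeries k σ) (N : ℕ) :
    ∃ p : MvPolynomial σ k, s - polyMap p ∈ maximalIdeal (powerSeries k σ) ^ N := by
  let I := MvPolynomial.idealOfVars σ k
  obtain ⟨p, hp⟩ := Submodule.Quotient.mk_surjective _ (AdicCompletion.eval I (MvPolynomial σ k) N s)
  refine ⟨p, ?_⟩
  let s' : AdicCompletion I (MvPolynomial σ k) := s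
  have h : s' - AdicCompletion.of I (MvPolynomial σ k) p ∈
      (AdicCompletion.eval I (MvPolynomial σ k) N).ker := by
    rw [LinearMap.mem_ker, map_sub, ← hp, AdicCompletion.eval_of]
    exact sub_self _
  rw [← AdicCompletion.pow_smul_top_eq_ker_eval (MvPolynomial.idealOfVars_fg σ k),
    Ideal.smul_top_eq_map] at h
  rw [maximalIdeal_powerSeries, ← Ideal.map_pow]
  exact h

theorem map_mem_maximalIdeal_pow {R S : CHat k} (f : R ⟶ S) {r : R} {N : ℕ}
    (hr : r ∈ maximalIdeal R ^ N) : f.toAlgHom r ∈ maximalIdeal S ^ N := by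
  have h : (maximalIdeal R).map f.toAlgHom.toRingHom ≤ maximalIdeal S := by
    rw [Ideal.map_le_iff_le_comap]
    exact fun r hr => f.map_maximalIdeal r hr
  refine Ideal.pow_right_mono h N ?_
  rw [← Ideal.map_pow]
  exact Ideal.mem_map_of_mem f.toAlgHom.toRingHom hr

/-- Some power of the maximal ideal of an Artinian target vanishes, so a morphism only sees a power
series up to a polynomial approximation. -/
theorem powerSeries_hom_ext {A : CHat k} [IsArtinianRing A] {f g : powerSeries k σ ⟶ A}
    (h : ∀ i, f.toAlgHom (polyMap (MvPolynomial.X i)) = g.toAlgHom (polyMap (MvPolynomial.X i))) :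
    f = g := by
  obtain ⟨N, hN⟩ := A.exists_maximalIdeal_pow_eq_bot
  have hpoly : f.toAlgHom.comp polyMap = g.toAlgHom.comp polyMap := MvPolynomial.algHom_ext h
  ext s
  obtain ⟨p, hp⟩ := exists_sub_polyMap_mem s N
  have hf := map_mem_maximalIdeal_pow f hp
  have hg := map_mem_maximalIdeal_pow g hp
  rw [hN, Ideal.mem_bot, map_sub, sub_eq_zero] at hf hg
  rw [hf, hg]
  exact congrArg (fun q => q p) hpoly

/-- With `𝔪_A ^ N = 0`, evaluation of polynomials at `a` kills the `N`-th power of the ideal of the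
variables and hence factors through a truncation. -/
theorem exists_powerSeries_hom {A : CHat k} [IsArtinianRing A] (a : σ → A)
    (ha : ∀ i, a i ∈ maximalIdeal A) :
    ∃ f : powerSeries k σ ⟶ A, ∀ i, f.toAlgHom (polyMap (MvPolynomial.X i)) = a i := by
  obtain ⟨N, hN⟩ := A.exists_maximalIdeal_pow_eq_bot
  let I := MvPolynomial.idealOfVars σ k
  let φ : MvPolynomial σ k →ₐ[k] A := MvPolynomial.aeval a
  have hI : I.map φ.toRingHom ≤ maximalIdeal A := by
    rw [Ideal.map_le_iff_le_comap]
    refine Ideal.span_le.2 ?_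
    rintro _ ⟨i, rfl⟩
    change MvPolynomial.aeval a (MvPolynomial.X i) ∈ maximalIdeal A
    rw [MvPolynomial.aeval_X]
    exact ha i
  have hker : ∀ p ∈ I ^ N, φ p = 0 := fun p hp => by
    have := Ideal.pow_right_mono hI N
      (by rw [← Ideal.map_pow]; exact Ideal.mem_map_of_mem φ.toRingHom hp)
    rwa [hN] at this
  refine ⟨ofAlgHom (R := powerSeries k σ) ((Ideal.Quotient.liftₐ (I ^ N) φ hker).comp
    ((AdicCompletion.evalₐ I N).restrictScalars k)), fun i => ?_⟩
  change Ideal.Quotient.liftₐ (I ^ N) φ hker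
    (AdicCompletion.evalₐ I N (AdicCompletion.of I _ (MvPolynomial.X i))) = a i
  rw [AdicCompletion.evalₐ_of]
  exact MvPolynomial.aeval_X a i

end CHat

end PowerSeries

/-! ### Quotients of objects of `Ĉ` -/

section Quotient

variable {k : Type u} [Field k]

/-- Completion preserves surjections, so `S` is precomplete because `R` is; it is Hausdorff because
it is Noetherian local. -/
theorem isAdicComplete_of_surjective {R S : Type*} [CommRing R] [IsNoetherianRing R] [IsLocalRing R]
    [IsAdicComplete (maximalIdeal R) R] [CommRing S] [IsLocalRing S] [IsNoetherianRing S]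
    (f : R →+* S) (hf : Function.Surjective f) : IsAdicComplete (maximalIdeal S) S := by
  have hm : (maximalIdeal R).map f = maximalIdeal S :=
    IsLocalRing.eq_maximalIdeal ((Ideal.map_eq_top_or_isMaximal_of_surjective f hf
      inferInstance).resolve_left fun h => by
        have : (maximalIdeal R).map f ≤ maximalIdeal S := by
          rw [Ideal.map_le_iff_le_comap]
          have := hf.isLocalHom f
          exact (IsLocalRing.maximalIdeal_comap f).ge
        exact (maximalIdeal.isMaximal S).ne_top (top_le_iff.1 (h ▸ this)))
  let : Algebra R S := f.toAlgebra
  have hpre : IsPrecomplete (maximalIdeal R) S := by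
    rw [← AdicCompletion.of_surjective_iff]
    intro y
    obtain ⟨x, rfl⟩ := AdicCompletion.map_surjective (maximalIdeal R)
      (f := Algebra.linearMap R S) hf y
    obtain ⟨r, rfl⟩ := AdicCompletion.of_surjective (maximalIdeal R) R x
    exact ⟨Algebra.linearMap R S r, (AdicCompletion.map_of _ _ _).symm⟩
  rw [← hm]
  have h1 : IsPrecomplete ((maximalIdeal R).map (algebraMap R S)) S :=
    IsPrecomplete.map_algebraMap_iff.2 hpre
  have h2 : IsHausdorff ((maximalIdeal R).map f) S := by rw [hm]; infer_instance
  exact { toIsHausdorff := h2, toIsPrecomplete := h1 }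

namespace CHat

/-- The quotient of an object of `Ĉ` by a proper ideal. -/
noncomputable def quotient (R : CHat k) (J : Ideal R) (hJ : J ≤ maximalIdeal R) : CHat k :=
  haveI : Nontrivial (R ⧸ J) := Ideal.Quotient.nontrivial_iff.2
    (ne_top_of_le_ne_top (maximalIdeal.isMaximal R).ne_top hJ)
  haveI : IsLocalRing (R ⧸ J) :=
    IsLocalRing.of_surjective' (Ideal.Quotient.mk J) Ideal.Quotient.mk_surjective
  haveI := isAdicComplete_of_surjective (Ideal.Quotient.mk J) Ideal.Quotient.mk_surjective
  { carrier := R ⧸ J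
    residue_bijective := residue_bijective_of fun s => by
      obtain ⟨r, rfl⟩ := Ideal.Quotient.mk_surjective s
      refine ⟨aug R r, fun hu => ?_⟩
      have hu' : IsUnit (Ideal.Quotient.mk J (r - algebraMap k R (aug R r))) := hu
      rw [isUnit_iff_exists_inv] at hu'
      obtain ⟨t, ht⟩ := hu'
      obtain ⟨t, rfl⟩ := Ideal.Quotient.mk_surjective t
      rw [← map_mul, ← map_one (Ideal.Quotient.mk J), Ideal.Quotient.eq] at ht
      have h1 := Ideal.sub_mem _ (Ideal.mul_mem_right t _ (sub_aug_mem R r)) (hJ ht)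
      rw [sub_sub_cancel] at h1
      exact h1 isUnit_one }

/-- The projection onto the quotient of an object of `Ĉ` by a proper ideal. -/
noncomputable def quotientMk (R : CHat k) (J : Ideal R) (hJ : J ≤ maximalIdeal R) :
    R ⟶ R.quotient J hJ := ofAlgHom (S := R.quotient J hJ) (Ideal.Quotient.mkₐ k J)

variable {R A : CHat k} {J : Ideal R} {hJ : J ≤ maximalIdeal R}

theorem quotientMk_surjective : Function.Surjective (R.quotientMk J hJ).toAlgHom :=
  Ideal.Quotient.mk_surjective

theorem quotientMk_eq_zero {r : R} (hr : r ∈ J) : (R.quotientMk J hJ).toAlgHom r = 0 :=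
  Ideal.Quotient.eq_zero_iff_mem.2 hr

theorem exists_quotient_hom (f : R ⟶ A) (hf : ∀ r ∈ J, f.toAlgHom r = 0) :
    ∃ g : R.quotient J hJ ⟶ A, R.quotientMk J hJ ≫ g = f :=
  ⟨ofAlgHom (R := R.quotient J hJ) (Ideal.Quotient.liftₐ J f.toAlgHom hf), rfl⟩

theorem quotient_hom_ext {f g : R.quotient J hJ ⟶ A}
    (h : R.quotientMk J hJ ≫ f = R.quotientMk J hJ ≫ g) : f = g := by
  ext s
  obtain ⟨r, rfl⟩ := quotientMk_surjective s
  exact congrArg (fun q : R ⟶ A => q.toAlgHom r) h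

end CHat

end Quotient

/-! ### A slice for the conjugation action -/

section Slice

variable {k : Type u} [Field k] {H : Type u} [NonUnitalRing H] [Module k H]
  {n : Type} [Fintype n] [DecidableEq n] {ρ₀ : H →ₙₐ[k] Matrix n n k} {r : ℕ} {β : Fin r → H}

/-- A linear section of the map onto its image, extended to the whole target, is a generalised
inverse. Then `A * B` is a projection onto the image of `A`; for `A = adMatrix ρ₀ β` its kernel is
the slice. -/
theorem Matrix.exists_mul_mul_eq_self {l m : Type*} [Fintype l] [Fintype m] [DecidableEq l]
    [DecidableEq m] (A : Matrix l m k) : ∃ B : Matrix m l k, A * B * A = A := by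
  let f := Matrix.toLin' A
  obtain ⟨g, hg⟩ := LinearMap.exists_rightInverse_of_surjective f.rangeRestrict f.range_rangeRestrict
  obtain ⟨g', hg'⟩ := LinearMap.exists_extend g
  refine ⟨LinearMap.toMatrix' g', ?_⟩
  apply Matrix.toLin'.injective
  rw [Matrix.toLin'_mul, Matrix.toLin'_mul, Matrix.toLin'_toMatrix']
  ext1 x
  have h₁ : g' (f (Pi.single x 1)) = g (f.rangeRestrict (Pi.single x 1)) :=
    congrArg (fun q => q (f.rangeRestrict (Pi.single x 1))) hg'
  have h₂ := congrArg (fun q => (q (f.rangeRestrict (Pi.single x 1)) : l → k)) hg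
  ext1
  simp only [LinearMap.coe_comp, Function.comp_apply, LinearMap.coe_single]
  change f (g' (f (Pi.single x 1))) = f (Pi.single x 1)
  rw [h₁]
  exact h₂

theorem mulVec_map_mem {R l m : Type*} [CommRing R] [Algebra k R] [Fintype m] (A : Matrix l m k)
    (I : Ideal R) {v : m → R} (hv : ∀ j, v j ∈ I) (i : l) :
    (A.map (algebraMap k R)).mulVec v i ∈ I :=
  Ideal.sum_mem _ fun j _ => Ideal.mul_mem_left _ _ (hv j)

variable (ρ₀ β) in
/-- The matrix of the linear map `X ↦ (X ρ₀(β_s) - ρ₀(β_s) X)_s`. -/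
def adMatrix : Matrix (Fin r × n × n) (n × n) k := Matrix.of fun t q =>
  (if t.2.1 = q.1 then ρ₀ (β t.1) q.2 t.2.2 else 0) -
    (if t.2.2 = q.2 then ρ₀ (β t.1) t.2.1 q.1 else 0)

theorem adMatrix_mulVec {R : Type*} [CommRing R] [Algebra k R] (X : Matrix n n R)
    (t : Fin r × n × n) :
    ((adMatrix ρ₀ β).map (algebraMap k R)).mulVec (fun q => X q.1 q.2) t =
      (X * (ρ₀ (β t.1)).map (algebraMap k R) - (ρ₀ (β t.1)).map (algebraMap k R) * X)
        t.2.1 t.2.2 := by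
  obtain ⟨s, i, j⟩ := t
  simp only [Matrix.mulVec, dotProduct, Matrix.map_apply, adMatrix, Matrix.of_apply, map_sub,
    sub_mul, Finset.sum_sub_distrib, Fintype.sum_prod_type, Matrix.sub_apply, Matrix.mul_apply,
    apply_ite (algebraMap k R), map_zero, ite_mul, zero_mul, Finset.sum_ite_eq, Finset.mem_univ,
    if_true]
  congr 1
  · rw [Finset.sum_comm]
    simp [mul_comm]
  
namespace FramedRep

variable {R S : CHat k}

variable (β) in
/-- The entries of the differences `ρ(β_s) - ρ₀(β_s)`. -/
noncomputable def deviation (ρ : FramedRep ρ₀ R) (t : Fin r × n × n) : R :=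
  ρ.rep (β t.1) t.2.1 t.2.2 - algebraMap k R (ρ₀ (β t.1) t.2.1 t.2.2)

theorem deviation_mem (ρ : FramedRep ρ₀ R) (t : Fin r × n × n) :
    ρ.deviation β t ∈ maximalIdeal R := ρ.rep_sub_mem _ _ _

theorem deviation_map (θ : R ⟶ S) (ρ : FramedRep ρ₀ R) (t : Fin r × n × n) :
    (ρ.map θ).deviation β t = θ.toAlgHom (ρ.deviation β t) := by
  simp [deviation, map_rep_apply]

/-- An exact form of the infinitesimal action: the commutator with `ρ₀ x`, plus terms in which `X`
is multiplied by a deviation. If `X` has entries in `K`, the latter have entries in `𝔪 * K`. -/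
theorem sub_eq_of_conj {ρ ρ' : FramedRep ρ₀ R} {X : Matrix n n R} {x : H}
    (h : (1 + X) * ρ.rep x = ρ'.rep x * (1 + X)) :
    ρ'.rep x - ρ.rep x = (X * (ρ₀ x).map (algebraMap k R) - (ρ₀ x).map (algebraMap k R) * X) +
      (X * (ρ.rep x - (ρ₀ x).map (algebraMap k R)) -
        (ρ'.rep x - (ρ₀ x).map (algebraMap k R)) * X) := by
  rw [add_mul, mul_add, one_mul, mul_one] at h
  rw [mul_sub, sub_mul, sub_eq_iff_eq_add, ← sub_eq_iff_eq_add'.2 h.symm]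
  abel

theorem mul_sub_mem (ρ : FramedRep ρ₀ R) (x : H) {X : Matrix n n R} {K : Ideal R}
    (hX : ∀ i j, X i j ∈ K) (i j : n) :
    (X * (ρ.rep x - (ρ₀ x).map (algebraMap k R))) i j ∈ maximalIdeal R * K := by
  rw [mul_comm (maximalIdeal R)]
  exact Ideal.sum_mem _ fun _ _ => Ideal.mul_mem_mul (hX _ _) (ρ.rep_sub_mem _ _ _)

theorem sub_mul_mem (ρ : FramedRep ρ₀ R) (x : H) {X : Matrix n n R} {K : Ideal R}
    (hX : ∀ i j, X i j ∈ K) (i j : n) :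
    ((ρ.rep x - (ρ₀ x).map (algebraMap k R)) * X) i j ∈ maximalIdeal R * K :=
  Ideal.sum_mem _ fun _ _ => Ideal.mul_mem_mul (ρ.rep_sub_mem _ _ _) (hX _ _)

/-- One step of successive approximation: an error in `K` becomes an error in `𝔪 * K`, at the cost
of a conjugation congruent to `1` modulo `K`. -/
theorem exists_conj_deviation_mem (B : Matrix (n × n) (Fin r × n × n) k)
    (hB : adMatrix ρ₀ β * B * adMatrix ρ₀ β = adMatrix ρ₀ β) (K : Ideal R)
    (hK : K ≤ maximalIdeal R) (ρ : FramedRep ρ₀ R)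
    (h : ∀ t, ((adMatrix ρ₀ β * B).map (algebraMap k R)).mulVec (ρ.deviation β) t ∈ K) :
    ∃ (ρ' : FramedRep ρ₀ R) (g : Matrix n n R), (∀ i j, (g - 1) i j ∈ K) ∧
      (∀ x, g * ρ.rep x = ρ'.rep x * g) ∧
      ∀ t, ((adMatrix ρ₀ β * B).map (algebraMap k R)).mulVec (ρ'.deviation β) t ∈
        maximalIdeal R * K := by
  set D := adMatrix ρ₀ β with hD
  let a : k →+* R := algebraMap k R
  set c := ((D * B).map a).mulVec (ρ.deviation β) with hc
  -- Write `D = adMatrix ρ₀ β`. The choice `X = -B c` changes the deviation to first order by `-D B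
  -- c`, and the projection `D B` fixes `c`, so the error `c` cancels.
  let X : Matrix n n R := Matrix.of fun i j => -((B.map a).mulVec c (i, j))
  have hX : ∀ i j, X i j ∈ K := fun i j => neg_mem (mulVec_map_mem B K h _)
  have hg : ∀ i j, (1 + X - 1) i j ∈ K := by simpa using hX
  obtain ⟨ρ', hρ'⟩ := ρ.exists_conj (g := 1 + X)
    ((mapMatrix_aug_eq_one_iff _).2 fun i j => hK (hg i j))
  refine ⟨ρ', 1 + X, hg, hρ', fun t => ?_⟩
  have hXv : (fun q : n × n => X q.1 q.2) = -((B.map a).mulVec c) := rfl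
  let e : Fin r × n × n → R := fun t => (X * (ρ.rep (β t.1) - (ρ₀ (β t.1)).map a) -
    (ρ'.rep (β t.1) - (ρ₀ (β t.1)).map a) * X) t.2.1 t.2.2
  have he : ∀ t, e t ∈ maximalIdeal R * K := fun t =>
    sub_mem (ρ.mul_sub_mem _ hX _ _) (ρ'.sub_mul_mem _ hX _ _)
  have hdev : ρ'.deviation β = ρ.deviation β + (D.map a).mulVec (-((B.map a).mulVec c)) + e := by
    funext t
    have h₁ := congrFun (congrFun (sub_eq_of_conj (hρ' (β t.1))) t.2.1) t.2.2
    rw [Matrix.add_apply, ← adMatrix_mulVec, hXv] at h₁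
    simp only [Pi.add_apply, deviation]
    rw [Matrix.sub_apply, sub_eq_iff_eq_add] at h₁
    rw [h₁]
    simp only [e]
    ring
  have hmap : ∀ v, (D.map a).mulVec ((B.map a).mulVec v) = ((D * B).map a).mulVec v := fun v => by
    rw [Matrix.mulVec_mulVec, Matrix.map_mul]
  have hidem : ((D * B).map a).mulVec c = c := by
    rw [hc, Matrix.mulVec_mulVec, ← Matrix.map_mul, ← Matrix.mul_assoc, hB]
  rw [hdev, Matrix.mulVec_add, Matrix.mulVec_add, Matrix.mulVec_neg, hmap, hidem, Matrix.mulVec_neg,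
    hidem, ← hc, add_neg_cancel, zero_add]
  exact mulVec_map_mem _ _ he t

/-- Iteration of the approximation step stops because `𝔪` is nilpotent. The bound on `g - 1` is the
essential output: with `K` the kernel of a surjection, the conjugation does not disturb the image.
-/
theorem exists_conj_deviation_eq_zero [IsArtinianRing R] (B : Matrix (n × n) (Fin r × n × n) k)
    (hB : adMatrix ρ₀ β * B * adMatrix ρ₀ β = adMatrix ρ₀ β) (K : Ideal R)
    (hK : K ≤ maximalIdeal R) (ρ : FramedRep ρ₀ R)
    (h : ∀ t, ((adMatrix ρ₀ β * B).map (algebraMap k R)).mulVec (ρ.deviation β) t ∈ K) :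
    ∃ (ρ' : FramedRep ρ₀ R) (g : Matrix n n R), (∀ i j, (g - 1) i j ∈ K) ∧
      (∀ x, g * ρ.rep x = ρ'.rep x * g) ∧
      ((adMatrix ρ₀ β * B).map (algebraMap k R)).mulVec (ρ'.deviation β) = 0 := by
  obtain ⟨N, hN⟩ := R.exists_maximalIdeal_pow_eq_bot
  have key : ∀ N : ℕ, ∃ (ρ' : FramedRep ρ₀ R) (g : Matrix n n R), (∀ i j, (g - 1) i j ∈ K) ∧
      (∀ x, g * ρ.rep x = ρ'.rep x * g) ∧
      ∀ t, ((adMatrix ρ₀ β * B).map (algebraMap k R)).mulVec (ρ'.deviation β) t ∈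
        maximalIdeal R ^ N * K := by
    intro N
    induction N with
    | zero => exact ⟨ρ, 1, by simp, by simp, by simpa using h⟩
    | succ N ih =>
      obtain ⟨ρ₁, g₁, hg₁, hρ₁, h₁⟩ := ih
      obtain ⟨ρ₂, g₂, hg₂, hρ₂, h₂⟩ := ρ₁.exists_conj_deviation_mem B hB
        (maximalIdeal R ^ N * K) (Ideal.mul_le_right.trans hK) h₁
      refine ⟨ρ₂, g₂ * g₁, fun i j => ?_, fun x => ?_, fun t => ?_⟩
      · have : g₂ * g₁ - 1 = (g₂ - 1) * g₁ + (g₁ - 1) := by noncomm_ring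
        rw [this]
        exact add_mem (Ideal.sum_mem _ fun l _ => Ideal.mul_mem_right _ _
          (Ideal.mul_le_right (hg₂ i l))) (hg₁ i j)
      · rw [mul_assoc, hρ₁, ← mul_assoc, hρ₂, mul_assoc]
      · rw [pow_succ', mul_assoc]
        exact h₂ t
  obtain ⟨ρ', g, hg, hρ', h'⟩ := key N
  refine ⟨ρ', g, hg, hρ', funext fun t => ?_⟩
  have := h' t
  rwa [hN, Ideal.bot_mul] at this

end FramedRep

end Slice

/-! ### Construction of the hull -/

section Hull

variable {k : Type u} [Field k] {H : Type u} [NonUnitalRing H] [Module k H]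
  {n : Type} [Fintype n] [DecidableEq n] {ρ₀ : H →ₙₐ[k] Matrix n n k} {r : ℕ} {β : Fin r → H}
  {κ : H →ₗ[k] Fin r → k}

variable (ρ₀ κ) in
/-- The linear map `x ↦ ρ₀(x) + ∑ κ_s(x) X_s` to matrices of power series in the entries of the
generic matrices `X_s`. -/
noncomputable def genericMap : H →ₗ[k] Matrix n n (powerSeries k (Fin r × n × n)) where
  toFun x := Matrix.of fun i j => algebraMap k _ (ρ₀ x i j) +
    ∑ s, κ x s • polyMap (k := k) (MvPolynomial.X (s, i, j))
  map_add' x y := by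
    ext i j
    simp only [map_add, Matrix.of_apply, Matrix.add_apply, Pi.add_apply, add_smul,
      Finset.sum_add_distrib]
    abel
  map_smul' c x := by
    ext i j
    simp only [map_smul, Matrix.of_apply, Matrix.smul_apply, Pi.smul_apply, smul_add,
      Finset.smul_sum, smul_assoc, RingHom.id_apply]
    rw [smul_eq_mul, map_mul, Algebra.smul_def c (algebraMap k _ _)]

omit [DecidableEq n] in
theorem genericMap_apply (x : H) (i j : n) : genericMap ρ₀ κ x i j = algebraMap k _ (ρ₀ x i j) +
    ∑ s, κ x s • polyMap (k := k) (MvPolynomial.X (s, i, j)) := rfl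

theorem aug_genericMap (x : H) : (aug _).mapMatrix (genericMap ρ₀ κ x) = ρ₀ x := by
  ext i j
  rw [AlgHom.mapMatrix_apply, Matrix.map_apply, genericMap_apply, map_add, aug_algebraMap, map_sum,
    Finset.sum_eq_zero, add_zero]
  intro s _
  rw [map_smul, (aug_eq_zero_iff _ _).2 (polyMap_X_mem _), smul_zero]

variable (ρ₀ β κ) in
/-- The ideal of relations which make `genericMap` multiplicative and consistent with the values at
the `β_s`, and impose the linear condition `A X = 0`. -/
noncomputable def relationIdeal (A : Matrix (Fin r × n × n) (Fin r × n × n) k) :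
    Ideal (powerSeries k (Fin r × n × n)) :=
  Ideal.span
    ({f | ∃ x y i j, f = (genericMap ρ₀ κ x * genericMap ρ₀ κ y - genericMap ρ₀ κ (x * y)) i j} ∪
    {f | ∃ t, f = genericMap ρ₀ κ (β t.1) t.2.1 t.2.2 - algebraMap k _ (ρ₀ (β t.1) t.2.1 t.2.2) -
      polyMap (MvPolynomial.X t)} ∪
    {f | ∃ t, f = (A.map (algebraMap k _)).mulVec (fun t => polyMap (MvPolynomial.X t)) t})

theorem relationIdeal_le (A : Matrix (Fin r × n × n) (Fin r × n × n) k) :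
    relationIdeal ρ₀ β κ A ≤ maximalIdeal _ := by
  refine Ideal.span_le.2 ?_
  rintro f ((⟨x, y, i, j, rfl⟩ | ⟨t, rfl⟩) | ⟨t, rfl⟩)
  · refine (aug_eq_zero_iff _ _).1 ?_
    have : (aug _).mapMatrix (genericMap ρ₀ κ x * genericMap ρ₀ κ y - genericMap ρ₀ κ (x * y)) =
        0 := by
      rw [map_sub, map_mul, aug_genericMap, aug_genericMap, aug_genericMap, map_mul, sub_self]
    exact congrFun (congrFun this i) j
  · refine (aug_eq_zero_iff _ _).1 ?_
    rw [map_sub, map_sub, aug_algebraMap, (aug_eq_zero_iff _ _).2 (polyMap_X_mem _), sub_zero,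
      sub_eq_zero]
    exact congrFun (congrFun (aug_genericMap (β t.1)) t.2.1) t.2.2
  · exact mulVec_map_mem A _ (fun _ => polyMap_X_mem _) t

/-- There is a universal framed deformation (for Artinian rings) subject to a linear condition on its
deviation from `ρ₀`. -/
theorem exists_universal_framedRep
    (hβ : ∀ (R : CHat k) (ρ : FramedRep ρ₀ R) (x : H), ρ.rep x = ∑ s, κ x s • ρ.rep (β s))
    (A : Matrix (Fin r × n × n) (Fin r × n × n) k) :
    ∃ (R : CHat k) (ρu : FramedRep ρ₀ R),
      (A.map (algebraMap k R)).mulVec (ρu.deviation β) = 0 ∧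
      (∀ (B : CHat k) [IsArtinianRing B] (ρ : FramedRep ρ₀ B),
        (A.map (algebraMap k B)).mulVec (ρ.deviation β) = 0 → ∃ v : R ⟶ B, ρu.map v = ρ) ∧
      ∀ (B : CHat k) [IsArtinianRing B] (v v' : R ⟶ B), ρu.map v = ρu.map v' → v = v' := by
  let J := relationIdeal ρ₀ β κ A
  have hJ : J ≤ maximalIdeal _ := relationIdeal_le A
  let q := (powerSeries k (Fin r × n × n)).quotientMk J hJ
  have hmul : ∀ x y, q.toAlgHom.mapMatrix (genericMap ρ₀ κ (x * y)) =
      q.toAlgHom.mapMatrix (genericMap ρ₀ κ x) * q.toAlgHom.mapMatrix (genericMap ρ₀ κ y) := by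
    intro x y
    rw [← map_mul, eq_comm, ← sub_eq_zero, ← map_sub]
    ext i j
    exact quotientMk_eq_zero (Ideal.subset_span (Or.inl (Or.inl ⟨x, y, i, j, rfl⟩)))
  let ρu : FramedRep ρ₀ ((powerSeries k (Fin r × n × n)).quotient J hJ) :=
    { rep :=
        { toFun := fun x => q.toAlgHom.mapMatrix (genericMap ρ₀ κ x)
          map_smul' := fun c x => by simp
          map_zero' := by simp
          map_add' := fun x y => by rw [map_add, map_add]
          map_mul' := hmul }
      aug_rep := fun x => (mapMatrix_aug_comp q _).trans (aug_genericMap x) }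
  -- This is where the second family of relations enters: `κ (β s)` is not assumed to be the `s`-th
  -- unit vector.
  have hdev : ∀ t, ρu.deviation β t = q.toAlgHom (polyMap (MvPolynomial.X t)) := by
    intro t
    rw [← sub_eq_zero]
    change q.toAlgHom (genericMap ρ₀ κ (β t.1) t.2.1 t.2.2) -
      algebraMap k _ (ρ₀ (β t.1) t.2.1 t.2.2) - _ = 0
    rw [← AlgHom.commutes q.toAlgHom, ← map_sub, ← map_sub]
    exact quotientMk_eq_zero (Ideal.subset_span (Or.inl (Or.inr ⟨t, rfl⟩)))
  refine ⟨_, ρu, ?_, ?_, ?_⟩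
  · funext t
    have h : q.toAlgHom ((A.map (algebraMap k _)).mulVec
        (fun t => polyMap (MvPolynomial.X t)) t) = 0 :=
      quotientMk_eq_zero (Ideal.subset_span (Or.inr ⟨t, rfl⟩))
    simp only [Matrix.mulVec, dotProduct, map_sum, map_mul, Matrix.map_apply, AlgHom.commutes,
      hdev] at h ⊢
    exact h
  · intro B _ ρ hρ
    obtain ⟨f, hf⟩ := exists_powerSeries_hom (k := k) (ρ.deviation β) ρ.deviation_mem
    -- The variables are specialised to the deviations. As `hβ` expresses both `ρ` and its reduction
    -- `ρ₀` through the values at the `β s`, the generic map specialises to `ρ`.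
    have hfG : ∀ x, f.toAlgHom.mapMatrix (genericMap ρ₀ κ x) = ρ.rep x := by
      intro x
      have h₀ : ρ₀ x = ∑ s, κ x s • ρ₀ (β s) := by
        simpa [ρ.aug_rep] using congrArg (aug B).mapMatrix (hβ B ρ x)
      ext i j
      rw [AlgHom.mapMatrix_apply, Matrix.map_apply, genericMap_apply, map_add, AlgHom.commutes,
        map_sum, hβ B ρ x, h₀]
      simp only [map_smul, hf, Matrix.sum_apply, Matrix.smul_apply, FramedRep.deviation, map_sum,
        smul_sub, Finset.sum_sub_distrib, smul_eq_mul, map_mul, ← Algebra.smul_def]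
      abel
    have hfJ : ∀ g ∈ J, f.toAlgHom g = 0 := by
      change J ≤ RingHom.ker f.toAlgHom
      refine Ideal.span_le.2 ?_
      rintro g ((⟨x, y, i, j, rfl⟩ | ⟨t, rfl⟩) | ⟨t, rfl⟩)
      · have : f.toAlgHom.mapMatrix
            (genericMap ρ₀ κ x * genericMap ρ₀ κ y - genericMap ρ₀ κ (x * y)) = 0 := by
          rw [map_sub, map_mul, hfG, hfG, hfG, map_mul, sub_self]
        exact congrFun (congrFun this i) j
      · have h₁ : f.toAlgHom (genericMap ρ₀ κ (β t.1) t.2.1 t.2.2) = _ :=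
          congrFun (congrFun (hfG (β t.1)) t.2.1) t.2.2
        change f.toAlgHom _ = 0
        rw [map_sub, map_sub, hf, AlgHom.commutes, h₁]
        exact sub_self _
      · change f.toAlgHom _ = 0
        have := congrFun hρ t
        simp only [Matrix.mulVec, dotProduct, map_sum, map_mul, Matrix.map_apply,
          AlgHom.commutes, hf] at this ⊢
        exact this
    obtain ⟨g, hg⟩ := exists_quotient_hom (J := J) (hJ := hJ) f hfJ
    refine ⟨g, FramedRep.ext_apply fun x => ?_⟩
    rw [← hfG x, ← hg]
    rfl
  · intro B _ v v' h
    refine quotient_hom_ext (powerSeries_hom_ext fun t => ?_)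
    change v.toAlgHom (q.toAlgHom _) = v'.toAlgHom (q.toAlgHom _)
    rw [← hdev, ← FramedRep.deviation_map, h, FramedRep.deviation_map]

theorem FramedRep.equiv_of_conj {R : CHat k} {ρ ρ' : FramedRep ρ₀ R} {g : Matrix n n R}
    (hg : ∀ i j, (g - 1) i j ∈ maximalIdeal R) (h : ∀ x, g * ρ.rep x = ρ'.rep x * g) :
    ρ.Equiv ρ' := ⟨g, (mapMatrix_aug_eq_one_iff g).2 hg, h⟩

theorem CHat.mul_eq_zero_dual {a b : CHat.dual k} (ha : a ∈ maximalIdeal (CHat.dual k))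
    (hb : b ∈ maximalIdeal (CHat.dual k)) : a * b = 0 := by
  have h : ∀ c : TrivSqZeroExt k k, ¬ IsUnit c → c.fst = 0 := fun c hc => by
    rw [TrivSqZeroExt.isUnit_iff_isUnit_fst] at hc
    simpa using hc
  have ha' := h a ha
  have hb' := h b hb
  refine TrivSqZeroExt.ext ?_ ?_
  · change TrivSqZeroExt.fst a * TrivSqZeroExt.fst b = 0
    rw [ha', zero_mul]
  · change TrivSqZeroExt.fst a • TrivSqZeroExt.snd b +
      MulOpposite.op (TrivSqZeroExt.fst b) • TrivSqZeroExt.snd a = 0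
    rw [ha', hb']
    simp

instance isArtinianRing_sqZero (W : Type u) [AddCommGroup W] [Module k W] [Module kᵐᵒᵖ W]
    [IsCentralScalar k W] [Module.Finite k W] : IsArtinianRing (CHat.sqZero k W) :=
  IsArtinianRing.of_finite k (TrivSqZeroExt k W)

/-- The universal framed deformation in the slice is a hull: moving into the slice gives smoothness
and tangent surjectivity, while transversality of the slice to the conjugation directions gives
tangent injectivity. -/
theorem FramedPresentation.exists_isHull {F : CHat k ⥤ Type w} (P : FramedPresentation ρ₀ F)
    (hfd : FinitelyDetermined ρ₀) : ∃ (R : CHat k) (ξ : F.obj R), IsHull F R ξ := by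
  obtain ⟨r, β, κ, hβ⟩ := hfd
  obtain ⟨B, hB⟩ := Matrix.exists_mul_mul_eq_self (adMatrix ρ₀ β)
  obtain ⟨R, ρu, hslice, hex, huniq⟩ := exists_universal_framedRep hβ (adMatrix ρ₀ β * B)
  have hslice' : ∀ {S : CHat k} (u : R ⟶ S),
      ((adMatrix ρ₀ β * B).map (algebraMap k S)).mulVec ((ρu.map u).deviation β) = 0 := by
    intro S u
    funext t
    have := congrArg u.toAlgHom (congrFun hslice t)
    simpa only [Matrix.mulVec, dotProduct, map_sum, map_mul, Matrix.map_apply, AlgHom.commutes,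
      ← FramedRep.deviation_map, Pi.zero_apply, map_zero] using this
  refine ⟨R, P.cls ρu, ?_, ?_, ?_⟩
  · intro S A _ _ p hp u b hb
    rw [P.map_cls] at hb
    obtain ⟨ρ, rfl, hρ⟩ := P.exists_lift p hp b _ hb
    -- The image of `ρ` over `A` lies in the slice, so the slice defect of `ρ` has entries in the
    -- kernel of `p`. The correcting matrix is then `1` modulo this kernel, and the image over `A`
    -- stays the same.
    let K : Ideal S := RingHom.ker p.toAlgHom
    have hK : K ≤ maximalIdeal S := fun s hs =>
      mem_maximalIdeal_of_map p (by rw [RingHom.mem_ker.1 hs]; exact Ideal.zero_mem _)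
    obtain ⟨ρ', g, hg, hgρ, hρ'⟩ := ρ.exists_conj_deviation_eq_zero B hB K hK fun t => by
      rw [RingHom.mem_ker]
      have := congrFun (hslice' u) t
      rw [← hρ] at this
      simp only [Matrix.mulVec, dotProduct, map_sum, map_mul, Matrix.map_apply, AlgHom.commutes,
        FramedRep.deviation_map] at this ⊢
      exact this
    obtain ⟨v, hv⟩ := hex S ρ' hρ'
    refine ⟨v, huniq A _ _ ?_, ?_⟩
    · rw [FramedRep.map_comp, hv, ← hρ]
      refine FramedRep.ext_apply fun x => ?_
      have hg1 : p.toAlgHom.mapMatrix g = 1 := by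
        rw [← sub_eq_zero, ← map_one (p.toAlgHom.mapMatrix : Matrix n n S →ₐ[k] _), ← map_sub]
        ext i j
        exact hg i j
      have := congrArg p.toAlgHom.mapMatrix (hgρ x)
      rw [map_mul, map_mul, hg1, one_mul, mul_one] at this
      exact this.symm
    · rw [P.map_cls, hv, eq_comm, P.cls_eq_iff]
      exact FramedRep.equiv_of_conj (fun i j => hK (hg i j)) hgρ
  · intro v v' h
    change F.map v _ = F.map v' _ at h
    rw [P.map_cls, P.map_cls, P.cls_eq_iff] at h
    obtain ⟨g, hg, hgρ⟩ := h
    rw [mapMatrix_aug_eq_one_iff] at hg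
    refine huniq _ _ _ (FramedRep.ext_apply fun x => ?_)
    obtain ⟨X, rfl⟩ : ∃ X, g = 1 + X := ⟨g - 1, by abel⟩
    simp only [add_sub_cancel_left] at hg
    have hX : ∀ x, (ρu.map v').rep x - (ρu.map v).rep x =
        X * (ρ₀ x).map (algebraMap k _) - (ρ₀ x).map (algebraMap k _) * X := by
      intro x
      rw [FramedRep.sub_eq_of_conj (hgρ x), add_eq_left, sub_eq_zero]
      trans 0
      · ext i j
        exact Finset.sum_eq_zero fun l _ => mul_eq_zero_dual (hg _ _)
          ((ρu.map v).rep_sub_mem _ _ _)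
      · ext i j
        exact (Finset.sum_eq_zero fun l _ => mul_eq_zero_dual ((ρu.map v').rep_sub_mem _ _ _)
          (hg _ _)).symm
    have hdev : (ρu.map v').deviation β = (ρu.map v).deviation β +
        ((adMatrix ρ₀ β).map (algebraMap k _)).mulVec (fun q => X q.1 q.2) := by
      funext t
      have := congrFun (congrFun (hX (β t.1)) t.2.1) t.2.2
      rw [← adMatrix_mulVec, Matrix.sub_apply, sub_eq_iff_eq_add] at this
      simp only [FramedRep.deviation, Pi.add_apply]
      rw [this]
      ring
    -- Both deviations lie in the slice and differ by a vector in the image of `adMatrix`, which the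
    -- projection fixes; so the difference is zero.
    have h₀ := hslice' v'
    rw [hdev, Matrix.mulVec_add, hslice' v, zero_add, Matrix.mulVec_mulVec, ← Matrix.map_mul,
      hB] at h₀
    rw [h₀, add_zero] at hdev
    rw [hβ, hβ _ (ρu.map v')]
    refine Finset.sum_congr rfl fun s _ => ?_
    congr 1
    ext i j
    have := congrFun hdev (s, i, j)
    simp only [FramedRep.deviation, sub_left_inj] at this
    exact this.symm
  · intro a
    obtain ⟨ρ, rfl⟩ := P.cls_surjective _ a
    -- Here `K` is the whole maximal ideal, where every deviation lies.
    obtain ⟨ρ', g, hg, hgρ, hρ'⟩ := ρ.exists_conj_deviation_eq_zero B hB _ le_rfl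
      fun t => mulVec_map_mem _ _ (fun j => ρ.deviation_mem j) t
    obtain ⟨v, hv⟩ := hex _ ρ' hρ'
    refine ⟨v, ?_⟩
    change F.map v _ = _
    rw [P.map_cls, hv, eq_comm, P.cls_eq_iff]
    exact FramedRep.equiv_of_conj hg hgρ

end Hull

/-! ### Matrices over square-zero extensions -/

section SqZeroMatrix

variable {k : Type u} [Field k] {n : Type} {W : Type u} [AddCommGroup W]

/-- The matrix `A + D` over `k ⊕ W`. -/
def sqZeroMatrix (A : Matrix n n k) (D : Matrix n n W) : Matrix n n (TrivSqZeroExt k W) :=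
  Matrix.of fun i j => TrivSqZeroExt.inl (A i j) + TrivSqZeroExt.inr (D i j)

/-- The product of a scalar matrix and a matrix with entries in a vector space. -/
def matrixLeftMul [Fintype n] [Module k W] (A : Matrix n n k) (D : Matrix n n W) : Matrix n n W :=
  Matrix.of fun i j => ∑ l, A i l • D l j

/-- The product of a matrix with entries in a vector space and a scalar matrix. -/
def matrixRightMul [Fintype n] [Module k W] (D : Matrix n n W) (A : Matrix n n k) : Matrix n n W :=
  Matrix.of fun i j => ∑ l, A l j • D i l

theorem matrixLeftMul_eq_mul [Fintype n] (A D : Matrix n n k) : matrixLeftMul A D = A * D := rfl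

theorem matrixRightMul_eq_mul [Fintype n] (D A : Matrix n n k) : matrixRightMul D A = D * A := by
  ext i j
  simp [matrixRightMul, Matrix.mul_apply, mul_comm]

theorem matrixLeftMul_map [Fintype n] [Module k W] {W' : Type u} [AddCommGroup W'] [Module k W'] (f : W →ₗ[k] W')
    (A : Matrix n n k) (D : Matrix n n W) :
    matrixLeftMul A (D.map f) = (matrixLeftMul A D).map f := by
  ext i j
  simp [matrixLeftMul]

theorem matrixRightMul_map [Fintype n] [Module k W] {W' : Type u} [AddCommGroup W'] [Module k W'] (f : W →ₗ[k] W')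
    (D : Matrix n n W) (A : Matrix n n k) :
    matrixRightMul (D.map f) A = (matrixRightMul D A).map f := by
  ext i j
  simp [matrixRightMul]

theorem sqZeroMatrix_mul [Fintype n] [Module k W] [Module kᵐᵒᵖ W] [IsCentralScalar k W]
    (A A' : Matrix n n k) (D D' : Matrix n n W) :
    sqZeroMatrix A D * sqZeroMatrix A' D' =
      sqZeroMatrix (A * A') (matrixLeftMul A D' + matrixRightMul D A') := by
  ext i j
  · simp [sqZeroMatrix, Matrix.mul_apply, TrivSqZeroExt.fst_sum]
  · simp [sqZeroMatrix, Matrix.mul_apply, TrivSqZeroExt.snd_sum, matrixLeftMul, matrixRightMul,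
      Finset.sum_add_distrib]

theorem sqZeroMatrix_inj {A A' : Matrix n n k} {D D' : Matrix n n W} :
    sqZeroMatrix A D = sqZeroMatrix A' D' ↔ A = A' ∧ D = D' := by
  constructor
  · intro h
    constructor
    · ext i j
      simpa [sqZeroMatrix] using congrArg TrivSqZeroExt.fst (congrFun (congrFun h i) j)
    · ext i j
      simpa [sqZeroMatrix] using congrArg TrivSqZeroExt.snd (congrFun (congrFun h i) j)
  · rintro ⟨rfl, rfl⟩
    rfl

theorem eq_sqZeroMatrix (M : Matrix n n (TrivSqZeroExt k W)) :
    M = sqZeroMatrix (M.map TrivSqZeroExt.fst) (M.map TrivSqZeroExt.snd) := by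
  ext i j <;> simp [sqZeroMatrix]

theorem sqZeroMatrix_add (A A' : Matrix n n k) (D D' : Matrix n n W) :
    sqZeroMatrix (A + A') (D + D') = sqZeroMatrix A D + sqZeroMatrix A' D' := by
  ext i j <;> simp [sqZeroMatrix]

theorem sqZeroMatrix_smul [Module k W] (c : k) (A : Matrix n n k) (D : Matrix n n W) :
    sqZeroMatrix (c • A) (c • D) = c • sqZeroMatrix A D := by
  ext i j <;> simp [sqZeroMatrix]

theorem CHat.aug_sqZero [Module k W] [Module kᵐᵒᵖ W] [IsCentralScalar k W] [Module.Finite k W]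
    (s : TrivSqZeroExt k W) :
    aug (CHat.sqZero k W) s = s.fst := by
  have h : s - TrivSqZeroExt.inl s.fst ∈ nonunits (TrivSqZeroExt k W) := by
    rw [mem_nonunits_iff, TrivSqZeroExt.isUnit_iff_isUnit_fst]
    simp
  have h' : aug (CHat.sqZero k W) (s - TrivSqZeroExt.inl s.fst : TrivSqZeroExt k W) = 0 :=
    (aug_eq_zero_iff _ _).2 h
  have h'' : aug (CHat.sqZero k W) s -
      aug (CHat.sqZero k W) (TrivSqZeroExt.inl s.fst : TrivSqZeroExt k W) = 0 :=
    (map_sub (aug (CHat.sqZero k W)) _ _).symm.trans h'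
  rw [sub_eq_zero] at h''
  exact h''.trans (aug_algebraMap (CHat.sqZero k W) s.fst)

theorem mapMatrix_aug_sqZeroMatrix [Fintype n] [DecidableEq n] [Module k W] [Module kᵐᵒᵖ W]
    [IsCentralScalar k W] [Module.Finite k W] (A : Matrix n n k)
    (D : Matrix n n W) :
    (aug (CHat.sqZero k W)).mapMatrix (sqZeroMatrix A D) = A := by
  ext i j
  refine (CHat.aug_sqZero _).trans ?_
  simp [sqZeroMatrix]

end SqZeroMatrix

/-! ### Lifting of automorphisms and representability -/

section Represents

variable {k : Type u} [Field k] {H : Type u} [NonUnitalRing H] [Module k H]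
  {n : Type} [Fintype n] [DecidableEq n] {ρ₀ : H →ₙₐ[k] Matrix n n k}

variable (ρ₀) in
/-- The endomorphisms of `ρ₀` lift to endomorphisms of each framed deformation. -/
def CentralizerLifts : Prop :=
  ∀ (R : CHat k) (ρ : FramedRep ρ₀ R) (f : Matrix n n k), (∀ x, f * ρ₀ x = ρ₀ x * f) →
    ∃ f' : Matrix n n R, (aug R).mapMatrix f' = f ∧ ∀ x, f' * ρ.rep x = ρ.rep x * f'

/-- The `t s` lift a basis of the span of the `y a` modulo `W`. Used with `E'` and `W` successive
powers of a maximal ideal, it splits a matrix of leading terms into scalar matrices with independent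
coefficients. -/
theorem exists_finite_independent_mod {E ι : Type*} [AddCommGroup E] [Module k E] [Finite ι]
    (W E' : Submodule k E) (y : ι → E) (hy : ∀ a, y a ∈ E') :
    ∃ (q : ℕ) (t : Fin q → E) (c : Fin q → ι → k), (∀ s, t s ∈ E') ∧
      (∀ a, y a - ∑ s, c s a • t s ∈ W) ∧ ∀ d : Fin q → k, ∑ s, d s • t s ∈ W → d = 0 := by
  let U := Submodule.span k (Set.range fun a => W.mkQ (y a))
  have : Module.Finite k U := Module.Finite.span_of_finite k (Set.finite_range _)
  let b := Module.finBasis k U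
  have hU : U ≤ E'.map W.mkQ := Submodule.span_le.2 (by
    rintro _ ⟨a, rfl⟩
    exact Submodule.mem_map_of_mem (hy a))
  choose t ht ht' using fun s => hU (b s).2
  refine ⟨_, t, fun s a => b.repr ⟨_, Submodule.subset_span ⟨a, rfl⟩⟩ s, ht, fun a => ?_,
    fun d hd => ?_⟩
  · have h := congrArg Subtype.val (b.sum_repr ⟨W.mkQ (y a), Submodule.subset_span ⟨a, rfl⟩⟩)
    rw [← Submodule.Quotient.mk_eq_zero, ← Submodule.mkQ_apply, map_sub, map_sum, sub_eq_zero]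
    simp only [map_smul, ht']
    simpa only [Submodule.coe_sum, Submodule.coe_smul] using h.symm
  · rw [← Submodule.Quotient.mk_eq_zero, ← Submodule.mkQ_apply, map_sum] at hd
    simp only [map_smul, ht'] at hd
    have h : ∑ s, d s • b s = 0 := Subtype.ext (by simpa using hd)
    exact funext (Fintype.linearIndependent_iff.1 b.linearIndependent d h)

/-- Approximation along the powers of `𝔪_A`, starting from `h = 0` at `𝔪_A ^ 0`. The leading term of
the remaining error is a combination of matrices over `k` centralizing `ρ₀`; each of them lifts to
an endomorphism over `B`, and adding these lifts improves the approximation by one order. -/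
theorem CentralizerLifts.exists_lift (hc : CentralizerLifts ρ₀) {B A : CHat k} [IsArtinianRing A]
    (p : B ⟶ A) (hp : Function.Surjective p.toAlgHom) (ρ : FramedRep ρ₀ B) (g : Matrix n n A)
    (hg : ∀ x, g * (ρ.map p).rep x = (ρ.map p).rep x * g) :
    ∃ h : Matrix n n B, p.toAlgHom.mapMatrix h = g ∧ ∀ x, h * ρ.rep x = ρ.rep x * h := by
  suffices key : ∀ N : ℕ, ∃ h : Matrix n n B, (∀ x, h * ρ.rep x = ρ.rep x * h) ∧
      ∀ i j, (g - p.toAlgHom.mapMatrix h) i j ∈ maximalIdeal A ^ N by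
    obtain ⟨N, hN⟩ := A.exists_maximalIdeal_pow_eq_bot
    obtain ⟨h, hh, hgh⟩ := key N
    refine ⟨h, ?_, hh⟩
    rw [eq_comm, ← sub_eq_zero]
    ext i j
    have := hgh i j
    rwa [hN] at this
  intro N
  induction N with
  | zero => exact ⟨0, by simp, by simp⟩
  | succ N ih =>
    obtain ⟨h, hh, hgh⟩ := ih
    obtain ⟨Y, hYdef⟩ : ∃ Y, Y = g - p.toAlgHom.mapMatrix h := ⟨_, rfl⟩
    rw [← hYdef] at hgh
    have hY : ∀ x, Y * (ρ.map p).rep x = (ρ.map p).rep x * Y := fun x => by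
      rw [hYdef, sub_mul, mul_sub, hg, FramedRep.map_rep, ← map_mul, hh, map_mul]
    let a : k →+* A := algebraMap k A
    -- Modulo `𝔪 ^ (N + 1)` the error is `Y = ∑ t_s C_s`, with each `C_s` a matrix over `k` and the
    -- `t_s ∈ 𝔪 ^ N` independent modulo `𝔪 ^ (N + 1)`.
    obtain ⟨q, t, c, ht, hyc, hind⟩ := exists_finite_independent_mod
      ((maximalIdeal A ^ (N + 1)).restrictScalars k) ((maximalIdeal A ^ N).restrictScalars k)
      (fun ij : n × n => Y ij.1 ij.2) fun ij => hgh _ _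
    let C : Fin q → Matrix n n k := fun s => Matrix.of fun i j => c s (i, j)
    have hW : ∀ i j, (Y - ∑ s, t s • (C s).map a) i j ∈ maximalIdeal A ^ (N + 1) := fun i j => by
      have := hyc (i, j)
      simp only [Submodule.restrictScalars_mem, Algebra.smul_def] at this
      simpa [Matrix.sum_apply, C, a, mul_comm] using this
    -- `Y` commutes with the deformed representation, hence with `ρ₀` modulo `𝔪 * 𝔪 ^ N`.
    -- Independence of the `t_s` then separates the commutators of the individual `C_s`.
    have hC : ∀ x s, C s * ρ₀ x = ρ₀ x * C s := by
      intro x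
      have h₁ : ∀ i j, (Y * (ρ₀ x).map a - (ρ₀ x).map a * Y) i j ∈ maximalIdeal A ^ (N + 1) := by
        intro i j
        have h₂ : Y * (ρ₀ x).map a - (ρ₀ x).map a * Y =
            ((ρ.map p).rep x - (ρ₀ x).map a) * Y - Y * ((ρ.map p).rep x - (ρ₀ x).map a) := by
          rw [sub_mul ((ρ.map p).rep x), mul_sub Y, ← hY]
          abel
        rw [h₂, pow_succ']
        exact sub_mem (FramedRep.sub_mul_mem _ _ hgh _ _) (FramedRep.mul_sub_mem _ _ hgh _ _)
      have h₃ : ∀ i j, ((Y - ∑ s, t s • (C s).map a) * (ρ₀ x).map a -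
          (ρ₀ x).map a * (Y - ∑ s, t s • (C s).map a)) i j ∈ maximalIdeal A ^ (N + 1) :=
        fun i j => sub_mem (Ideal.sum_mem _ fun l _ => Ideal.mul_mem_right _ _ (hW _ _))
          (Ideal.sum_mem _ fun l _ => Ideal.mul_mem_left _ _ (hW _ _))
      have h₄ : Y * (ρ₀ x).map a - (ρ₀ x).map a * Y -
          ((Y - ∑ s, t s • (C s).map a) * (ρ₀ x).map a -
          (ρ₀ x).map a * (Y - ∑ s, t s • (C s).map a)) =
          ∑ s, t s • (C s * ρ₀ x - ρ₀ x * C s).map a := by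
        simp only [sub_mul, mul_sub, Finset.sum_mul, Finset.mul_sum, Matrix.map_sub a (map_sub a),
          Matrix.map_mul, smul_sub, Finset.sum_sub_distrib, smul_mul_assoc, mul_smul_comm]
        abel
      have h₅ : ∀ i j, (fun s => (C s * ρ₀ x - ρ₀ x * C s) i j) = 0 := fun i j => by
        refine hind _ ?_
        have h₆ := sub_mem (h₁ i j) (h₃ i j)
        rw [← Matrix.sub_apply, h₄] at h₆
        simp only [Submodule.restrictScalars_mem, Algebra.smul_def]
        simpa [Matrix.sum_apply, a, mul_comm] using h₆
      intro s
      rw [← sub_eq_zero]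
      ext i j
      exact congrFun (h₅ i j) s
    choose F hF hF' using fun s => hc B ρ (C s) (hC · s)
    choose τ hτ using fun s => hp (t s)
    refine ⟨h + ∑ s, τ s • F s, fun x => ?_, fun i j => ?_⟩
    · rw [add_mul, mul_add, hh, Finset.sum_mul, Finset.mul_sum]
      congr 1
      exact Finset.sum_congr rfl fun s _ => by rw [smul_mul_assoc, mul_smul_comm, hF']
    · have h₁ : g - p.toAlgHom.mapMatrix (h + ∑ s, τ s • F s) = (Y - ∑ s, t s • (C s).map a) +
          ∑ s, t s • ((C s).map a - p.toAlgHom.mapMatrix (F s)) := by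
        have h₂ : ∀ s, p.toAlgHom.mapMatrix (τ s • F s) = t s • p.toAlgHom.mapMatrix (F s) :=
          fun s => by
            ext i j
            simp [← hτ s]
        simp only [map_add, map_sum, h₂, smul_sub, Finset.sum_sub_distrib, hYdef]
        abel
      rw [h₁, Matrix.add_apply, Matrix.sum_apply]
      refine add_mem (hW i j) (Ideal.sum_mem _ fun s _ => ?_)
      rw [pow_succ]
      refine Ideal.mul_mem_mul (ht s) ?_
      rw [← aug_eq_zero_iff, Matrix.sub_apply, map_sub, Matrix.map_apply, aug_algebraMap, sub_eq_zero,
        ← hF s, ← mapMatrix_aug_comp p (F s)]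
      rfl

/-- After correction by a lifted automorphism, the two framed deformations over the small extension
are conjugate by `1 + X` with `X` in the kernel. Their difference is then an infinitesimal
deformation that is trivial up to conjugation, and injectivity on tangent vectors forces it to
vanish. -/
theorem FramedPresentation.hom_eq_of_comp_eq {F : CHat k ⥤ Type w} (P : FramedPresentation ρ₀ F)
    (hc : CentralizerLifts ρ₀) {R : CHat k} {ξ : F.obj R}
    (hξ : Function.Injective (fun u : R ⟶ CHat.dual k => F.map u ξ)) {B A : CHat k}
    [IsArtinianRing A] (p : B ⟶ A) (hp : Function.Surjective p.toAlgHom)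
    (hker : ∀ a b, a ∈ maximalIdeal B → p.toAlgHom b = 0 → a * b = 0) (v v' : R ⟶ B)
    (hv : v ≫ p = v' ≫ p) (h : F.map v ξ = F.map v' ξ) : v = v' := by
  obtain ⟨ρ, rfl⟩ := P.cls_surjective R ξ
  rw [P.map_cls, P.map_cls, P.cls_eq_iff] at h
  obtain ⟨g, hg, hgρ⟩ := h
  have hvp : (ρ.map v).map p = (ρ.map v').map p := by
    rw [← FramedRep.map_comp, hv, FramedRep.map_comp]
  -- The two framed deformations agree over `A`, so the image of `g` is an automorphism there; it
  -- lifts to an automorphism `h` of `ρ.map v`, and `g * h⁻¹` conjugates as `g` does but is `1` over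
  -- `A`.
  obtain ⟨h, hhg, hh⟩ := hc.exists_lift p hp (ρ.map v) (p.toAlgHom.mapMatrix g) fun x => by
    rw [FramedRep.map_rep, ← map_mul, hgρ, map_mul, ← FramedRep.map_rep p (ρ.map v'), ← hvp]
    rfl
  obtain ⟨e, rfl⟩ : IsUnit h := isUnit_of_mapMatrix_aug_eq_one
    (by rw [← mapMatrix_aug_comp p, hhg, mapMatrix_aug_comp, hg])
  obtain ⟨X, hX⟩ : ∃ X, g * (↑e⁻¹ : Matrix n n B) = 1 + X := ⟨g * (↑e⁻¹ : Matrix n n B) - 1, by abel⟩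
  have hpX : ∀ i j, p.toAlgHom (X i j) = 0 := by
    have h₁ : p.toAlgHom.mapMatrix X = 0 := by
      rw [← add_right_inj (p.toAlgHom.mapMatrix 1), ← map_add, ← hX, map_mul, ← hhg, ← map_mul,
        e.mul_inv, add_zero]
    exact fun i j => congrFun (congrFun h₁ i) j
  have hconj : ∀ x, (1 + X) * (ρ.map v).rep x = (ρ.map v').rep x * (1 + X) := fun x => by
    have h₁ : (↑e⁻¹ : Matrix n n B) * (ρ.map v).rep x = (ρ.map v).rep x * (↑e⁻¹ : Matrix n n B) :=
      (Commute.units_inv_left (hh x)).eq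
    rw [← hX, mul_assoc, h₁, ← mul_assoc, hgρ, mul_assoc]
  have hdiff : ∀ x, (ρ.map v').rep x - (ρ.map v).rep x =
      X * (ρ₀ x).map (algebraMap k B) - (ρ₀ x).map (algebraMap k B) * X := by
    intro x
    rw [FramedRep.sub_eq_of_conj (hconj x), add_eq_left, sub_eq_zero]
    trans 0
    · ext i j
      exact Finset.sum_eq_zero fun l _ => (mul_comm _ _).trans
        (hker _ _ ((ρ.map v).rep_sub_mem _ _ _) (hpX _ _))
    · ext i j
      exact (Finset.sum_eq_zero fun l _ => hker _ _ ((ρ.map v').rep_sub_mem _ _ _) (hpX _ _)).symm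
  have hD : ∀ r, p.toAlgHom (v'.toAlgHom r - v.toAlgHom r) = 0 := fun r => by
    rw [map_sub, sub_eq_zero]
    exact (congrArg (fun q : R ⟶ A => q.toAlgHom r) hv).symm
  -- `B` acts on the kernel through `k`, so `v' - v` is a derivation of `R` over the residue map.
  have hmul : ∀ (b : B) (d : B), p.toAlgHom d = 0 → b * d = aug B b • d := fun b d hd => by
    have := hker _ _ (sub_aug_mem B b) hd
    rwa [sub_mul, sub_eq_zero, ← Algebra.smul_def] at this
  ext r
  rw [eq_comm, ← sub_eq_zero, ← Module.forall_dual_apply_eq_zero_iff k]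
  intro ℓ
  have hD' : ∀ r s, v'.toAlgHom (r * s) - v.toAlgHom (r * s) =
      aug R r • (v'.toAlgHom s - v.toAlgHom s) + aug R s • (v'.toAlgHom r - v.toAlgHom r) := by
    intro r s
    rw [← aug_comp v' r, ← hmul _ _ (hD s), ← aug_comp v s, ← hmul _ _ (hD r), map_mul, map_mul]
    ring
  -- Each linear form `ℓ` turns this derivation into a tangent vector of `R`.
  let wl : R →ₐ[k] TrivSqZeroExt k k :=
    { toFun := fun r => TrivSqZeroExt.inl (aug R r) +
        TrivSqZeroExt.inr (ℓ (v'.toAlgHom r - v.toAlgHom r))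
      map_one' := by simp
      map_zero' := by simp
      map_add' := fun r s => by
        ext
        · simp
        · simp only [map_add, TrivSqZeroExt.snd_add, TrivSqZeroExt.snd_inl, TrivSqZeroExt.snd_inr,
            map_sub]
          ring
      map_mul' := fun r s => by
        rw [hD']
        ext <;> simp [mul_comm]
      commutes' := fun c => by simp [TrivSqZeroExt.algebraMap_eq_inl] }
  -- The matrix `1 + ε ℓ(X)` conjugates the trivial deformation into the one induced by `wl`, so
  -- `wl` is the zero tangent vector.
  have hw : (ofAlgHom (S := CHat.dual k) wl : R ⟶ CHat.dual k) = augHom R (CHat.dual k) := by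
    refine hξ ?_
    simp only [P.map_cls]
    refine ((P.cls_eq_iff _ _).2 ⟨sqZeroMatrix 1 (X.map ℓ), mapMatrix_aug_sqZeroMatrix _ _,
      fun x => ?_⟩).symm
    have h₁ : (ρ.map (augHom R (CHat.dual k))).rep x = sqZeroMatrix (ρ₀ x) (0 : Matrix n n k) := by
      ext i j
      rw [FramedRep.map_rep_apply, augHom_apply, ← ρ.aug_rep]
      refine (congrFun (TrivSqZeroExt.algebraMap_eq_inl k k) _).trans ?_
      simp [sqZeroMatrix]
    have h₂ : (ρ.map (ofAlgHom (S := CHat.dual k) wl)).rep x =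
        sqZeroMatrix (ρ₀ x) (X.map ℓ * ρ₀ x - ρ₀ x * X.map ℓ) := by
      have h₃ : ((ρ.map v').rep x - (ρ.map v).rep x).map ℓ = X.map ℓ * ρ₀ x - ρ₀ x * X.map ℓ := by
        rw [hdiff]
        ext i j
        simp [Matrix.mul_apply, ← Algebra.smul_def, ← Algebra.commutes]
        exact Finset.sum_congr rfl fun l _ => mul_comm _ _
      rw [← h₃, ← ρ.aug_rep]
      rfl
    refine (congrArg _ h₁).trans ?_
    refine Eq.trans ?_ (congrArg (fun M : Matrix n n (TrivSqZeroExt k k) =>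
      M * sqZeroMatrix 1 (X.map ℓ)) h₂).symm
    refine (sqZeroMatrix_mul _ _ _ _).trans ?_
    refine Eq.trans ?_ (sqZeroMatrix_mul _ _ _ _).symm
    rw [sqZeroMatrix_inj]
    simp only [matrixLeftMul_eq_mul, matrixRightMul_eq_mul]
    simp
  have h₀ := congrArg (fun w : R ⟶ CHat.dual k => TrivSqZeroExt.snd (w.toAlgHom r)) hw
  refine Eq.trans ?_ (h₀.trans ?_)
  · change _ = TrivSqZeroExt.snd (TrivSqZeroExt.inl (aug R r) +
        TrivSqZeroExt.inr (ℓ (v'.toAlgHom r - v.toAlgHom r)))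
    simp
  · exact TrivSqZeroExt.snd_inl k _

/-- Both halves pass through the Artinian quotients of `A`: uniqueness rises along small extensions
by `hom_eq_of_comp_eq`, and existence by smoothness of the hull. -/
theorem FramedPresentation.represents {F : CHat k ⥤ Type w} (P : FramedPresentation ρ₀ F)
    (hfd : FinitelyDetermined ρ₀) (hc : CentralizerLifts ρ₀) (R : CHat k) (ξ : F.obj R)
    (hull : IsHull F R ξ) : Represents F R ξ := by
  refine fun A => ⟨fun u u' h => ?_, fun a => ?_⟩
  · have key : ∀ n, u ≫ A.quotProj n = u' ≫ A.quotProj n := fun n => by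
      induction n with
      | zero =>
        ext r
        have h₀ := A.maximalIdeal_quot_pow 0
        rw [zero_add, pow_one] at h₀
        have h₁ := sub_aug_mem (A.quot 0) ((u ≫ A.quotProj 0).toAlgHom r)
        have h₂ := sub_aug_mem (A.quot 0) ((u' ≫ A.quotProj 0).toAlgHom r)
        rw [h₀, Ideal.mem_bot, sub_eq_zero] at h₁ h₂
        rw [h₁, h₂, aug_comp, aug_comp]
      | succ n ih =>
        refine P.hom_eq_of_comp_eq hc hull.tangent.1 (A.quotTrans n) (A.quotTrans_surjective n)
          (fun a b => A.mul_eq_zero_of_quotTrans_eq_zero n) _ _ ih ?_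
        rw [Functor.map_comp_apply, Functor.map_comp_apply]
        exact congrArg _ h
    ext r
    exact A.eq_of_quotProj fun n => congrArg (fun w : R ⟶ A.quot n => w.toAlgHom r) (key n)
  · have h₀ : F.map (augHom R (A.quot 0)) ξ = F.map (A.quotProj 0) a :=
      P.eq_of_maximalIdeal_eq_bot (by simpa using A.maximalIdeal_quot_pow 0) _ _
    have step : ∀ n (u : R ⟶ A.quot n), F.map u ξ = F.map (A.quotProj n) a →
        ∃ v : R ⟶ A.quot (n + 1), v ≫ A.quotTrans n = u ∧
          F.map v ξ = F.map (A.quotProj (n + 1)) a := fun n u hu =>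
      hull.smooth _ _ (A.quotTrans n) (A.quotTrans_surjective n) u _ (by
        rw [← Functor.map_comp_apply, quotProj_comp_quotTrans, hu])
    choose next hnext hnext' using step
    -- Smoothness yields a compatible tower starting from `R → k → A.quot 0`. Its limit induces `a`
    -- because classes over `A` are detected on the quotients, by continuity.
    let u : ∀ n, { u : R ⟶ A.quot n // F.map u ξ = F.map (A.quotProj n) a } := fun n =>
      Nat.rec ⟨_, h₀⟩ (fun n u => ⟨next n u.1 u.2, hnext' n _ u.2⟩) n
    obtain ⟨v, hv⟩ := exists_hom_comp_quotProj_eq (fun n => (u n).1) fun n =>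
      hnext n _ (u n).2
    refine ⟨v, (P.isContinuous hfd A).1 (Subtype.ext (funext fun n => ?_))⟩
    change F.map (A.quotProj n) (F.map v ξ) = F.map (A.quotProj n) a
    rw [← Functor.map_comp_apply, hv]
    exact (u n).2

end Represents

/-! ### Bimodule identities for matrices with entries in a vector space -/

section MatrixBimodule

variable {k : Type u} [Field k] {n : Type} [Fintype n] {W : Type u} [AddCommGroup W] [Module k W]

theorem matrixLeftMul_mul (A B : Matrix n n k) (D : Matrix n n W) :
    matrixLeftMul (A * B) D = matrixLeftMul A (matrixLeftMul B D) := by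
  ext i j
  simp only [matrixLeftMul, Matrix.mul_apply, Matrix.of_apply, Finset.sum_smul, Finset.smul_sum,
    smul_smul]
  exact Finset.sum_comm

theorem matrixRightMul_mul (D : Matrix n n W) (A B : Matrix n n k) :
    matrixRightMul D (A * B) = matrixRightMul (matrixRightMul D A) B := by
  ext i j
  simp only [matrixRightMul, Matrix.mul_apply, Matrix.of_apply, Finset.sum_smul, Finset.smul_sum,
    smul_smul]
  rw [Finset.sum_comm]
  simp only [mul_comm]

theorem matrixRightMul_matrixLeftMul (A : Matrix n n k) (D : Matrix n n W) (B : Matrix n n k) :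
    matrixRightMul (matrixLeftMul A D) B = matrixLeftMul A (matrixRightMul D B) := by
  ext i j
  simp only [matrixRightMul, matrixLeftMul, Matrix.of_apply, Finset.smul_sum, smul_smul]
  rw [Finset.sum_comm]
  simp only [mul_comm]

theorem matrixLeftMul_sub (A : Matrix n n k) (D D' : Matrix n n W) :
    matrixLeftMul A (D - D') = matrixLeftMul A D - matrixLeftMul A D' := by
  ext i j
  simp [matrixLeftMul, smul_sub]

theorem matrixRightMul_sub (D D' : Matrix n n W) (A : Matrix n n k) :
    matrixRightMul (D - D') A = matrixRightMul D A - matrixRightMul D' A := by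
  ext i j
  simp [matrixRightMul, smul_sub]

end MatrixBimodule

/-! ### Derivations modulo inner derivations -/

section FirstCohomology

variable {k : Type u} [Field k] {H : Type u} [NonUnitalRing H] [Module k H]
  {n : Type} [Fintype n] (ρ₀ : H →ₙₐ[k] Matrix n n k)

/-- The derivations of `H` with values in the matrices with entries in `W`, seen as an `H`-bimodule
through `ρ₀`. -/
def repCocycle (W : Type u) [AddCommGroup W] [Module k W] :
    Submodule k (H →ₗ[k] Matrix n n W) where
  carrier := {d | ∀ x y, d (x * y) = matrixLeftMul (ρ₀ x) (d y) + matrixRightMul (d x) (ρ₀ y)}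
  zero_mem' x y := by ext i j; simp [matrixLeftMul, matrixRightMul]
  add_mem' {d d'} hd hd' x y := by
    rw [LinearMap.add_apply, hd x y, hd' x y]
    ext i j
    simp only [matrixLeftMul, matrixRightMul, LinearMap.add_apply, Matrix.add_apply, smul_add,
      Finset.sum_add_distrib, Matrix.of_apply]
    abel
  smul_mem' c d hd x y := by
    rw [LinearMap.smul_apply, hd x y]
    ext i j
    simp only [matrixLeftMul, matrixRightMul, LinearMap.smul_apply, Matrix.add_apply,
      Matrix.smul_apply, smul_add, Finset.smul_sum, Matrix.of_apply, smul_comm c]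

variable {W W' W'' : Type u} [AddCommGroup W] [Module k W] [AddCommGroup W'] [Module k W']
  [AddCommGroup W''] [Module k W'']

variable {ρ₀} in
theorem repCocycle_map_mul (d : repCocycle ρ₀ W) (x y : H) :
    d.1 (x * y) = matrixLeftMul (ρ₀ x) (d.1 y) + matrixRightMul (d.1 x) (ρ₀ y) := d.2 x y

variable (W) in
/-- The inner derivation `x ↦ X ρ₀(x) - ρ₀(x) X`. -/
def repCoboundary : Matrix n n W →ₗ[k] repCocycle ρ₀ W where
  toFun X :=
    ⟨{ toFun := fun x => matrixRightMul X (ρ₀ x) - matrixLeftMul (ρ₀ x) X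
       map_add' := fun x y => by
         ext i j
         simp only [matrixLeftMul, matrixRightMul, map_add, Matrix.add_apply, Matrix.sub_apply,
           Matrix.of_apply, add_smul, Finset.sum_add_distrib]
         abel
       map_smul' := fun c x => by
         ext i j
         simp [matrixLeftMul, matrixRightMul, smul_sub, Finset.smul_sum, mul_smul] }, fun x y => by
      change matrixRightMul X (ρ₀ (x * y)) - matrixLeftMul (ρ₀ (x * y)) X =
        matrixLeftMul (ρ₀ x) (matrixRightMul X (ρ₀ y) - matrixLeftMul (ρ₀ y) X) +
          matrixRightMul (matrixRightMul X (ρ₀ x) - matrixLeftMul (ρ₀ x) X) (ρ₀ y)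
      rw [map_mul, matrixRightMul_mul, matrixLeftMul_mul, matrixLeftMul_sub, matrixRightMul_sub,
        matrixRightMul_matrixLeftMul]
      abel⟩
  map_add' X Y := by
    ext x i j
    simp only [matrixLeftMul, matrixRightMul, Matrix.add_apply, Matrix.sub_apply, Matrix.of_apply,
      LinearMap.coe_mk, AddHom.coe_mk, Submodule.coe_add, LinearMap.add_apply, smul_add,
      Finset.sum_add_distrib]
    abel
  map_smul' c X := by
    ext x i j
    simp only [matrixLeftMul, matrixRightMul, Matrix.smul_apply, Matrix.sub_apply, Matrix.of_apply,
      LinearMap.coe_mk, AddHom.coe_mk, Submodule.coe_smul, LinearMap.smul_apply, smul_sub,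
      Finset.smul_sum, smul_comm c, RingHom.id_apply]

theorem repCoboundary_apply (X : Matrix n n W) (x : H) :
    (repCoboundary ρ₀ W X).1 x = matrixRightMul X (ρ₀ x) - matrixLeftMul (ρ₀ x) X := rfl

variable (W) in
/-- The first Hochschild cohomology of `H` with values in the matrices with entries in `W`. -/
abbrev RepH1 : Type u := repCocycle ρ₀ W ⧸ LinearMap.range (repCoboundary ρ₀ W)

/-- The action of a linear map of coefficients on derivations. -/
def repCocycleMap (f : W →ₗ[k] W') : repCocycle ρ₀ W →ₗ[k] repCocycle ρ₀ W' where
  toFun d := ⟨f.mapMatrix ∘ₗ d.1, fun x y => by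
    simp only [LinearMap.comp_apply, LinearMap.mapMatrix_apply, repCocycle_map_mul, matrixLeftMul_map,
      matrixRightMul_map]
    exact Matrix.map_add f (map_add f) _ _⟩
  map_add' d d' := Subtype.ext (LinearMap.comp_add _ _ _)
  map_smul' c d := Subtype.ext (LinearMap.comp_smul _ _ _)

theorem repCocycleMap_apply (f : W →ₗ[k] W') (d : repCocycle ρ₀ W) (x : H) :
    (repCocycleMap ρ₀ f d).1 x = (d.1 x).map f := rfl

theorem repCocycleMap_repCoboundary (f : W →ₗ[k] W') (X : Matrix n n W) :
    repCocycleMap ρ₀ f (repCoboundary ρ₀ W X) = repCoboundary ρ₀ W' (X.map f) := by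
  ext x : 2
  rw [repCocycleMap_apply, repCoboundary_apply, repCoboundary_apply, matrixLeftMul_map, matrixRightMul_map]
  exact Matrix.map_sub f (map_sub f) _ _

/-- The action of a linear map of coefficients on cohomology. -/
def repH1Map (f : W →ₗ[k] W') : RepH1 ρ₀ W →ₗ[k] RepH1 ρ₀ W' :=
  Submodule.mapQ _ _ (repCocycleMap ρ₀ f) (by
    rintro _ ⟨X, rfl⟩
    exact ⟨X.map f, (repCocycleMap_repCoboundary ρ₀ f X).symm⟩)

theorem repH1Map_comp (f : W →ₗ[k] W') (g : W' →ₗ[k] W'') (z : RepH1 ρ₀ W) :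
    repH1Map ρ₀ g (repH1Map ρ₀ f z) = repH1Map ρ₀ (g ∘ₗ f) z := by
  induction z using Submodule.Quotient.induction_on with
  | H d => rfl

theorem repH1Map_id (z : RepH1 ρ₀ W) : repH1Map ρ₀ LinearMap.id z = z := by
  induction z using Submodule.Quotient.induction_on with
  | H d => rfl

theorem repH1Map_add (f g : W →ₗ[k] W') (z : RepH1 ρ₀ W) :
    repH1Map ρ₀ (f + g) z = repH1Map ρ₀ f z + repH1Map ρ₀ g z := by
  induction z using Submodule.Quotient.induction_on with
  | H d => rfl

theorem repH1Map_smul (c : k) (f : W →ₗ[k] W') (z : RepH1 ρ₀ W) :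
    repH1Map ρ₀ (c • f) z = c • repH1Map ρ₀ f z := by
  induction z using Submodule.Quotient.induction_on with
  | H d => rfl

theorem repH1Map_zero (z : RepH1 ρ₀ W) : repH1Map ρ₀ (0 : W →ₗ[k] W') z = 0 := by
  rw [← zero_smul k (0 : W →ₗ[k] W'), repH1Map_smul, zero_smul]

/-- `H¹` is additive in its coefficients, so the two inclusions of `k` into `k × k` provide the
inverse. -/
theorem repH1_bijective_map_fst_map_snd : Function.Bijective
    (fun z : RepH1 ρ₀ (k × k) => (repH1Map ρ₀ (LinearMap.fst k k k) z,
      repH1Map ρ₀ (LinearMap.snd k k k) z)) := by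
  refine Function.bijective_iff_has_inverse.2 ⟨fun p => repH1Map ρ₀ (LinearMap.inl k k k) p.1 +
    repH1Map ρ₀ (LinearMap.inr k k k) p.2, fun z => ?_, fun p => ?_⟩
  · simp only [repH1Map_comp]
    rw [← repH1Map_add]
    convert repH1Map_id ρ₀ z
    ext <;> simp
  · simp only [map_add, repH1Map_comp, LinearMap.fst_comp_inl, LinearMap.fst_comp_inr,
      LinearMap.snd_comp_inl, LinearMap.snd_comp_inr, repH1Map_id, repH1Map_zero, add_zero,
      zero_add]

end FirstCohomology

/-! ### The tangent space as first cohomology -/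

section Tangent

variable {k : Type u} [Field k] {H : Type u} [NonUnitalRing H] [Module k H]
  {n : Type} [Fintype n] [DecidableEq n] {ρ₀ : H →ₙₐ[k] Matrix n n k}
  {W W' : Type u} [AddCommGroup W] [Module k W] [Module kᵐᵒᵖ W] [IsCentralScalar k W]
  [Module.Finite k W] [AddCommGroup W'] [Module k W'] [Module kᵐᵒᵖ W'] [IsCentralScalar k W']
  [Module.Finite k W']

/-- The framed deformation `x ↦ ρ₀(x) + d(x)` over `k ⊕ W`. -/
noncomputable def FramedRep.ofCocycle (d : repCocycle ρ₀ W) : FramedRep ρ₀ (CHat.sqZero k W) where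
  rep :=
    { toFun := fun x => sqZeroMatrix (ρ₀ x) (d.1 x)
      map_smul' := fun c x => by
        rw [map_smul, map_smul]
        exact sqZeroMatrix_smul c _ _
      map_zero' := by
        rw [map_zero, map_zero]
        ext i j
        · exact (add_zero _).trans rfl
        · exact (add_zero _).trans rfl
      map_add' := fun x y => by
        rw [map_add, map_add]
        exact sqZeroMatrix_add _ _ _ _
      map_mul' := fun x y => by
        rw [map_mul, repCocycle_map_mul]
        exact (sqZeroMatrix_mul _ _ _ _).symm }
  aug_rep x := mapMatrix_aug_sqZeroMatrix _ _

theorem FramedRep.ofCocycle_rep (d : repCocycle ρ₀ W) (x : H) :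
    (FramedRep.ofCocycle d).rep x = sqZeroMatrix (ρ₀ x) (d.1 x) := rfl

theorem FramedRep.exists_ofCocycle_eq (ρ : FramedRep ρ₀ (CHat.sqZero k W)) :
    ∃ d, FramedRep.ofCocycle d = ρ := by
  let δ : H → Matrix n n W := fun x => Matrix.map (ρ.rep x) TrivSqZeroExt.snd
  have hδ : ∀ x, ρ.rep x = sqZeroMatrix (ρ₀ x) (δ x) := fun x => by
    refine (eq_sqZeroMatrix _).trans (sqZeroMatrix_inj.2 ⟨?_, rfl⟩)
    rw [← ρ.aug_rep]
    ext i j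
    exact (CHat.aug_sqZero _).symm
  refine ⟨⟨{ toFun := δ, map_add' := fun x y => ?_, map_smul' := fun c x => ?_ }, fun x y => ?_⟩,
    FramedRep.ext_apply fun x => (hδ x).symm⟩
  · have h := (hδ (x + y)).symm.trans (map_add ρ.rep x y)
    rw [hδ, hδ] at h
    exact (sqZeroMatrix_inj.1 (h.trans (sqZeroMatrix_add _ _ _ _).symm)).2
  · have h := (hδ (c • x)).symm.trans (map_smul ρ.rep c x)
    rw [hδ] at h
    exact (sqZeroMatrix_inj.1 (h.trans (sqZeroMatrix_smul _ _ _).symm)).2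
  · have h := (hδ (x * y)).symm.trans (map_mul ρ.rep x y)
    rw [hδ, hδ] at h
    exact (sqZeroMatrix_inj.1 (h.trans (sqZeroMatrix_mul _ _ _ _))).2

theorem FramedRep.map_ofCocycle (f : W →ₗ[k] W') (d : repCocycle ρ₀ W) :
    (FramedRep.ofCocycle d).map (CHat.sqZeroMap f) =
      FramedRep.ofCocycle (repCocycleMap ρ₀ f d) := by
  refine FramedRep.ext_apply fun x => ?_
  ext i j
  change TrivSqZeroExt.map f _ = _
  simp [sqZeroMatrix, FramedRep.ofCocycle_rep]
  rfl

/-- A matrix reducing to `1` is `1 + X` with entries of `X` in `W`. Since `W² = 0`, the intertwining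
relation is exactly `Xρ₀ - ρ₀X = d' - d`. -/
theorem FramedRep.ofCocycle_equiv_iff (d d' : repCocycle ρ₀ W) :
    (FramedRep.ofCocycle d).Equiv (FramedRep.ofCocycle d') ↔
      ∃ X : Matrix n n W, repCoboundary ρ₀ W X = d' - d := by
  have key : ∀ (X : Matrix n n W) x, (sqZeroMatrix 1 X * sqZeroMatrix (ρ₀ x) (d.1 x) =
      sqZeroMatrix (ρ₀ x) (d'.1 x) * sqZeroMatrix 1 X ↔
        (repCoboundary ρ₀ W X).1 x = (d' - d).1 x) := by
    intro X x
    rw [sqZeroMatrix_mul, sqZeroMatrix_mul, sqZeroMatrix_inj, one_mul, mul_one,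
      eq_self_iff_true, true_and, repCoboundary_apply]
    have h₁ : ∀ D : Matrix n n W, matrixLeftMul (1 : Matrix n n k) D = D := fun D => by
      ext i j
      simp [matrixLeftMul, Matrix.one_apply]
    have h₂ : ∀ D : Matrix n n W, matrixRightMul D (1 : Matrix n n k) = D := fun D => by
      ext i j
      simp [matrixRightMul, Matrix.one_apply]
    rw [h₁, h₂]
    change _ ↔ _ = d'.1 x - d.1 x
    rw [sub_eq_sub_iff_add_eq_add, add_comm, add_comm (d'.1 x)]
  constructor
  · rintro ⟨g, hg, h⟩
    have hg' : g = sqZeroMatrix 1 (Matrix.map g TrivSqZeroExt.snd) := by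
      refine (eq_sqZeroMatrix _).trans (sqZeroMatrix_inj.2 ⟨?_, rfl⟩)
      rw [← hg]
      ext i j
      exact (CHat.aug_sqZero _).symm
    rw [hg'] at h
    exact ⟨_, Subtype.ext (LinearMap.ext fun x => (key _ x).1 (h x))⟩
  · rintro ⟨X, hX⟩
    exact ⟨sqZeroMatrix 1 X, mapMatrix_aug_sqZeroMatrix _ _,
      fun x => (key X x).2 (congrArg (fun d => d.1 x) hX)⟩

namespace FramedPresentation

variable {F : CHat k ⥤ Type w}

variable (W) in
/-- The elements of `F(k ⊕ W)` are the classes in the first cohomology with coefficients `W`. -/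
noncomputable def sqZeroEquiv (P : FramedPresentation ρ₀ F) : RepH1 ρ₀ W ≃ F.obj (CHat.sqZero k W) :=
  Equiv.ofBijective
    (Quotient.lift (fun d => P.cls (FramedRep.ofCocycle d)) fun d d' h => by
      rw [P.cls_eq_iff, FramedRep.ofCocycle_equiv_iff]
      obtain ⟨X, hX⟩ := (Submodule.quotientRel_def _).1 h
      exact ⟨-X, by rw [map_neg, hX, neg_sub]⟩)
    ⟨fun z z' h => by
      induction z using Submodule.Quotient.induction_on with | H d
      induction z' using Submodule.Quotient.induction_on with | H d'
      have h' := (FramedRep.ofCocycle_equiv_iff d d').1 ((P.cls_eq_iff _ _).1 h)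
      exact ((Submodule.Quotient.eq _).2 h').symm,
    fun a => by
      obtain ⟨ρ, rfl⟩ := P.cls_surjective _ a
      obtain ⟨d, rfl⟩ := ρ.exists_ofCocycle_eq
      exact ⟨Submodule.Quotient.mk d, rfl⟩⟩

theorem map_sqZeroEquiv (P : FramedPresentation ρ₀ F) (f : W →ₗ[k] W') (z : RepH1 ρ₀ W) :
    F.map (CHat.sqZeroMap f) (P.sqZeroEquiv W z) = P.sqZeroEquiv W' (repH1Map ρ₀ f z) := by
  induction z using Submodule.Quotient.induction_on with | H d
  refine (P.map_cls _ _).trans ?_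
  rw [FramedRep.map_ofCocycle]
  rfl

/-- The structure is transported from `H¹`. Naturality of `sqZeroEquiv` in the coefficients then
reduces the defining properties of the canonical structure to linearity of `f ↦ repH1Map ρ₀ f`. -/
theorem exists_isTangentStructure (P : FramedPresentation ρ₀ F) : ∃ (_ : AddCommGroup (FunctorTangentSpace F))
    (_ : Module k (FunctorTangentSpace F)), IsTangentStructure F ∧
      Nonempty (FunctorTangentSpace F ≃ₗ[k] RepH1 ρ₀ k) := by
  let e : FunctorTangentSpace F ≃ RepH1 ρ₀ k := (P.sqZeroEquiv k).symm
  let : AddCommGroup (FunctorTangentSpace F) := e.addCommGroup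
  let : Module k (FunctorTangentSpace F) := e.module k
  have he : ∀ t, P.sqZeroEquiv k (e t) = t := fun t => Equiv.apply_symm_apply _ t
  have hadd : ∀ y z, P.sqZeroEquiv k y + P.sqZeroEquiv k z = P.sqZeroEquiv k (y + z) :=
    fun y z => ((e.linearEquiv k).symm.map_add y z).symm
  have hsmul : ∀ (c : k) z, c • P.sqZeroEquiv k z = P.sqZeroEquiv k (c • z) :=
    fun c z => ((e.linearEquiv k).symm.map_smul c z).symm
  refine ⟨inferInstance, inferInstance, ⟨?_, fun z => ?_, fun c t => ?_⟩, ⟨e.linearEquiv k⟩⟩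
  · have h := (((P.sqZeroEquiv k).prodCongr (P.sqZeroEquiv k)).bijective.comp
      (repH1_bijective_map_fst_map_snd ρ₀)).comp (P.sqZeroEquiv (k × k)).symm.bijective
    convert h using 1
    funext z
    obtain ⟨z, rfl⟩ := (P.sqZeroEquiv (k × k)).surjective z
    simp [map_sqZeroEquiv]
  · obtain ⟨z, rfl⟩ := (P.sqZeroEquiv (k × k)).surjective z
    rw [map_sqZeroEquiv, map_sqZeroEquiv, map_sqZeroEquiv, hadd, repH1Map_add]
  · obtain ⟨z, rfl⟩ := (P.sqZeroEquiv k).surjective t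
    rw [map_sqZeroEquiv, hsmul, repH1Map_smul, repH1Map_id]

end FramedPresentation

end Tangent

/-! ### Local units and finite determination -/

section RepMatrix

open scoped ModuleCat

variable {k Λ : Type u} [Field k] [Ring Λ] [Algebra k Λ]

namespace RepetitiveAlgebra

theorem localUnit_fst_apply_of_natAbs_le {n : ℕ} {i : ℤ} (h : i.natAbs ≤ n) :
    (localUnit n : RepetitiveAlgebra k Λ).1 i = 1 := by
  have : i ∈ Finset.Icc (-(n : ℤ)) n := by
    rw [Finset.mem_Icc]
    omega
  simp [localUnit, Finsupp.indicator, this, -Finset.mem_Icc]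

theorem localUnit_fst_apply_of_lt_natAbs {n : ℕ} {i : ℤ} (h : n < i.natAbs) :
    (localUnit n : RepetitiveAlgebra k Λ).1 i = 0 := by
  have : i ∉ Finset.Icc (-(n : ℤ)) n := by
    rw [Finset.mem_Icc]
    omega
  simp [localUnit, Finsupp.indicator, this, -Finset.mem_Icc]

theorem localUnit_snd_apply (n : ℕ) (i : ℤ) : (localUnit n : RepetitiveAlgebra k Λ).2 i = 0 := rfl

theorem localUnit_mul_self (n : ℕ) :
    (localUnit n * localUnit n : RepetitiveAlgebra k Λ) = localUnit n := by
  ext i z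
  · rw [mul_fst_apply]
    rcases le_or_gt i.natAbs n with h | h
    · rw [localUnit_fst_apply_of_natAbs_le h, one_mul]
    · rw [localUnit_fst_apply_of_lt_natAbs h, zero_mul]
  · simp [localUnit_snd_apply]

/-- The linear map `x ↦ e x e`, where `e` is the idempotent `localUnit n`. -/
noncomputable def localCorner (n : ℕ) : RepetitiveAlgebra k Λ →ₗ[k] RepetitiveAlgebra k Λ :=
  LinearMap.mulRight k (localUnit n) ∘ₗ LinearMap.mulLeft k (localUnit n)

theorem localCorner_apply (n : ℕ) (x : RepetitiveAlgebra k Λ) :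
    localCorner n x = localUnit n * x * localUnit n := rfl

instance finite_range_localCorner [FiniteDimensional k Λ] (n : ℕ) :
    Module.Finite k (LinearMap.range (localCorner n : RepetitiveAlgebra k Λ →ₗ[k] _)) := by
  let S : Finset ℤ := Finset.Icc (-(n : ℤ)) n
  let f : RepetitiveAlgebra k Λ →ₗ[k] (S → Λ) × (S → Module.Dual k Λ) :=
    { toFun := fun x => (fun i => x.1 i, fun i => x.2 i)
      map_add' := fun x y => rfl
      map_smul' := fun c x => rfl }
  refine Module.Finite.of_injective (f ∘ₗ Submodule.subtype _) fun y y' h => Subtype.ext ?_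
  obtain ⟨_, x, rfl⟩ := y
  obtain ⟨_, x', rfl⟩ := y'
  have hS : ∀ i : ℤ, i ∉ S → n < i.natAbs := fun i hi => by
    rw [Finset.mem_Icc] at hi
    omega
  change localCorner n x = localCorner n x'
  ext i z
  · by_cases hi : i ∈ S
    · exact congrFun (congrArg Prod.fst h) ⟨i, hi⟩
    · simp [localCorner_apply, localUnit_fst_apply_of_lt_natAbs (hS i hi)]
  · by_cases hi : i ∈ S
    · exact LinearMap.congr_fun (congrFun (congrArg Prod.snd h) ⟨i, hi⟩) z
    · simp [localCorner_apply, localUnit_fst_apply_of_lt_natAbs (hS i hi), localUnit_snd_apply]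

end RepetitiveAlgebra

open RepetitiveAlgebra

theorem RepMod.finite (V : RepMod k Λ) : Module.Finite k V.obj := ((isRepMod_iff _).1 V.property).1

/-- Each basis vector is fixed by all large local units; finite dimension makes the bound uniform.
-/
theorem RepMod.exists_localUnit_smul (V : RepMod k Λ) : ∃ N : ℕ, ∀ n, N ≤ n → ∀ v : V.obj,
    (Unitization.inr (localUnit n) : RepetitiveAlgebraUnit k Λ) • v = v := by
  have h₁ : ∀ v : V.obj, ∃ N : ℕ, ∀ n, N ≤ n →
      (Unitization.inr (localUnit n) : RepetitiveAlgebraUnit k Λ) • v = v := fun v => by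
    obtain ⟨x, hx⟩ := ((isRepMod_iff _).1 V.property).2 v
    obtain ⟨N, hN⟩ := exists_localUnit_mul x
    refine ⟨N, fun n hn => ?_⟩
    rw [← hx, smul_smul, ← Unitization.inr_mul, hN n hn]
  choose N hN using h₁
  have := V.finite
  let b := Module.finBasis k V.obj
  refine ⟨Finset.univ.sup fun i => N (b i), fun n hn v => ?_⟩
  have h₂ : Algebra.lsmul k k V.obj (Unitization.inr (localUnit n) : RepetitiveAlgebraUnit k Λ) =
      LinearMap.id := b.ext fun i =>
    hN (b i) n ((Finset.le_sup (f := fun i => N (b i)) (Finset.mem_univ i)).trans hn)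
  exact LinearMap.congr_fun h₂ v

variable {V : RepMod k Λ} {n : Type} [Fintype n] [DecidableEq n] (b : Module.Basis n k V.obj)

/-- The matrix representation of the repetitive algebra on a based module. -/
noncomputable def repMatrix : RepetitiveAlgebra k Λ →ₙₐ[k] Matrix n n k :=
  ((((LinearMap.toMatrixAlgEquiv b : Module.End k V.obj ≃ₐ[k] Matrix n n k) :
      Module.End k V.obj →ₐ[k] Matrix n n k).comp (Algebra.lsmul k k V.obj) :
    RepetitiveAlgebraUnit k Λ →ₐ[k] Matrix n n k) :
    RepetitiveAlgebraUnit k Λ →ₙₐ[k] Matrix n n k).comp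
    (Unitization.inrNonUnitalAlgHom k (RepetitiveAlgebra k Λ))

theorem toLin_repMatrix (x : RepetitiveAlgebra k Λ) :
    Matrix.toLin b b (repMatrix b x) =
      Algebra.lsmul k k V.obj (Unitization.inr x : RepetitiveAlgebraUnit k Λ) :=
  Matrix.toLin_toMatrix b b _

theorem toLin_repMatrix_apply (x : RepetitiveAlgebra k Λ) (v : V.obj) :
    Matrix.toLin b b (repMatrix b x) v = (Unitization.inr x : RepetitiveAlgebraUnit k Λ) • v := by
  rw [toLin_repMatrix]
  rfl

theorem exists_repMatrix_localUnit_eq_one : ∃ N : ℕ, ∀ m, N ≤ m →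
    repMatrix b (localUnit m) = 1 := by
  obtain ⟨N, hN⟩ := V.exists_localUnit_smul
  refine ⟨N, fun m hm => (Matrix.toLin b b).injective (LinearMap.ext fun v => ?_)⟩
  rw [toLin_repMatrix_apply, hN m hm, Matrix.toLin_one, LinearMap.id_apply]

/-- Invertibility of a matrix can be tested on its reduction, and an invertible idempotent is `1`.
-/
theorem FramedRep.rep_eq_one {H : Type u} [NonUnitalRing H] [Module k H]
    {ρ₀ : H →ₙₐ[k] Matrix n n k} {R : CHat k} (ρ : FramedRep ρ₀ R) {e : H} (he : e * e = e)
    (h : ρ₀ e = 1) : ρ.rep e = 1 := by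
  obtain ⟨u, hu⟩ := isUnit_of_mapMatrix_aug_eq_one ((ρ.aug_rep e).trans h)
  have h' : ρ.rep e * ρ.rep e = ρ.rep e := by rw [← map_mul, he]
  rw [← hu] at h' ⊢
  exact u.isUnit.mul_left_cancel (h'.trans (mul_one _).symm)

/-- With `e` a local unit acting as `1`, every `ρ` satisfies `ρ(x) = ρ(exe)`. The elements `β s`
form a basis of the corner `eΛ̂e`, and `κ` gives the coordinates of `exe`. -/
theorem finitelyDetermined_repMatrix [FiniteDimensional k Λ] :
    FinitelyDetermined (repMatrix b) := by
  obtain ⟨N, hN⟩ := exists_repMatrix_localUnit_eq_one b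
  let E := LinearMap.range (localCorner N : RepetitiveAlgebra k Λ →ₗ[k] _)
  let c := Module.finBasis k E
  refine ⟨_, fun s => c s, c.equivFun.toLinearMap ∘ₗ (localCorner N).rangeRestrict,
    fun R ρ x => ?_⟩
  have h₁ : ρ.rep x = ρ.rep (localCorner N x) := by
    rw [localCorner_apply, map_mul, map_mul,
      ρ.rep_eq_one (localUnit_mul_self N) (hN N le_rfl), one_mul, mul_one]
  have h₂ : localCorner N x = ∑ s, c.repr ((localCorner N).rangeRestrict x) s • (c s).1 := by
    have := congrArg Subtype.val (c.sum_repr ((localCorner N).rangeRestrict x))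
    simp only [Submodule.coe_sum, Submodule.coe_smul] at this
    exact this.symm
  rw [h₁, h₂, map_sum]
  simp

end RepMatrix

/-! ### From framed deformations to lifts -/

section LiftsOfFramed

variable {k Λ : Type u} [Field k] [Ring Λ] [Algebra k Λ] {V : RepMod k Λ} {n : Type} [Fintype n]
  [DecidableEq n]

open scoped ModuleCat

section Framing

variable (b : Module.Basis n k V.obj) (R : CHat k)

/-- The reduction of the free module `R ^ n`, identified with `V` through a basis. -/
noncomputable def framing : k ⊗[R] (n → R) ≃ₗ[k] V.obj :=
  (TensorProduct.piScalarRight R k k n).trans b.equivFun.symm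

theorem framing_tmul (c : k) (v : n → R) : framing b R (c ⊗ₜ v) = ∑ j, (aug R (v j) * c) • b j := by
  refine (b.equivFun_symm_apply _).trans ?_
  exact Finset.sum_congr rfl fun j _ =>
    congrArg (· • b j) (congrFun (piScalarRightHom_tmul R k k n c v) j)

theorem framing_one_tmul_single (j : n) : framing b R (1 ⊗ₜ Pi.single j 1) = b j := by
  rw [framing_tmul, Finset.sum_eq_single j]
  · simp
  · intro i _ hij
    simp [hij]
  · simp

variable {R}

theorem framing_toLin' (A : Matrix n n R) (t : k ⊗[R] (n → R)) :
    framing b R ((Matrix.toLin' A).baseChange k t) =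
      Matrix.toLin b b ((aug R).mapMatrix A) (framing b R t) := by
  refine LinearMap.congr_fun (f := (framing b R).toLinearMap ∘ₗ (Matrix.toLin' A).baseChange k)
    (g := Matrix.toLin b b ((aug R).mapMatrix A) ∘ₗ (framing b R).toLinearMap) ?_ t
  refine ((Pi.basisFun R n).baseChange k).ext fun j => ?_
  rw [Module.Basis.baseChange_apply, LinearMap.comp_apply, LinearMap.comp_apply,
    LinearMap.baseChange_tmul, LinearEquiv.coe_coe, Pi.basisFun_apply, framing_one_tmul_single,
    framing_tmul, Matrix.toLin_self]
  simp

theorem toLin_mapMatrix_aug_eq_iff (A : Matrix n n R) (f : V.obj →ₗ[k] V.obj) :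
    (∀ t, framing b R ((Matrix.toLin' A).baseChange k t) = f (framing b R t)) ↔
      Matrix.toLin b b ((aug R).mapMatrix A) = f := by
  simp only [framing_toLin']
  refine ⟨fun h => LinearMap.ext fun v => ?_, fun h t => by rw [h]⟩
  obtain ⟨t, rfl⟩ := (framing b R).surjective v
  exact h t

end Framing

variable {b : Module.Basis n k V.obj} {R S : CHat k}

/-- The lift of `V` on the free module `R ^ n` given by a framed deformation. -/
noncomputable def FramedRep.toLift (ρ : FramedRep (repMatrix b) R) : Lift V R where
  M := n → R
  act := ((Matrix.toLinAlgEquiv' : Matrix n n R ≃ₐ[R] _) : Matrix n n R →ₙ+* _).comp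
    (ρ.rep : RepetitiveAlgebra k Λ →ₙ+* Matrix n n R)
  act_smul c x := by
    change Matrix.toLin' (ρ.rep (c • x)) = algebraMap k R c • Matrix.toLin' (ρ.rep x)
    rw [map_smul, ← algebraMap_smul R c (ρ.rep x), map_smul]
  fg := by
    classical
    obtain ⟨N, hN⟩ := exists_repMatrix_localUnit_eq_one b
    refine ⟨Finset.univ.image (Pi.basisFun R n), ?_⟩
    rw [eq_top_iff, ← (Pi.basisFun R n).span_eq, Submodule.span_le]
    rintro _ ⟨j, rfl⟩
    refine Submodule.subset_span ⟨RepetitiveAlgebra.localUnit N, Pi.basisFun R n j,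
      Finset.mem_image_of_mem _ (Finset.mem_univ j), ?_⟩
    change _ = Matrix.toLin' (ρ.rep _) _
    rw [ρ.rep_eq_one (RepetitiveAlgebra.localUnit_mul_self N) (hN N le_rfl), Matrix.toLin'_one,
      LinearMap.id_apply]
  φ := framing b R
  φ_act x t := by
    refine (framing_toLin' b (ρ.rep x) t).trans ?_
    rw [ρ.aug_rep, toLin_repMatrix_apply]

/-- The matrix of an isomorphism intertwines the two actions, and its compatibility with the
reductions to `V` says that it reduces to `1`. -/
theorem FramedRep.isIso_toLift_iff (ρ ρ' : FramedRep (repMatrix b) R) :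
    Lift.IsIso ρ.toLift ρ'.toLift ↔ ρ.Equiv ρ' := by
  constructor
  · rintro ⟨e⟩
    let α : (n → R) →ₗ[R] (n → R) := e.α.toLinearMap
    have hα : Matrix.toLin' (LinearMap.toMatrix' α) = α := Matrix.toLin'_toMatrix' α
    refine ⟨LinearMap.toMatrix' α, ?_, fun x => ?_⟩
    · refine (Matrix.toLin b b).injective ?_
      refine ((toLin_mapMatrix_aug_eq_iff b _ LinearMap.id).1 fun t => ?_).trans
        (Matrix.toLin_one b).symm
      rw [hα]
      exact e.φ_α t
    · refine Matrix.toLin'.injective ?_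
      rw [Matrix.toLin'_mul, Matrix.toLin'_mul, hα]
      exact LinearMap.ext fun m => e.α_act x m
  · rintro ⟨g, hg, h⟩
    obtain ⟨u, rfl⟩ := isUnit_of_mapMatrix_aug_eq_one hg
    refine ⟨{ α := Matrix.toLin'OfInv u.inv_mul u.mul_inv
              α_act := fun x m => ?_
              φ_α := fun t => ?_ }⟩
    · have := congrArg (fun A => Matrix.toLin' A m) (h x)
      simp only [Matrix.toLin'_mul] at this
      exact this
    · refine (framing_toLin' b (u : Matrix n n R) t).trans ?_
      rw [hg, Matrix.toLin_one]
      rfl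

theorem FramedRep.baseChange_toLift_isIso (θ : R ⟶ S) (ρ : FramedRep (repMatrix b) R) :
    Lift.IsIso (ρ.toLift.baseChange θ) (ρ.map θ).toLift := by
  let : Algebra R S := θ.toAlgHom.toRingHom.toAlgebra
  have : IsScalarTower k R S :=
    IsScalarTower.of_algebraMap_eq fun c => (θ.toAlgHom.commutes c).symm
  have : IsScalarTower R S k :=
    IsScalarTower.of_algebraMap_eq fun r => (CHat.aug_comp θ r).symm
  let : Module R (ρ.map θ).toLift.M := inferInstanceAs (Module R (n → S))
  have : IsScalarTower R S (ρ.map θ).toLift.M := inferInstanceAs (IsScalarTower R S (n → S))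
  let f : (n → R) →ₗ[R] (n → S) := (Algebra.linearMap R S).compLeft n
  refine Lift.isIso_extend ρ.toLift (ρ.map θ).toLift f ?_ (fun x m => ?_) (fun m => ?_)
  · have h : IsBaseChange S f := IsBaseChange.of_equiv (TensorProduct.piScalarRight R S S n)
      fun v => by
        rw [piScalarRight_apply, piScalarRightHom_tmul]
        funext j
        exact (Algebra.algebraMap_eq_smul_one _).symm
    exact h
  · change f (Matrix.toLin' (ρ.rep x) m) = Matrix.toLin' ((ρ.map θ).rep x) (f m)
    funext i
    exact RingHom.map_mulVec θ.toAlgHom.toRingHom (ρ.rep x) m i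
  · change framing b S (1 ⊗ₜ f m) = framing b R (1 ⊗ₜ m)
    refine (framing_tmul b S 1 (f m)).trans (Eq.trans ?_ (framing_tmul b R 1 m).symm)
    exact Finset.sum_congr rfl fun j _ => congrArg (fun c : k => (c * 1) • b j) (aug_comp θ (m j))

end LiftsOfFramed

/-! ### Every lift comes from a framed deformation -/

section DefFunctorPresentation

open scoped ModuleCat

variable {k Λ : Type u} [Field k] [Ring Λ] [Algebra k Λ] {V : RepMod k Λ} {n : Type} [Fintype n]
  [DecidableEq n] (b : Module.Basis n k V.obj) {R : CHat k}

/-- A lift of a based module has coordinates in which its reduction is the given basis. -/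
theorem Lift.exists_coordinates (L : Lift V R) :
    ∃ α : L.M ≃ₗ[R] (n → R), ∀ t, framing b R (α.toLinearMap.baseChange k t) = L.φ t := by
  let c₀ := Module.Free.chooseBasis R L.M
  let c : Module.Basis n R L.M := c₀.reindex (((c₀.baseChange k).map L.φ).indexEquiv b)
  let b' : Module.Basis n k V.obj := (c.baseChange k).map L.φ
  let a : k →+* R := algebraMap k R
  -- An arbitrary basis of the lift reduces to some basis `b'` of `V`. The change of basis to `b`
  -- has entries in `k`, so it lifts to an invertible matrix over `R` through `algebraMap`.
  have hinv : ∀ d d' : Module.Basis n k V.obj,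
      a.mapMatrix (d.toMatrix d') * a.mapMatrix (d'.toMatrix d) = 1 := fun d d' => by
    rw [← map_mul, Module.Basis.toMatrix_mul_toMatrix_flip, map_one]
  refine ⟨c.equivFun.trans (Matrix.toLin'OfInv (hinv b' b) (hinv b b')), fun t => ?_⟩
  refine LinearMap.congr_fun (f := (framing b R).toLinearMap ∘ₗ LinearMap.baseChange k
    (c.equivFun.trans (Matrix.toLin'OfInv (hinv b' b) (hinv b b'))).toLinearMap)
    (g := L.φ.toLinearMap) ?_ t
  refine (c.baseChange k).ext fun j => ?_
  rw [LinearMap.comp_apply, Module.Basis.baseChange_apply, LinearMap.baseChange_tmul,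
    LinearEquiv.coe_coe, LinearEquiv.coe_coe, LinearEquiv.trans_apply]
  have h₁ : Matrix.toLin'OfInv (hinv b' b) (hinv b b') (c.equivFun (c j)) =
      Matrix.toLin' (a.mapMatrix (b.toMatrix b')) (Pi.single j 1) := by
    have h₃ : c.equivFun (c j) = Pi.single j 1 := funext fun i => by
      rw [Module.Basis.equivFun_self, Pi.single_apply]
      simp only [eq_comm]
    rw [h₃]
    rfl
  have h₂ : L.φ (1 ⊗ₜ c j) = b' j := by
    rw [Module.Basis.map_apply, Module.Basis.baseChange_apply]
  rw [LinearEquiv.coe_coe, h₁, h₂, framing_tmul]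
  conv_rhs => rw [← b.sum_repr (b' j)]
  refine Finset.sum_congr rfl fun i _ => ?_
  simp [a, Module.Basis.toMatrix_apply]

theorem Lift.exists_isIso_toLift (L : Lift V R) :
    ∃ ρ : FramedRep (repMatrix b) R, Lift.IsIso ρ.toLift L := by
  obtain ⟨α, hα⟩ := L.exists_coordinates b
  let E : Module.End R L.M ≃ₐ[R] Matrix n n R :=
    (LinearEquiv.conjAlgEquiv R α).trans LinearMap.toMatrixAlgEquiv'
  have hE : ∀ f, Matrix.toLin' (E f) = α.conj f := fun f => Matrix.toLin'_toMatrix' (α.conj f)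
  let r : RepetitiveAlgebra k Λ →ₙₐ[k] Matrix n n R :=
    { toFun := fun x => E (L.act x)
      map_smul' := fun c x => by
        rw [L.act_smul, map_smul, algebraMap_smul]
        rfl
      map_zero' := by rw [map_zero, map_zero]
      map_add' := fun x y => by rw [map_add, map_add]
      map_mul' := fun x y => by rw [map_mul, map_mul] }
  have hr : ∀ x m, Matrix.toLin' (r x) (α m) = α (L.act x m) := fun x m => by
    refine (LinearMap.congr_fun (hE (L.act x)) (α m)).trans ?_
    rw [LinearEquiv.conj_apply_apply, LinearEquiv.symm_apply_apply]
  refine ⟨⟨r, fun x => ?_⟩, Lift.IsIso.symm ⟨⟨α, fun x m => (hr x m).symm, hα⟩⟩⟩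
  refine (Matrix.toLin b b).injective ?_
  rw [toLin_repMatrix]
  refine (toLin_mapMatrix_aug_eq_iff b _ _).1 fun t => ?_
  obtain ⟨t, rfl⟩ : ∃ t', α.toLinearMap.baseChange k t' = t :=
    (α.baseChange R k L.M (n → R)).surjective t
  have h₁ : (Matrix.toLin' (r x)).baseChange k (α.toLinearMap.baseChange k t) =
      α.toLinearMap.baseChange k ((L.act x).baseChange k t) := by
    rw [← LinearMap.comp_apply, ← LinearMap.comp_apply, ← LinearMap.baseChange_comp,
      ← LinearMap.baseChange_comp]
    congr 2
    exact LinearMap.ext (hr x)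
  rw [h₁, hα, hα, L.φ_act]
  rfl

/-- The deformation functor of a module is presented by framed deformations. -/
noncomputable def defFunctorPresentation : FramedPresentation (repMatrix b) (defFunctor V) where
  cls ρ := (⟦ρ.toLift⟧ : Quotient (Lift.setoid V _))
  cls_surjective R a := by
    induction a using Quotient.inductionOn with | h L
    obtain ⟨ρ, hρ⟩ := L.exists_isIso_toLift b
    exact ⟨ρ, Quotient.sound hρ⟩
  cls_eq_iff ρ ρ' := Quotient.eq.trans (ρ.isIso_toLift_iff ρ')
  map_cls θ ρ := Quotient.sound (ρ.baseChange_toLift_isIso θ)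

end DefFunctorPresentation

/-! ### The projective objects `(Λ̂ e) ^ n` -/

section CornerModule

open scoped ModuleCat

variable {k Λ : Type u} [Field k] [Ring Λ] [Algebra k Λ]

open RepetitiveAlgebra

variable (k Λ) in
/-- The left ideal `Λ̂ e` of `k ⊕ Λ̂`, where `e` is the idempotent `localUnit N`. -/
noncomputable def cornerIdeal (N : ℕ) : Submodule (RepetitiveAlgebraUnit k Λ)
    (RepetitiveAlgebraUnit k Λ) :=
  Submodule.span _ {Unitization.inr (localUnit N)}

theorem inr_mem_cornerIdeal (N : ℕ) :
    (Unitization.inr (localUnit N) : RepetitiveAlgebraUnit k Λ) ∈ cornerIdeal k Λ N :=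
  Submodule.mem_span_singleton_self _

theorem mul_inr_of_mem_cornerIdeal {N : ℕ} {y : RepetitiveAlgebraUnit k Λ}
    (hy : y ∈ cornerIdeal k Λ N) : y * Unitization.inr (localUnit N) = y := by
  obtain ⟨a, rfl⟩ := Submodule.mem_span_singleton.1 hy
  rw [smul_eq_mul, mul_assoc, ← Unitization.inr_mul, localUnit_mul_self]

theorem inr_snd_of_mem_cornerIdeal {N : ℕ} {y : RepetitiveAlgebraUnit k Λ}
    (hy : y ∈ cornerIdeal k Λ N) : Unitization.inr y.snd = y := by
  rw [← mul_inr_of_mem_cornerIdeal hy]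
  ext <;> simp

theorem snd_mul_localUnit_of_mem_cornerIdeal {N : ℕ} {y : RepetitiveAlgebraUnit k Λ}
    (hy : y ∈ cornerIdeal k Λ N) : y.snd * localUnit N = y.snd := by
  refine Unitization.inr_injective (R := k) ?_
  rw [Unitization.inr_mul, inr_snd_of_mem_cornerIdeal hy, mul_inr_of_mem_cornerIdeal hy]

/-- Entries of `z` live in degrees at most `N` in absolute value, but `Λ` acts from the left on the
`DΛ`-entry of degree `i` through its entry of degree `i + 1`; hence the local unit one size larger.
-/
theorem RepetitiveAlgebra.localUnit_succ_mul {N : ℕ} {z : RepetitiveAlgebra k Λ}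
    (hz : z * localUnit N = z) : localUnit (N + 1) * z = z := by
  have h₁ : ∀ i : ℤ, N < i.natAbs → z.1 i = 0 := fun i hi => by
    rw [← hz, mul_fst_apply, localUnit_fst_apply_of_lt_natAbs hi, mul_zero]
  have h₂ : ∀ i : ℤ, N < i.natAbs → z.2 i = 0 := fun i hi => by
    ext w
    rw [← hz]
    simp [localUnit_fst_apply_of_lt_natAbs hi, localUnit_snd_apply]
  ext i w
  · rcases le_or_gt i.natAbs N with h | h
    · rw [mul_fst_apply, localUnit_fst_apply_of_natAbs_le (by omega), one_mul]
    · rw [mul_fst_apply, h₁ i h, mul_zero]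
  · rcases le_or_gt i.natAbs N with h | h
    · simp [localUnit_fst_apply_of_natAbs_le (k := k) (Λ := Λ)
        (show (i + 1).natAbs ≤ N + 1 by omega), localUnit_snd_apply]
    · simp [h₂ i h, localUnit_snd_apply]

theorem RepetitiveAlgebra.mul_localUnit_succ {N : ℕ} {z : RepetitiveAlgebra k Λ}
    (hz : z * localUnit N = z) : z * localUnit (N + 1) = z := by
  have h : (localUnit N * localUnit (N + 1) : RepetitiveAlgebra k Λ) = localUnit N := by
    ext i w
    · rcases le_or_gt i.natAbs N with h | h
      · rw [mul_fst_apply, localUnit_fst_apply_of_natAbs_le (n := N + 1) (by omega), mul_one]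
      · rw [mul_fst_apply, localUnit_fst_apply_of_lt_natAbs h, zero_mul]
    · simp [localUnit_snd_apply]
  rw [← hz, mul_assoc, h]

variable {n : Type} [Fintype n]

theorem isRepMod_corner [FiniteDimensional k Λ] (N : ℕ) :
    isRepMod k Λ (ModuleCat.of (RepetitiveAlgebraUnit k Λ) (n → cornerIdeal k Λ N)) := by
  rw [isRepMod_iff]
  refine ⟨?_, fun y => ⟨localUnit (N + 1), funext fun i => Subtype.ext ?_⟩⟩
  -- `Λ̂ e_N` is contained in `e_{N+1} Λ̂ e_{N+1}`, which is finite dimensional.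
  · let E := LinearMap.range (localCorner (N + 1) : RepetitiveAlgebra k Λ →ₗ[k] _)
    have hE : ∀ y ∈ cornerIdeal k Λ N, y.snd ∈ E := fun y hy => ⟨y.snd, by
      have h := snd_mul_localUnit_of_mem_cornerIdeal hy
      rw [localCorner_apply, localUnit_succ_mul h, mul_localUnit_succ h]⟩
    let : Module k (n → cornerIdeal k Λ N) := ModuleCat.moduleOfAlgebraModule
      (ModuleCat.of (RepetitiveAlgebraUnit k Λ) (n → cornerIdeal k Λ N))
    let f : (n → cornerIdeal k Λ N) →ₗ[k] (n → E) :=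
      { toFun := fun y i => ⟨(y i).1.snd, hE _ (y i).2⟩
        map_add' := fun y z => rfl
        map_smul' := fun c y => by
          funext i
          refine Subtype.ext ?_
          change (algebraMap k (RepetitiveAlgebraUnit k Λ) c * (y i).1).snd = c • (y i).1.snd
          rw [← Algebra.smul_def, Unitization.snd_smul] }
    refine Module.Finite.of_injective f fun y z h => funext fun i => Subtype.ext ?_
    rw [← inr_snd_of_mem_cornerIdeal (y i).2, ← inr_snd_of_mem_cornerIdeal (z i).2]
    exact congrArg _ (congrArg Subtype.val (congrFun h i))
  · change Unitization.inr (localUnit (N + 1)) * (y i).1 = (y i).1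
    rw [← inr_snd_of_mem_cornerIdeal (y i).2, ← Unitization.inr_mul,
      localUnit_succ_mul (snd_mul_localUnit_of_mem_cornerIdeal (y i).2)]

variable (k Λ n) in
/-- The object `(Λ̂ e) ^ n` of `Λ̂`-mod. -/
noncomputable def RepMod.corner [FiniteDimensional k Λ] (N : ℕ) : RepMod k Λ :=
  ⟨_, isRepMod_corner (n := n) N⟩

/-- The homomorphism `(y_i)_i ↦ ∑ y_i w_i` on `(Λ̂ e) ^ n`. -/
noncomputable def cornerLift (N : ℕ) {M : Type u} [AddCommGroup M]
    [Module (RepetitiveAlgebraUnit k Λ) M] (w : n → M) :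
    (n → cornerIdeal k Λ N) →ₗ[RepetitiveAlgebraUnit k Λ] M where
  toFun y := ∑ i, (y i).1 • w i
  map_add' y z := by simp [add_smul, Finset.sum_add_distrib]
  map_smul' a y := by simp [Finset.smul_sum, mul_smul]

theorem cornerLift_apply (N : ℕ) {M : Type u} [AddCommGroup M]
    [Module (RepetitiveAlgebraUnit k Λ) M] (w : n → M) (y : n → cornerIdeal k Λ N) :
    cornerLift N w y = ∑ i, (y i).1 • w i := rfl

/-- Every `y` in `Λ̂ e` equals `y e`, so a homomorphism is determined by the images of the copies of
`e`. -/
theorem exists_eq_cornerLift [DecidableEq n] {N : ℕ} {M : Type u} [AddCommGroup M]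
    [Module (RepetitiveAlgebraUnit k Λ) M]
    (f : (n → cornerIdeal k Λ N) →ₗ[RepetitiveAlgebraUnit k Λ] M) :
    ∃ w : n → M, f = cornerLift N w := by
  have h : ∀ y : cornerIdeal k Λ N, y = y.1 • ⟨_, inr_mem_cornerIdeal N⟩ := fun y =>
    Subtype.ext (mul_inr_of_mem_cornerIdeal y.2).symm
  refine ⟨fun i => f (Pi.single i ⟨_, inr_mem_cornerIdeal N⟩), LinearMap.ext fun y => ?_⟩
  rw [cornerLift_apply]
  simp only [← map_smul, ← Pi.single_smul, ← h]
  rw [← map_sum]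
  congr 1
  exact (Finset.univ_sum_single y).symm

/-- The module cokernel stays in `Λ̂`-mod, so it can serve as a test object. -/
theorem RepMod.surjective_of_epi {X Y : RepMod k Λ} (f : X ⟶ Y) [Epi f] :
    Function.Surjective f.hom.hom := by
  let Q : RepMod k Λ := ⟨ModuleCat.of _ (Y.obj ⧸ LinearMap.range f.hom.hom),
    isRepMod_of_surjective (ModuleCat.ofHom (Submodule.mkQ _)) (Submodule.mkQ_surjective _)
      Y.property⟩
  let g : Y ⟶ Q := ObjectProperty.homMk (ModuleCat.ofHom (Submodule.mkQ _))
  have hg : f ≫ g = 0 := by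
    refine ObjectProperty.hom_ext _ (ModuleCat.hom_ext (LinearMap.ext fun x => ?_))
    exact (Submodule.Quotient.mk_eq_zero _).2 ⟨x, rfl⟩
  have hg' : g = 0 := by rwa [← Limits.comp_zero (f := f), cancel_epi] at hg
  rw [← LinearMap.range_eq_top, ← Submodule.ker_mkQ (LinearMap.range f.hom.hom), LinearMap.ker_eq_top]
  exact congrArg (fun g : Y ⟶ Q => g.hom.hom) hg'

theorem RepMod.epi_of_surjective {X Y : RepMod k Λ} (f : X ⟶ Y)
    (hf : Function.Surjective f.hom.hom) : Epi f :=
  ⟨fun g h e => ObjectProperty.hom_ext _ (ModuleCat.hom_ext (LinearMap.ext fun y => by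
    obtain ⟨x, rfl⟩ := hf y
    exact congrArg (fun g : X ⟶ _ => g.hom.hom x) e))⟩

instance RepMod.projective_corner [FiniteDimensional k Λ] [DecidableEq n] (N : ℕ) :
    Projective (RepMod.corner k Λ n N) where
  factors {E X} f e _ := by
    -- Lifting a homomorphism amounts to lifting the vectors `v i`. The lifts need not be fixed by
    -- `e`, since `cornerLift` accepts arbitrary vectors.
    obtain ⟨v, hf⟩ := exists_eq_cornerLift (n := n) f.hom.hom
    choose w hw using fun i => RepMod.surjective_of_epi e (v i)
    refine ⟨ObjectProperty.homMk (ModuleCat.ofHom (cornerLift N w)),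
      ObjectProperty.hom_ext _ (ModuleCat.hom_ext (LinearMap.ext fun y => ?_))⟩
    change e.hom.hom (cornerLift N w y) = f.hom.hom y
    rw [hf]
    refine (map_sum e.hom.hom (fun i => (y i).1 • w i) Finset.univ).trans ?_
    exact Finset.sum_congr rfl fun i _ => by rw [map_smul, hw]

theorem RepMod.exists_surjective_cornerLift {V : RepMod k Λ} (b : Module.Basis n k V.obj) :
    ∃ N : ℕ, Function.Surjective (cornerLift N b : (n → cornerIdeal k Λ N) →ₗ[_] V.obj) := by
  obtain ⟨N, hN⟩ := V.exists_localUnit_smul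
  refine ⟨N, fun v => ⟨fun i => algebraMap k (RepetitiveAlgebraUnit k Λ) (b.repr v i) •
    ⟨_, inr_mem_cornerIdeal N⟩, ?_⟩⟩
  rw [cornerLift_apply]
  conv_rhs => rw [← b.sum_repr v]
  refine Finset.sum_congr rfl fun i _ => ?_
  change (algebraMap k (RepetitiveAlgebraUnit k Λ) (b.repr v i) *
    Unitization.inr (localUnit N)) • b i = _
  rw [mul_smul, hN N le_rfl]
  rfl

end CornerModule

/-! ### `Ext¹` from a projective presentation -/

section ExtOfProjective

variable {C : Type*} [Category C] [Abelian C] [HasExt.{w} C] {k : Type*} [CommRing k] [Linear k C]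

open Abelian

/-- `Ext¹` computed from a projective cover: the quotient of `Hom(K, Y)` by the homomorphisms that
extend to the projective object. -/
theorem nonempty_ext_linearEquiv {S : ShortComplex C} (hS : S.ShortExact) [Projective S.X₂] (Y : C)
    {Q : Type*} [AddCommGroup Q] [Module k Q] (q : (S.X₁ ⟶ Y) →ₗ[k] Q)
    (hq : Function.Surjective q) (hker : ∀ f, q f = 0 ↔ ∃ g : S.X₂ ⟶ Y, S.f ≫ g = f) :
    Nonempty (Ext S.X₃ Y 1 ≃ₗ[k] Q) := by
  -- The connecting homomorphism: it is onto because `Ext¹` of the projective middle term vanishes,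
  -- and its kernel consists of the maps that extend to the middle term.
  let p : (S.X₁ ⟶ Y) →ₗ[k] Ext S.X₃ Y 1 :=
    hS.extClass.precompOfLinear k Y (add_zero 1) ∘ₗ (Ext.linearEquiv₀ (R := k)).symm.toLinearMap
  have hp : ∀ f, p f = hS.extClass.comp (Ext.mk₀ f) (add_zero 1) := fun f => rfl
  have hps : Function.Surjective p := fun x => by
    obtain ⟨y, rfl⟩ := Ext.contravariant_sequence_exact₃ hS Y x (Ext.eq_zero_of_projective _)
      (add_zero 1)
    obtain ⟨f, rfl⟩ := (Ext.linearEquiv₀ (R := k)).symm.surjective y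
    exact ⟨f, rfl⟩
  have hpk : LinearMap.ker p = LinearMap.ker q := by
    ext f
    rw [LinearMap.mem_ker, LinearMap.mem_ker, hker, hp]
    constructor
    · intro h
      obtain ⟨y, hy⟩ := Ext.contravariant_sequence_exact₁ hS Y _ (add_zero 1) h
      obtain ⟨g, rfl⟩ := (Ext.linearEquiv₀ (R := k)).symm.surjective y
      refine ⟨g, (Ext.linearEquiv₀ (R := k)).symm.injective ?_⟩
      exact (Ext.mk₀_comp_mk₀ S.f g).symm.trans hy
    · rintro ⟨g, rfl⟩
      rw [← Ext.mk₀_comp_mk₀, hS.extClass_comp_assoc]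
  exact ⟨(p.quotKerEquivOfSurjective hps).symm.trans
    ((Submodule.quotEquivOfEq _ _ hpk).trans (q.quotKerEquivOfSurjective hq))⟩

end ExtOfProjective

/-! ### `Ext¹` in `Λ̂`-mod as first cohomology -/

section ExtRepMod

open scoped ModuleCat

variable {k Λ : Type u} [Field k] [Ring Λ] [Algebra k Λ]

open RepetitiveAlgebra

/-- A `k`-linear map which commutes with the action of the repetitive algebra is linear. -/
noncomputable def linearMapOfAction {M M' : ModuleCat.{u} (RepetitiveAlgebraUnit k Λ)} (f : M →ₗ[k] M')
    (hf : ∀ (x : RepetitiveAlgebra k Λ) v, f ((Unitization.inr x : RepetitiveAlgebraUnit k Λ) • v) =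
      (Unitization.inr x : RepetitiveAlgebraUnit k Λ) • f v) :
    M →ₗ[RepetitiveAlgebraUnit k Λ] M' where
  toFun := f
  map_add' := map_add f
  map_smul' a v := by
    induction a using Unitization.ind with
    | inl_add_inr c x =>
      rw [add_smul, map_add, hf, RingHom.id_apply, add_smul]
      congr 1
      exact map_smul f c v

/-- The kernel of a homomorphism in `Λ̂`-mod. -/
noncomputable def RepMod.kernelShortComplex {X Y : RepMod k Λ} (π : X ⟶ Y) :
    ShortComplex (RepMod k Λ) where
  X₁ := ⟨ModuleCat.of _ (LinearMap.ker π.hom.hom),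
    isRepMod_of_injective (ModuleCat.ofHom (Submodule.subtype _)) Subtype.val_injective X.property⟩
  X₂ := X
  X₃ := Y
  f := ObjectProperty.homMk (ModuleCat.ofHom (Submodule.subtype _))
  g := π
  zero := ObjectProperty.hom_ext _ (ModuleCat.hom_ext (LinearMap.ext fun x => x.2))

theorem RepMod.shortExact_kernelShortComplex {X Y : RepMod k Λ} (π : X ⟶ Y)
    (hπ : Function.Surjective π.hom.hom) : (RepMod.kernelShortComplex π).ShortExact := by
  have hmono : ∀ {Z : RepMod k Λ} (g h : Z ⟶ (RepMod.kernelShortComplex π).X₁),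
      g ≫ (RepMod.kernelShortComplex π).f = h ≫ (RepMod.kernelShortComplex π).f → g = h :=
    fun g h e => ObjectProperty.hom_ext _ (ModuleCat.hom_ext (LinearMap.ext fun z =>
      Subtype.ext (congrArg (fun g : _ ⟶ X => g.hom.hom z) e)))
  have : Mono (RepMod.kernelShortComplex π).f := ⟨hmono⟩
  have : Epi (RepMod.kernelShortComplex π).g := RepMod.epi_of_surjective π hπ
  refine .mk' (ShortComplex.exact_of_f_is_kernel _ (Limits.KernelFork.IsLimit.ofι _ _
    (fun {Z} g hg => ObjectProperty.homMk (ModuleCat.ofHom (g.hom.hom.codRestrict _ fun z =>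
      congrArg (fun g : Z ⟶ Y => g.hom.hom z) hg))) (fun {Z} g hg => rfl)
    (fun {Z} g hg m hm => hmono _ _ hm))) inferInstance inferInstance

section Cocycles

variable {V : RepMod k Λ} {n : Type} [Fintype n] [DecidableEq n] (b : Module.Basis n k V.obj)

/-- A derivation with values in the endomorphisms of `V`, in matrix form. -/
noncomputable def repCocycleOfEnd (d : RepetitiveAlgebra k Λ →ₗ[k] Module.End k V.obj)
    (hd : ∀ x y v, d (x * y) v = (Unitization.inr x : RepetitiveAlgebraUnit k Λ) • d y v +
      d x ((Unitization.inr y : RepetitiveAlgebraUnit k Λ) • v)) : repCocycle (repMatrix b) k :=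
  ⟨(LinearMap.toMatrix b b).toLinearMap ∘ₗ d, fun x y => by
    refine (Matrix.toLin b b).injective (LinearMap.ext fun v => ?_)
    have h : ∀ x, Matrix.toLin b b (((LinearMap.toMatrix b b).toLinearMap ∘ₗ d) x) = d x :=
      fun x => Matrix.toLin_toMatrix b b (d x)
    rw [matrixLeftMul_eq_mul, matrixRightMul_eq_mul, map_add, Matrix.toLin_mul b b b,
      Matrix.toLin_mul b b b, LinearMap.add_apply, LinearMap.comp_apply (Matrix.toLin b b _),
      LinearMap.comp_apply (Matrix.toLin b b _), toLin_repMatrix_apply, toLin_repMatrix_apply,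
      h, h, h]
    exact hd x y v⟩

theorem toLin_repCocycleOfEnd (d : RepetitiveAlgebra k Λ →ₗ[k] Module.End k V.obj)
    (hd : ∀ x y v, d (x * y) v = (Unitization.inr x : RepetitiveAlgebraUnit k Λ) • d y v +
      d x ((Unitization.inr y : RepetitiveAlgebraUnit k Λ) • v)) (x : RepetitiveAlgebra k Λ) :
    Matrix.toLin b b ((repCocycleOfEnd b d hd).1 x) = d x :=
  Matrix.toLin_toMatrix b b (d x)

theorem toLin_repCocycle_mul (d : repCocycle (repMatrix b) k) (x y : RepetitiveAlgebra k Λ)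
    (v : V.obj) : Matrix.toLin b b (d.1 (x * y)) v =
      (Unitization.inr x : RepetitiveAlgebraUnit k Λ) • Matrix.toLin b b (d.1 y) v +
      Matrix.toLin b b (d.1 x) ((Unitization.inr y : RepetitiveAlgebraUnit k Λ) • v) := by
  rw [repCocycle_map_mul, matrixLeftMul_eq_mul, matrixRightMul_eq_mul, map_add,
    Matrix.toLin_mul b b b, Matrix.toLin_mul b b b, LinearMap.add_apply, LinearMap.comp_apply,
    LinearMap.comp_apply, toLin_repMatrix_apply, toLin_repMatrix_apply]

theorem exists_repCoboundary_eq_iff (d : repCocycle (repMatrix b) k) :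
    (∃ X, repCoboundary (repMatrix b) k X = d) ↔ ∃ X : V.obj →ₗ[k] V.obj, ∀ x v,
      Matrix.toLin b b (d.1 x) v = X ((Unitization.inr x : RepetitiveAlgebraUnit k Λ) • v) -
        (Unitization.inr x : RepetitiveAlgebraUnit k Λ) • X v := by
  have key : ∀ (X : Matrix n n k) x v, Matrix.toLin b b ((repCoboundary (repMatrix b) k X).1 x) v =
      Matrix.toLin b b X ((Unitization.inr x : RepetitiveAlgebraUnit k Λ) • v) -
        (Unitization.inr x : RepetitiveAlgebraUnit k Λ) • Matrix.toLin b b X v := fun X x v => by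
    rw [repCoboundary_apply, matrixLeftMul_eq_mul, matrixRightMul_eq_mul, map_sub,
      Matrix.toLin_mul b b b, Matrix.toLin_mul b b b, LinearMap.sub_apply, LinearMap.comp_apply,
      LinearMap.comp_apply, toLin_repMatrix_apply, toLin_repMatrix_apply]
  constructor
  · rintro ⟨X, rfl⟩
    exact ⟨Matrix.toLin b b X, key X⟩
  · rintro ⟨X, hX⟩
    refine ⟨LinearMap.toMatrix b b X, Subtype.ext (LinearMap.ext fun x =>
      (Matrix.toLin b b).injective (LinearMap.ext fun v => ?_))⟩
    rw [key, hX, Matrix.toLin_toMatrix]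

variable {F : RepMod k Λ} (π : F ⟶ V) (s : V.obj →ₗ[k] F.obj) (hs : ∀ v, π.hom.hom (s v) = v)

/-- The failure of a `k`-linear section to commute with the action. -/
noncomputable def sectionDefect (x : RepetitiveAlgebra k Λ) (v : V.obj) : LinearMap.ker π.hom.hom :=
  ⟨(Unitization.inr x : RepetitiveAlgebraUnit k Λ) • s v -
    s ((Unitization.inr x : RepetitiveAlgebraUnit k Λ) • v), by
    rw [LinearMap.mem_ker, map_sub, map_smul, hs, hs, sub_self]⟩

theorem sectionDefect_add_left (x y : RepetitiveAlgebra k Λ) (v : V.obj) :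
    sectionDefect π s hs (x + y) v = sectionDefect π s hs x v + sectionDefect π s hs y v := by
  refine Subtype.ext ?_
  simp only [sectionDefect, Unitization.inr_add, add_smul, map_add, Submodule.coe_add]
  abel

theorem sectionDefect_smul_left (c : k) (x : RepetitiveAlgebra k Λ) (v : V.obj) :
    sectionDefect π s hs (c • x) v =
      algebraMap k (RepetitiveAlgebraUnit k Λ) c • sectionDefect π s hs x v := by
  refine Subtype.ext ?_
  have h : ∀ w : V.obj, s (algebraMap k (RepetitiveAlgebraUnit k Λ) c • w) =
    algebraMap k (RepetitiveAlgebraUnit k Λ) c • s w := fun w => map_smul s c w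
  simp only [sectionDefect, Unitization.inr_smul, Algebra.smul_def, mul_smul, smul_sub, h,
    Submodule.coe_smul]

theorem sectionDefect_add_right (x : RepetitiveAlgebra k Λ) (v w : V.obj) :
    sectionDefect π s hs x (v + w) = sectionDefect π s hs x v + sectionDefect π s hs x w := by
  refine Subtype.ext ?_
  simp only [sectionDefect, smul_add, map_add, Submodule.coe_add]
  abel

theorem sectionDefect_smul_right (c : k) (x : RepetitiveAlgebra k Λ) (v : V.obj) :
    sectionDefect π s hs x (c • v) =
      algebraMap k (RepetitiveAlgebraUnit k Λ) c • sectionDefect π s hs x v := by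
  refine Subtype.ext ?_
  change (Unitization.inr x : RepetitiveAlgebraUnit k Λ) • s (c • v) -
    s ((Unitization.inr x : RepetitiveAlgebraUnit k Λ) • c • v) =
      c • ((Unitization.inr x : RepetitiveAlgebraUnit k Λ) • s v -
        s ((Unitization.inr x : RepetitiveAlgebraUnit k Λ) • v))
  rw [map_smul, smul_comm _ c v, map_smul, smul_comm _ c (s v), smul_sub]

/-- The defect is the commutator of `x` with `s`, so it obeys the Leibniz rule; composition with a
homomorphism on the kernel yields a derivation. -/
theorem sectionDefect_mul (x y : RepetitiveAlgebra k Λ) (v : V.obj) :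
    sectionDefect π s hs (x * y) v =
      (Unitization.inr x : RepetitiveAlgebraUnit k Λ) • sectionDefect π s hs y v +
        sectionDefect π s hs x ((Unitization.inr y : RepetitiveAlgebraUnit k Λ) • v) := by
  refine Subtype.ext ?_
  simp only [sectionDefect, Unitization.inr_mul, mul_smul, Submodule.coe_add, Submodule.coe_smul,
    smul_sub]
  abel

/-- The derivation attached to a homomorphism on the kernel of `π`. -/
noncomputable def kernelDerivation (f : (RepMod.kernelShortComplex π).X₁ ⟶ V) :
    RepetitiveAlgebra k Λ →ₗ[k] Module.End k V.obj :=
  LinearMap.mk₂ k (fun x v => f.hom.hom (sectionDefect π s hs x v))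
    (fun x y v => by rw [sectionDefect_add_left]; exact map_add f.hom.hom _ _)
    (fun c x v => by rw [sectionDefect_smul_left]; exact map_smul f.hom.hom _ _)
    (fun x v w => by rw [sectionDefect_add_right]; exact map_add f.hom.hom _ _)
    (fun c x v => by rw [sectionDefect_smul_right]; exact map_smul f.hom.hom _ _)

theorem kernelDerivation_apply (f : (RepMod.kernelShortComplex π).X₁ ⟶ V)
    (x : RepetitiveAlgebra k Λ) (v : V.obj) :
    kernelDerivation π s hs f x v = f.hom.hom (sectionDefect π s hs x v) := rfl

theorem kernelDerivation_mul (f : (RepMod.kernelShortComplex π).X₁ ⟶ V)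
    (x y : RepetitiveAlgebra k Λ) (v : V.obj) :
    kernelDerivation π s hs f (x * y) v =
      (Unitization.inr x : RepetitiveAlgebraUnit k Λ) • kernelDerivation π s hs f y v +
      kernelDerivation π s hs f x ((Unitization.inr y : RepetitiveAlgebraUnit k Λ) • v) := by
  rw [kernelDerivation_apply, sectionDefect_mul]
  exact (map_add f.hom.hom _ _).trans (congrArg (· + _) (map_smul f.hom.hom _ _))

theorem kernelDerivation_add (f g : (RepMod.kernelShortComplex π).X₁ ⟶ V) :
    kernelDerivation π s hs (f + g) = kernelDerivation π s hs f + kernelDerivation π s hs g :=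
  LinearMap.ext fun _ => LinearMap.ext fun _ => rfl

theorem kernelDerivation_smul (c : k) (f : (RepMod.kernelShortComplex π).X₁ ⟶ V) :
    kernelDerivation π s hs (c • f) = c • kernelDerivation π s hs f :=
  LinearMap.ext fun _ => LinearMap.ext fun _ => rfl

/-- The derivation attached to a homomorphism on the kernel of `π`, in matrix form. -/
noncomputable def kernelCocycle : ((RepMod.kernelShortComplex π).X₁ ⟶ V) →ₗ[k]
    repCocycle (repMatrix b) k where
  toFun f := repCocycleOfEnd b (kernelDerivation π s hs f) (kernelDerivation_mul π s hs f)
  map_add' f g := by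
    refine Subtype.ext (LinearMap.ext fun x => ?_)
    refine (congrArg (fun d => LinearMap.toMatrix b b (d x)) (kernelDerivation_add π s hs f g)).trans ?_
    exact map_add (LinearMap.toMatrix b b) _ _
  map_smul' c f := by
    refine Subtype.ext (LinearMap.ext fun x => ?_)
    refine (congrArg (fun d => LinearMap.toMatrix b b (d x)) (kernelDerivation_smul π s hs c f)).trans ?_
    exact map_smul (LinearMap.toMatrix b b) _ _

theorem toLin_kernelCocycle (f : (RepMod.kernelShortComplex π).X₁ ⟶ V) (x : RepetitiveAlgebra k Λ)
    (v : V.obj) : Matrix.toLin b b ((kernelCocycle b π s hs f).1 x) v =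
      f.hom.hom (sectionDefect π s hs x v) :=
  LinearMap.congr_fun (toLin_repCocycleOfEnd b (kernelDerivation π s hs f)
    (kernelDerivation_mul π s hs f) x) v

theorem exists_repCoboundary_eq_kernelCocycle_iff (f : (RepMod.kernelShortComplex π).X₁ ⟶ V) :
    (∃ X, repCoboundary (repMatrix b) k X = kernelCocycle b π s hs f) ↔
      ∃ g : F ⟶ V, (RepMod.kernelShortComplex π).f ≫ g = f := by
  rw [exists_repCoboundary_eq_iff]
  simp only [toLin_kernelCocycle]
  constructor
  · rintro ⟨X, hX⟩
    let r₀ : F.obj → LinearMap.ker π.hom.hom := fun y => ⟨y - s (π.hom.hom y), by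
      rw [LinearMap.mem_ker, map_sub, hs, sub_self]⟩
    let r : F.obj →ₗ[k] (RepMod.kernelShortComplex π).X₁.obj :=
      { toFun := r₀
        map_add' := fun y z => Subtype.ext (by
          change y + z - s (π.hom.hom (y + z)) = y - s (π.hom.hom y) + (z - s (π.hom.hom z))
          rw [map_add, map_add]
          abel)
        map_smul' := fun c y => Subtype.ext (by
          change c • y - s (π.hom.hom (c • y)) = c • (y - s (π.hom.hom y))
          rw [show π.hom.hom (c • y) = c • π.hom.hom y from map_smul π.hom.hom _ y, map_smul,
            smul_sub]) }
    -- Here `r = 1 - sπ` projects onto the kernel. The failure of `f ∘ r` to be `Λ̂`-linear is `f`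
    -- applied to the section defect, and by `hX` the term `X ∘ π` compensates for it.
    let g : F.obj →ₗ[k] V.obj := f.hom.hom.restrictScalars k ∘ₗ r - X ∘ₗ π.hom.hom.restrictScalars k
    have hg : ∀ y, g y = f.hom.hom (r₀ y) - X (π.hom.hom y) := fun y => rfl
    refine ⟨ObjectProperty.homMk (ModuleCat.ofHom (linearMapOfAction g fun x y => ?_)),
      ObjectProperty.hom_ext _ (ModuleCat.hom_ext (LinearMap.ext fun z => ?_))⟩
    · have h : r₀ ((Unitization.inr x : RepetitiveAlgebraUnit k Λ) • y) =
          (Unitization.inr x : RepetitiveAlgebraUnit k Λ) • r₀ y +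
            sectionDefect π s hs x (π.hom.hom y) := Subtype.ext (by
        change _ - s _ = (Unitization.inr x : RepetitiveAlgebraUnit k Λ) • (y - s (π.hom.hom y)) +
          ((Unitization.inr x : RepetitiveAlgebraUnit k Λ) • s (π.hom.hom y) - s _)
        rw [map_smul, smul_sub]
        abel)
      rw [hg, hg, h, smul_sub, map_smul]
      have h' : f.hom.hom ((Unitization.inr x : RepetitiveAlgebraUnit k Λ) • r₀ y +
          sectionDefect π s hs x (π.hom.hom y)) =
          (Unitization.inr x : RepetitiveAlgebraUnit k Λ) • f.hom.hom (r₀ y) +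
            f.hom.hom (sectionDefect π s hs x (π.hom.hom y)) :=
        (map_add f.hom.hom _ _).trans (congrArg (· + _) (map_smul f.hom.hom _ _))
      rw [h', hX]
      abel
    · change g z.1 = f.hom.hom z
      have hz : π.hom.hom z.1 = 0 := z.2
      rw [hg, hz, map_zero, sub_zero]
      congr 1
      refine Subtype.ext ?_
      change z.1 - s (π.hom.hom z.1) = z.1
      rw [hz, map_zero, sub_zero]
  · rintro ⟨g, rfl⟩
    refine ⟨-(g.hom.hom.restrictScalars k ∘ₗ s), fun x v => ?_⟩
    change g.hom.hom ((Unitization.inr x : RepetitiveAlgebraUnit k Λ) • s v -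
      s ((Unitization.inr x : RepetitiveAlgebraUnit k Λ) • v)) =
        -g.hom.hom (s ((Unitization.inr x : RepetitiveAlgebraUnit k Λ) • v)) -
          (Unitization.inr x : RepetitiveAlgebraUnit k Λ) • -g.hom.hom (s v)
    rw [map_sub, map_smul, smul_neg]
    abel

end Cocycles

/-- Every derivation `D` becomes inner after pullback to `(Λ̂ e) ^ n`, through `h(y) = ∑ D(y_i)
b_i`. Restricting `h` to the kernel gives `f`, and composing it with the section `s` gives the inner
correction `X`. -/
theorem exists_kernelCocycle_add_repCoboundary [FiniteDimensional k Λ] {V : RepMod k Λ} {n : Type}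
    [Fintype n] [DecidableEq n] (b : Module.Basis n k V.obj) {N : ℕ}
    (π : RepMod.corner k Λ n N ⟶ V) (hπ : π.hom.hom = cornerLift N b) (s : V.obj →ₗ[k] _)
    (hs : ∀ v, π.hom.hom (s v) = v) (d : repCocycle (repMatrix b) k) :
    ∃ f X, kernelCocycle b π s hs f + repCoboundary (repMatrix b) k X = d := by
  let D : RepetitiveAlgebra k Λ →ₗ[k] Module.End k V.obj := (Matrix.toLin b b).toLinearMap ∘ₗ d.1
  have hD : ∀ x y v, D (x * y) v = (Unitization.inr x : RepetitiveAlgebraUnit k Λ) • D y v +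
      D x ((Unitization.inr y : RepetitiveAlgebraUnit k Λ) • v) := toLin_repCocycle_mul b d
  let h : (RepMod.corner k Λ n N).obj →ₗ[k] V.obj :=
    { toFun := fun y : n → cornerIdeal k Λ N => ∑ i, D (y i).1.snd (b i)
      map_add' := fun y z => by
        rw [← Finset.sum_add_distrib]
        refine Finset.sum_congr rfl fun i _ => ?_
        rw [← LinearMap.add_apply, ← map_add]
        rfl
      map_smul' := fun c y => by
        refine Eq.trans ?_ (Finset.smul_sum (r := c)
          (f := fun i => D ((y : n → cornerIdeal k Λ N) i).1.snd (b i))).symm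
        refine Finset.sum_congr rfl fun i _ => ?_
        rw [← LinearMap.smul_apply, ← map_smul, ← Unitization.snd_smul, Algebra.smul_def]
        rfl }
  -- The Leibniz rule for `D`, summed over the basis. The last term vanishes on the kernel of `π`,
  -- where `h` is therefore `Λ̂`-linear.
  have hh : ∀ x y, h ((Unitization.inr x : RepetitiveAlgebraUnit k Λ) • y) =
      (Unitization.inr x : RepetitiveAlgebraUnit k Λ) • h y + D x (π.hom.hom y) := fun x y => by
    have h₁ : h y = ∑ i, D ((y : n → cornerIdeal k Λ N) i).1.snd (b i) := rfl
    have h₂ : π.hom.hom y = ∑ i, ((y : n → cornerIdeal k Λ N) i).1 • b i := by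
      rw [hπ]
      rfl
    rw [h₁, h₂, Finset.smul_sum, map_sum, ← Finset.sum_add_distrib]
    refine Finset.sum_congr rfl fun i _ => ?_
    change D ((Unitization.inr x : RepetitiveAlgebraUnit k Λ) *
      ((y : n → cornerIdeal k Λ N) i).1).snd (b i) = _
    have h₃ := inr_snd_of_mem_cornerIdeal ((y : n → cornerIdeal k Λ N) i).2
    generalize ((y : n → cornerIdeal k Λ N) i).1 = z at h₃ ⊢
    rw [← h₃, ← Unitization.inr_mul, Unitization.snd_inr, Unitization.snd_inr, hD]
  let f : (RepMod.kernelShortComplex π).X₁.obj →ₗ[k] V.obj :=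
    h ∘ₗ (RepMod.kernelShortComplex π).f.hom.hom.restrictScalars k
  have hf : ∀ z, f z = h z.1 := fun z => rfl
  refine ⟨ObjectProperty.homMk (ModuleCat.ofHom (linearMapOfAction f fun x z => ?_)),
    LinearMap.toMatrix b b (h ∘ₗ s), Subtype.ext (LinearMap.ext fun x =>
      (Matrix.toLin b b).injective (LinearMap.ext fun v => ?_))⟩
  · refine (hh x z.1).trans ?_
    rw [show π.hom.hom z.1 = 0 from z.2, map_zero, add_zero]
    rfl
  · rw [Submodule.coe_add, LinearMap.add_apply, map_add, LinearMap.add_apply, toLin_kernelCocycle,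
      repCoboundary_apply, matrixLeftMul_eq_mul, matrixRightMul_eq_mul, map_sub,
      Matrix.toLin_mul b b b, Matrix.toLin_mul b b b, LinearMap.sub_apply, LinearMap.comp_apply,
      LinearMap.comp_apply, toLin_repMatrix_apply, toLin_repMatrix_apply, Matrix.toLin_toMatrix]
    change h ((Unitization.inr x : RepetitiveAlgebraUnit k Λ) • s v - s _) +
      (h (s _) - (Unitization.inr x : RepetitiveAlgebraUnit k Λ) • h (s v)) = D x v
    rw [map_sub, hh, hs]
    abel

theorem nonempty_ext_linearEquiv_repH1 [FiniteDimensional k Λ] {V : RepMod k Λ} {n : Type}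
    [Fintype n] [DecidableEq n] (b : Module.Basis n k V.obj) :
    Nonempty (Abelian.Ext V V 1 ≃ₗ[k] RepH1 (repMatrix b) k) := by
  obtain ⟨N, hN⟩ := RepMod.exists_surjective_cornerLift b
  let π : RepMod.corner k Λ n N ⟶ V := ObjectProperty.homMk (ModuleCat.ofHom (cornerLift N b))
  obtain ⟨s, hs⟩ := (π.hom.hom.restrictScalars k).exists_rightInverse_of_surjective
    (LinearMap.range_eq_top.2 hN)
  have hs' : ∀ v, π.hom.hom (s v) = v := fun v => LinearMap.congr_fun hs v
  have : Projective (RepMod.kernelShortComplex π).X₂ := RepMod.projective_corner N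
  refine nonempty_ext_linearEquiv (RepMod.shortExact_kernelShortComplex π hN) V
    ((LinearMap.range (repCoboundary (repMatrix b) k)).mkQ ∘ₗ kernelCocycle b π s hs')
    (fun z => ?_) fun f => ?_
  · induction z using Submodule.Quotient.induction_on with | H d
    obtain ⟨f, X, hf⟩ := exists_kernelCocycle_add_repCoboundary b π rfl s hs' d
    refine ⟨f, (Submodule.Quotient.eq _).2 ⟨-X, ?_⟩⟩
    rw [← hf, map_neg]
    abel
  · rw [LinearMap.comp_apply, Submodule.mkQ_apply, Submodule.Quotient.mk_eq_zero]
    exact exists_repCoboundary_eq_kernelCocycle_iff b π s hs' f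

end ExtRepMod

/-! ### The trace form and the Casimir operator -/

section Casimir

variable {k Λ : Type u} [Field k] [Ring Λ] [Algebra k Λ]

namespace RepetitiveAlgebra

/-- The element of the repetitive algebra with entry `a ∈ Λ` in degree `j`. -/
noncomputable def inl (j : ℤ) : Λ →ₗ[k] RepetitiveAlgebra k Λ where
  toFun a := (Finsupp.single j a, 0)
  map_add' a b := Prod.ext (Finsupp.single_add j a b) (add_zero 0).symm
  map_smul' c a := Prod.ext (Finsupp.smul_single c j a).symm (smul_zero c).symm

/-- The element of the repetitive algebra with entry `φ ∈ DΛ` in degree `j`. -/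
noncomputable def inr (j : ℤ) : Module.Dual k Λ →ₗ[k] RepetitiveAlgebra k Λ where
  toFun φ := (0, Finsupp.single j φ)
  map_add' φ ψ := Prod.ext (add_zero 0).symm (Finsupp.single_add j φ ψ)
  map_smul' c φ := Prod.ext (smul_zero c).symm (Finsupp.smul_single c j φ).symm

theorem inl_fst (j : ℤ) (a : Λ) : (inl j a : RepetitiveAlgebra k Λ).1 = Finsupp.single j a := rfl

theorem inl_snd (j : ℤ) (a : Λ) : (inl j a : RepetitiveAlgebra k Λ).2 = 0 := rfl

theorem inr_fst (j : ℤ) (φ : Module.Dual k Λ) : (inr j φ : RepetitiveAlgebra k Λ).1 = 0 := rfl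

theorem inr_snd (j : ℤ) (φ : Module.Dual k Λ) :
    (inr j φ : RepetitiveAlgebra k Λ).2 = Finsupp.single j φ := rfl

theorem inl_mul_inl (i j : ℤ) (a b : Λ) :
    (inl i a * inl j b : RepetitiveAlgebra k Λ) = if i = j then inl j (a * b) else 0 := by
  split_ifs with h
  · subst h
    ext l z
    · by_cases hl : i = l <;> simp [inl_fst, hl]
    · simp [inl_snd]
  · ext l z
    · rw [mul_fst_apply, inl_fst, inl_fst, Finsupp.single_apply, Finsupp.single_apply]
      split_ifs <;> simp_all
    · simp [inl_snd]

theorem inl_mul_inr (i j : ℤ) (a : Λ) (φ : Module.Dual k Λ) :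
    (inl i a * inr j φ : RepetitiveAlgebra k Λ) = if i = j + 1 then inr j (dualLeft a φ) else 0 := by
  split_ifs with h
  · subst h
    ext l z
    · simp [inr_fst]
    · by_cases hl : j = l <;> simp [inl_fst, inl_snd, inr_fst, inr_snd, hl]
  · ext l z
    · simp [inr_fst]
    · rw [mul_snd_apply, inl_fst, inl_snd, inr_fst, inr_snd, Finsupp.single_apply,
        Finsupp.single_apply]
      by_cases hl : j = l
      · subst hl
        simp [h]
      · simp [hl]

theorem inr_mul_inl (i j : ℤ) (φ : Module.Dual k Λ) (b : Λ) :
    (inr i φ * inl j b : RepetitiveAlgebra k Λ) = if i = j then inr j (dualRight φ b) else 0 := by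
  split_ifs with h
  · subst h
    ext l z
    · simp [inr_fst]
    · by_cases hl : i = l <;> simp [inl_fst, inl_snd, inr_fst, inr_snd, hl]
  · ext l z
    · simp [inr_fst]
    · rw [mul_snd_apply, inl_fst, inl_snd, inr_fst, inr_snd, Finsupp.single_apply,
        Finsupp.single_apply]
      by_cases hl : i = l
      · subst hl
        simp [Ne.symm h]
      · simp [hl]

theorem inr_mul_inr (i j : ℤ) (φ ψ : Module.Dual k Λ) :
    (inr i φ * inr j ψ : RepetitiveAlgebra k Λ) = 0 := by
  ext l z <;> simp [inr_fst]

theorem induction_inl_inr {p : RepetitiveAlgebra k Λ → Prop} (x : RepetitiveAlgebra k Λ)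
    (add : ∀ x y, p x → p y → p (x + y)) (inl : ∀ j a, p (inl j a)) (inr : ∀ j φ, p (inr j φ)) :
    p x := by
  obtain ⟨f, g⟩ := x
  have h₀ : p 0 := by simpa using inl 0 0
  have h₁ : p ((f, 0) : RepetitiveAlgebra k Λ) := by
    induction f using Finsupp.induction_linear with
    | zero => exact h₀
    | add f f' hf hf' =>
      have : ((f + f', 0) : RepetitiveAlgebra k Λ) = (f, 0) + (f', 0) :=
        Prod.ext rfl (add_zero 0).symm
      rw [this]
      exact add _ _ hf hf'
    | single j a => exact inl j a
  have h₂ : p ((0, g) : RepetitiveAlgebra k Λ) := by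
    induction g using Finsupp.induction_linear with
    | zero => exact h₀
    | add f f' hf hf' =>
      have : ((0, f + f') : RepetitiveAlgebra k Λ) = (0, f) + (0, f') :=
        Prod.ext (add_zero 0).symm rfl
      rw [this]
      exact add _ _ hf hf'
    | single j φ => exact inr j φ
  have : ((f, g) : RepetitiveAlgebra k Λ) = (f, 0) + (0, g) :=
    Prod.ext (add_zero f).symm (zero_add g).symm
  rw [this]
  exact add _ _ h₁ h₂

theorem sum_fst_apply {ι : Type*} (J : Finset ι) (f : ι → RepetitiveAlgebra k Λ) (i : ℤ) :
    (∑ j ∈ J, f j).1 i = ∑ j ∈ J, (f j).1 i :=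
  map_sum (⟨⟨fun x => x.1 i, rfl⟩, fun _ _ => rfl⟩ : RepetitiveAlgebra k Λ →+ Λ) f J

theorem sum_snd_apply {ι : Type*} (J : Finset ι) (f : ι → RepetitiveAlgebra k Λ) (i : ℤ) :
    (∑ j ∈ J, f j).2 i = ∑ j ∈ J, (f j).2 i :=
  map_sum (⟨⟨fun x => x.2 i, rfl⟩, fun _ _ => rfl⟩ :
    RepetitiveAlgebra k Λ →+ Module.Dual k Λ) f J

theorem sum_inl_add_inr (J : Finset ℤ) {z : RepetitiveAlgebra k Λ} (h₁ : ∀ i ∉ J, z.1 i = 0)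
    (h₂ : ∀ i ∉ J, z.2 i = 0) : ∑ j ∈ J, (inl j (z.1 j) + inr j (z.2 j)) = z := by
  ext i w
  · simp only [sum_fst_apply, add_fst_apply, inl_fst, inr_fst, Finsupp.zero_apply, add_zero,
      Finsupp.single_apply]
    rw [Finset.sum_ite_eq']
    split_ifs with hi
    · rfl
    · exact (h₁ i hi).symm
  · simp only [sum_snd_apply, add_snd_apply, inl_snd, inr_snd, Finsupp.zero_apply, zero_add,
      Finsupp.single_apply]
    rw [Finset.sum_ite_eq']
    split_ifs with hi
    · rfl
    · rw [h₂ i hi]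

/-- The linear form `(a, φ) ↦ ∑ φ_j(1)`. -/
noncomputable def trace : RepetitiveAlgebra k Λ →ₗ[k] k :=
  (Finsupp.lsum k fun _ => LinearMap.applyₗ (1 : Λ)) ∘ₗ
    LinearMap.snd k (ℤ →₀ Λ) (ℤ →₀ Module.Dual k Λ)

theorem trace_inl (j : ℤ) (a : Λ) : trace (inl j a : RepetitiveAlgebra k Λ) = 0 :=
  map_zero (Finsupp.lsum k fun _ : ℤ => LinearMap.applyₗ (R := k) (M₂ := k) (1 : Λ))

theorem trace_inr (j : ℤ) (φ : Module.Dual k Λ) : trace (inr j φ) = φ 1 := by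
  refine (Finsupp.lsum_single k _ j φ).trans ?_
  rfl

/-- Together with `trace_inl_mul` this exhibits dual bases: `inr j (c.coord a)` is dual to `inl j (c
a)`, while `inl (j + 1) (c a)` is dual to `inr j (c.coord a)`. The shift by one explains the shape
of `casimir`. -/
theorem trace_inr_mul (j : ℤ) (φ : Module.Dual k Λ) (z : RepetitiveAlgebra k Λ) :
    trace (inr j φ * z) = φ (z.1 j) := by
  induction z using induction_inl_inr with
  | add x y hx hy => rw [mul_add, map_add, hx, hy, add_fst_apply, map_add]
  | inl i a =>
    rw [inr_mul_inl, inl_fst, Finsupp.single_apply]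
    by_cases h : j = i
    · simp [h, trace_inr]
    · simp [h, Ne.symm h]
  | inr i ψ => simp [inr_mul_inr, inr_fst]

theorem trace_inl_mul (j : ℤ) (a : Λ) (z : RepetitiveAlgebra k Λ) :
    trace (inl (j + 1) a * z) = z.2 j a := by
  induction z using induction_inl_inr with
  | add x y hx hy => rw [mul_add, map_add, hx, hy, add_snd_apply, LinearMap.add_apply]
  | inl i b =>
    rw [inl_mul_inl]
    split_ifs
    · rw [trace_inl]
      rfl
    · rw [map_zero]
      rfl
  | inr i ψ =>
    rw [inl_mul_inr, inr_snd, Finsupp.single_apply]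
    by_cases h : j = i
    · simp [h, trace_inr]
    · simp [h, Ne.symm h]

section DualBasis

variable {ι : Type*} [Fintype ι] (c : Module.Basis ι k Λ) {S : Type*} [AddCommGroup S] [Module k S]

theorem sum_apply_smul_coord (φ : Module.Dual k Λ) : ∑ a, φ (c a) • c.coord a = φ :=
  c.ext fun a => by simp

/-- The canonical element `∑ c_a ⊗ c_a*` of `Λ ⊗ DΛ` is invariant: an endomorphism of `Λ` moves from
the first factor to its transpose on the second. -/
theorem sum_apply_basis_coord (B : Λ →ₗ[k] Module.Dual k Λ →ₗ[k] S) (h : Λ →ₗ[k] Λ) :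
    ∑ a, B (h (c a)) (c.coord a) = ∑ a, B (c a) (c.coord a ∘ₗ h) := by
  have h₁ : ∀ a, B (h (c a)) (c.coord a) = ∑ d, c.coord d (h (c a)) • B (c d) (c.coord a) := by
    intro a
    conv_lhs => rw [← c.sum_repr (h (c a))]
    rw [map_sum, LinearMap.sum_apply]
    simp only [map_smul, LinearMap.smul_apply]
    rfl
  have h₂ : ∀ d, B (c d) (c.coord d ∘ₗ h) = ∑ a, c.coord d (h (c a)) • B (c d) (c.coord a) := by
    intro d
    conv_lhs => rw [← sum_apply_smul_coord c (c.coord d ∘ₗ h)]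
    simp [map_sum]
  simp only [h₁, h₂]
  exact Finset.sum_comm

/-- Both sides are `B` evaluated on `∑ ψ(c_a c_d) c_d* ⊗ c_a*`. -/
theorem sum_apply_dualRight_coord (B : Module.Dual k Λ →ₗ[k] Module.Dual k Λ →ₗ[k] S)
    (ψ : Module.Dual k Λ) :
    ∑ a, B (dualRight ψ (c a)) (c.coord a) = ∑ a, B (c.coord a) (dualLeft (c a) ψ) := by
  have h₁ : ∀ a, B (dualRight ψ (c a)) (c.coord a) =
      ∑ d, ψ (c a * c d) • B (c.coord d) (c.coord a) := by
    intro a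
    conv_lhs => rw [← sum_apply_smul_coord c (dualRight ψ (c a))]
    simp [map_sum, LinearMap.sum_apply]
  have h₂ : ∀ d, B (c.coord d) (dualLeft (c d) ψ) =
      ∑ a, ψ (c a * c d) • B (c.coord d) (c.coord a) := by
    intro d
    conv_lhs => rw [← sum_apply_smul_coord c (dualLeft (c d) ψ)]
    simp [map_sum]
  simp only [h₁, h₂]
  exact Finset.sum_comm

end DualBasis

variable {ι : Type*} [Fintype ι] (c : Module.Basis ι k Λ) (J : Finset ℤ) {S : Type*} [Ring S]
  [Algebra k S]

/-- The Casimir operator of the repetitive algebra, truncated to the degrees in `J`. -/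
noncomputable def casimir (ρ : RepetitiveAlgebra k Λ →ₙₐ[k] S) (T : S) : S :=
  ∑ j ∈ J, ∑ a, (ρ (inl j (c a)) * T * ρ (inr j (c.coord a)) +
    ρ (inr j (c.coord a)) * T * ρ (inl (j + 1) (c a)))

/-- The bilinear map `(x, y) ↦ ρ(x) T ρ(y)`. -/
noncomputable def sandwich (ρ : RepetitiveAlgebra k Λ →ₙₐ[k] S) (T : S) :
    RepetitiveAlgebra k Λ →ₗ[k] RepetitiveAlgebra k Λ →ₗ[k] S :=
  LinearMap.mk₂ k (fun x y => ρ x * T * ρ y) (fun x x' y => by simp [add_mul])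
    (fun r x y => by simp) (fun x y y' => by simp [mul_add]) (fun r x y => by simp)

theorem sandwich_apply (ρ : RepetitiveAlgebra k Λ →ₙₐ[k] S) (T : S) (x y : RepetitiveAlgebra k Λ) :
    sandwich ρ T x y = ρ x * T * ρ y := rfl

/-- For generators `x` the identity holds degree by degree, so no condition on the truncation `J` is
needed. Entries from `Λ` use the invariance of the canonical element in each summand separately;
entries from `DΛ` match the first summand on the left with the second on the right. -/
theorem mul_casimir (ρ : RepetitiveAlgebra k Λ →ₙₐ[k] S) (T : S) (x : RepetitiveAlgebra k Λ) :
    ρ x * casimir c J ρ T = casimir c J ρ T * ρ x := by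
  have hl : ρ x * casimir c J ρ T = ∑ j ∈ J, (∑ a, sandwich ρ T (x * inl j (c a))
      (inr j (c.coord a)) + ∑ a, sandwich ρ T (x * inr j (c.coord a)) (inl (j + 1) (c a))) := by
    rw [casimir, Finset.mul_sum]
    refine Finset.sum_congr rfl fun j _ => ?_
    rw [Finset.mul_sum, ← Finset.sum_add_distrib]
    simp only [sandwich_apply, map_mul, mul_add, mul_assoc]
  have hr : casimir c J ρ T * ρ x = ∑ j ∈ J, (∑ a, sandwich ρ T (inl j (c a))
      (inr j (c.coord a) * x) + ∑ a, sandwich ρ T (inr j (c.coord a)) (inl (j + 1) (c a) * x)) := by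
    rw [casimir, Finset.sum_mul]
    refine Finset.sum_congr rfl fun j _ => ?_
    rw [Finset.sum_mul, ← Finset.sum_add_distrib]
    simp only [sandwich_apply, map_mul, add_mul, mul_assoc]
  rw [hl, hr]
  clear hl hr
  induction x using induction_inl_inr with
  | add x y hx hy =>
    simp only [add_mul, mul_add, map_add, LinearMap.add_apply, Finset.sum_add_distrib] at hx hy ⊢
    rw [add_add_add_comm, hx, hy, add_add_add_comm]
  | inl i b =>
    refine Finset.sum_congr rfl fun j _ => ?_
    congr 1
    · simp only [inl_mul_inl, inr_mul_inl]
      by_cases h : i = j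
      · subst h
        simp only [if_true]
        exact sum_apply_basis_coord c ((sandwich ρ T).compl₁₂ (inl i) (inr i)) (LinearMap.mulLeft k b)
      · simp [h, Ne.symm h]
    · simp only [inl_mul_inr, inl_mul_inl]
      by_cases h : i = j + 1
      · subst h
        simp only [if_true]
        exact (sum_apply_basis_coord c ((sandwich ρ T).compl₁₂ (inr j) (inl (j + 1))).flip
          (LinearMap.mulRight k b)).symm
      · simp [h, Ne.symm h]
  | inr i ψ =>
    refine Finset.sum_congr rfl fun j _ => ?_
    simp only [inr_mul_inr, map_zero, LinearMap.zero_apply, Finset.sum_const_zero, add_zero,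
      zero_add, inr_mul_inl, inl_mul_inr]
    by_cases h : i = j
    · subst h
      simp only [if_true]
      exact sum_apply_dualRight_coord c ((sandwich ρ T).compl₁₂ (inr i) (inr i)) ψ
    · simp [h, Ne.symm h]

theorem map_casimir {S' : Type*} [Ring S'] [Algebra k S'] (f : S →ₐ[k] S')
    (ρ : RepetitiveAlgebra k Λ →ₙₐ[k] S) (T : S) (ρ' : RepetitiveAlgebra k Λ →ₙₐ[k] S')
    (h : ∀ x, f (ρ x) = ρ' x) : f (casimir c J ρ T) = casimir c J ρ' (f T) := by
  simp only [casimir, map_sum, map_add, map_mul, h]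

/-- The expansion of `z` in the dual bases; the condition `z e = z` confines its degrees to `[-N,
N]`. -/
theorem sum_trace_smul {N : ℕ} {z : RepetitiveAlgebra k Λ} (hz : z * localUnit N = z) :
    ∑ j ∈ Finset.Icc (-(N : ℤ)) N, ∑ a, (trace (inr j (c.coord a) * z) • inl j (c a) +
      trace (inl (j + 1) (c a) * z) • inr j (c.coord a)) = z := by
  refine Eq.trans (Finset.sum_congr rfl fun j _ => ?_)
    (sum_inl_add_inr (Finset.Icc (-(N : ℤ)) N) (fun i hi => ?_) fun i hi => ?_)
  · simp only [trace_inr_mul, trace_inl_mul, Finset.sum_add_distrib, ← map_smul]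
    rw [← map_sum, ← map_sum, sum_apply_smul_coord]
    congr 2
    exact c.sum_repr _
  · rw [← hz, mul_fst_apply, localUnit_fst_apply_of_lt_natAbs, mul_zero]
    rw [Finset.mem_Icc] at hi
    omega
  · have h : (localUnit N : RepetitiveAlgebra k Λ).1 i = 0 := localUnit_fst_apply_of_lt_natAbs (by
      rw [Finset.mem_Icc] at hi
      omega)
    ext w
    rw [← hz]
    simp [h, localUnit_snd_apply]

end RepetitiveAlgebra

end Casimir

/-! ### Maps through projectives and lifting of endomorphisms -/

section StableEndomorphisms

open scoped ModuleCat

open RepetitiveAlgebra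

variable {k Λ : Type u} [Field k] [Ring Λ] [Algebra k Λ]

/-- The action of the repetitive algebra on a module by `k`-linear endomorphisms. -/
noncomputable def RepMod.action (V : RepMod k Λ) :
    RepetitiveAlgebra k Λ →ₙₐ[k] Module.End k V.obj :=
  ((Algebra.lsmul k k V.obj : RepetitiveAlgebraUnit k Λ →ₐ[k] Module.End k V.obj) :
    RepetitiveAlgebraUnit k Λ →ₙₐ[k] Module.End k V.obj).comp
    (Unitization.inrNonUnitalAlgHom k (RepetitiveAlgebra k Λ))

theorem RepMod.casimir_action_apply (V : RepMod k Λ) {ι : Type*} [Fintype ι]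
    (c : Module.Basis ι k Λ) (J : Finset ℤ) (T : Module.End k V.obj) (v : V.obj) :
    casimir c J V.action T v = ∑ j ∈ J, ∑ a,
      ((Unitization.inr (inl j (c a)) : RepetitiveAlgebraUnit k Λ) •
          T ((Unitization.inr (inr j (c.coord a)) : RepetitiveAlgebraUnit k Λ) • v) +
        (Unitization.inr (inr j (c.coord a)) : RepetitiveAlgebraUnit k Λ) •
          T ((Unitization.inr (inl (j + 1) (c a)) : RepetitiveAlgebraUnit k Λ) • v)) := by
  simp only [casimir, LinearMap.sum_apply]
  rfl

/-- The identity of `(Λ̂ e) ^ n` is in the image of the Casimir operator. -/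
theorem RepMod.exists_casimir_corner_eq [FiniteDimensional k Λ] {n : Type} [Fintype n] {ι : Type*}
    [Fintype ι] (c : Module.Basis ι k Λ) (N : ℕ) :
    ∃ T, casimir c (Finset.Icc (-(N : ℤ)) N) (RepMod.corner k Λ n N).action T = 1 := by
  let ε : cornerIdeal k Λ N := ⟨_, inr_mem_cornerIdeal N⟩
  -- In each coordinate `T` is `y ↦ trace(y) e`. The Casimir operator turns it into `∑ trace(x_i' y)
  -- x_i e`, which is `y e = y` by the dual basis expansion.
  let T : Module.End k (RepMod.corner k Λ n N).obj :=
    { toFun := fun y : n → cornerIdeal k Λ N => fun t =>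
        algebraMap k (RepetitiveAlgebraUnit k Λ) (trace (y t).1.snd) • ε
      map_add' := fun y z => funext fun t => by
        refine Eq.trans ?_ (add_smul (algebraMap k (RepetitiveAlgebraUnit k Λ) _)
          (algebraMap k (RepetitiveAlgebraUnit k Λ) _) ε)
        rw [← map_add, ← map_add]
        rfl
      map_smul' := fun r y => funext fun t => by
        refine Eq.trans ?_ (smul_smul (algebraMap k (RepetitiveAlgebraUnit k Λ) r) _ ε).symm
        rw [← map_mul, ← smul_eq_mul r, ← map_smul, ← Unitization.snd_smul, Algebra.smul_def]
        rfl }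
  let ι' := Unitization.inrNonUnitalAlgHom k (RepetitiveAlgebra k Λ)
  refine ⟨T, LinearMap.ext fun y => funext fun t => Subtype.ext ?_⟩
  let g : (RepMod.corner k Λ n N).obj →+ RepetitiveAlgebraUnit k Λ :=
    ⟨⟨fun y => ((y : n → cornerIdeal k Λ N) t).1, rfl⟩, fun _ _ => rfl⟩
  obtain ⟨z, hz⟩ : ∃ z, z = (g y).snd := ⟨_, rfl⟩
  have hy : g y = ι' z := by
    rw [hz]
    exact (inr_snd_of_mem_cornerIdeal ((y : n → cornerIdeal k Λ N) t).2).symm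
  have hze : z * localUnit N = z := by
    rw [hz]
    exact snd_mul_localUnit_of_mem_cornerIdeal ((y : n → cornerIdeal k Λ N) t).2
  have hT : ∀ x x' : RepetitiveAlgebra k Λ, g ((Unitization.inr x : RepetitiveAlgebraUnit k Λ) •
      T ((Unitization.inr x' : RepetitiveAlgebraUnit k Λ) • y)) =
        ι' ((trace (x' * z) • x) * localUnit N) := by
    intro x x'
    change Unitization.inr x * (algebraMap k (RepetitiveAlgebraUnit k Λ)
      (trace ((Unitization.inr x' : RepetitiveAlgebraUnit k Λ) * g y).snd) *
        Unitization.inr (localUnit N)) = Unitization.inr _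
    rw [hy]
    change _ * (algebraMap k _ (trace (_ * Unitization.inr z : RepetitiveAlgebraUnit k Λ).snd) * _) = _
    rw [← Unitization.inr_mul, Unitization.snd_inr, ← mul_assoc,
      ← Algebra.commutes, ← Algebra.smul_def, ← Unitization.inr_smul, ← Unitization.inr_mul]
  change g (casimir c _ _ T y) = g y
  rw [RepMod.casimir_action_apply]
  simp only [map_sum, map_add, hT]
  simp only [← map_add, ← map_sum, ← add_mul, ← Finset.sum_mul]
  rw [sum_trace_smul c hze, hze, hy]

/-- The endomorphisms which factor through a projective object are in the image of the Casimir
operator. -/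
theorem RepMod.exists_casimir_eq_of_mem_projectiveEnd [FiniteDimensional k Λ] {V : RepMod k Λ}
    {ι : Type*} [Fintype ι] (c : Module.Basis ι k Λ) {f : V ⟶ V} (hf : f ∈ projectiveEnd V) :
    ∃ J T, casimir c J V.action T = f.hom.hom.restrictScalars k := by
  obtain ⟨P, hP, a, a', rfl⟩ := hf
  have := P.finite
  let bP := Module.finBasis k P.obj
  obtain ⟨N, hN⟩ := RepMod.exists_surjective_cornerLift bP
  let F := RepMod.corner k Λ (Fin (Module.finrank k P.obj)) N
  let π : F ⟶ P := ObjectProperty.homMk (ModuleCat.ofHom (cornerLift N bP))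
  have : Epi π := RepMod.epi_of_surjective π hN
  obtain ⟨T, hT⟩ := RepMod.exists_casimir_corner_eq (n := Fin (Module.finrank k P.obj)) c N
  -- Since `P` is projective, `π` splits, so the given map factors through `(Λ̂ e) ^ n` as `α ≫ β`.
  -- Sandwiching `T` between `α` and `β` commutes with the Casimir operator, by `Λ̂`-linearity.
  let α : V ⟶ F := a ≫ Projective.factorThru (𝟙 P) π
  let β : F ⟶ V := π ≫ a'
  have hαβ : a ≫ a' = α ≫ β := by simp [α, β]
  refine ⟨Finset.Icc (-(N : ℤ)) N, β.hom.hom.restrictScalars k ∘ₗ T ∘ₗ α.hom.hom.restrictScalars k,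
    LinearMap.ext fun v => ?_⟩
  have h : ∀ x x' v, (Unitization.inr x : RepetitiveAlgebraUnit k Λ) •
      (β.hom.hom.restrictScalars k ∘ₗ T ∘ₗ α.hom.hom.restrictScalars k)
        ((Unitization.inr x' : RepetitiveAlgebraUnit k Λ) • v) =
      β.hom.hom ((Unitization.inr x : RepetitiveAlgebraUnit k Λ) •
        T ((Unitization.inr x' : RepetitiveAlgebraUnit k Λ) • α.hom.hom v)) := fun x x' v => by
    rw [map_smul β.hom.hom, ← map_smul α.hom.hom]
    rfl
  rw [RepMod.casimir_action_apply, hαβ]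
  simp only [h, ← map_add, ← map_sum]
  rw [← RepMod.casimir_action_apply, hT]
  rfl

/-- An endomorphism is a scalar plus a Casimir image. Both make sense for every framed deformation
`ρ` and commute with it by `mul_casimir`. -/
theorem centralizerLifts_repMatrix [FiniteDimensional k Λ] {V : RepMod k Λ} {n : Type} [Fintype n]
    [DecidableEq n] (b : Module.Basis n k V.obj) (hV : StableEndEqBase V) :
    CentralizerLifts (repMatrix b) := by
  intro R ρ f hf
  let φ : V ⟶ V := ObjectProperty.homMk (ModuleCat.ofHom
    (linearMapOfAction (Matrix.toLin b b f) fun x v => by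
      rw [← toLin_repMatrix_apply b, ← toLin_repMatrix_apply b, ← LinearMap.comp_apply,
        ← LinearMap.comp_apply, ← Matrix.toLin_mul, ← Matrix.toLin_mul, hf]))
  have hφ : ∀ v, φ.hom.hom v = Matrix.toLin b b f v := fun v => rfl
  obtain ⟨r, hr⟩ := hV.2 ((projectiveEnd V).mkQ φ)
  let c := Module.finBasis k Λ
  obtain ⟨J, T, hT⟩ := RepMod.exists_casimir_eq_of_mem_projectiveEnd c
    ((Submodule.Quotient.eq _).1 hr.symm)
  have hf' : f = r • 1 + casimir c J (repMatrix b) (LinearMap.toMatrix b b T) := by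
    have h := map_casimir c J (LinearMap.toMatrixAlgEquiv b : Module.End k V.obj →ₐ[k] _) V.action
      T (repMatrix b) fun _ => rfl
    refine Eq.trans ?_ (congrArg (r • 1 + ·) h)
    rw [hT]
    refine (Matrix.toLin b b).injective (LinearMap.ext fun v => ?_)
    rw [map_add, map_smul, Matrix.toLin_one, LinearMap.add_apply, LinearMap.smul_apply,
      LinearMap.id_apply]
    refine Eq.trans ?_ (congrArg (r • v + ·) (LinearMap.congr_fun
      (Matrix.toLin_toMatrix b b ((φ - r • 𝟙 V).hom.hom.restrictScalars k)) v)).symm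
    change φ.hom.hom v = r • v + (φ.hom.hom v - r • v)
    abel
  -- The operator `T` may be lifted arbitrarily, for instance along `k → R`, since Casimir images
  -- commute with `ρ` whatever `T` is.
  refine ⟨r • 1 + casimir c J ρ.rep ((LinearMap.toMatrix b b T).map (algebraMap k R)), ?_,
    fun x => ?_⟩
  · rw [map_add, map_smul, map_one, map_casimir c J (aug R).mapMatrix ρ.rep _ _ ρ.aug_rep, hf']
    congr 2
    ext i j
    exact aug_algebraMap R _
  · rw [add_mul, mul_add, mul_casimir, smul_mul_assoc, one_mul, mul_smul_comm, mul_one]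

theorem RepMod.exists_basis (V : RepMod k Λ) : ∃ d : ℕ, Nonempty (Module.Basis (Fin d) k V.obj) :=
  have := V.finite
  ⟨_, ⟨Module.finBasis k V.obj⟩⟩

end StableEndomorphisms

theorem proposition3p17 {k Λ : Type u} [Field k] [IsAlgClosed k] [Ring Λ] [Algebra k Λ]
    [FiniteDimensional k Λ] (V : RepMod k Λ) :
    (∃ (R : CHat k) (ξ : (defFunctor V).obj R), IsHull (defFunctor V) R ξ) ∧
    IsContinuous (defFunctor V) ∧
    (∃ (_ : AddCommGroup (FunctorTangentSpace (defFunctor V)))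
      (_ : Module k (FunctorTangentSpace (defFunctor V))),
      IsTangentStructure (defFunctor V) ∧
        Nonempty (FunctorTangentSpace (defFunctor V) ≃ₗ[k] Abelian.Ext V V 1)) ∧
    (StableEndEqBase V → ∀ (R : CHat k) (ξ : (defFunctor V).obj R),
      IsHull (defFunctor V) R ξ → Represents (defFunctor V) R ξ) := by
  obtain ⟨d, ⟨b⟩⟩ := V.exists_basis
  let P := defFunctorPresentation b
  have hfd := finitelyDetermined_repMatrix b
  refine ⟨P.exists_isHull hfd, P.isContinuous hfd, ?_,
    fun hV => P.represents hfd (centralizerLifts_repMatrix b hV)⟩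
  obtain ⟨hg, hm, ht, ⟨e⟩⟩ := P.exists_isTangentStructure
  obtain ⟨e'⟩ := nonempty_ext_linearEquiv_repH1 b
  exact ⟨hg, hm, ht, ⟨e.trans e'.symm⟩⟩
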